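/- Work on $\mathbb R^2$ with $\langle x\rangle=\sqrt{1+|x|^2}$, $\hat f(\xi)=\int_{\mathbb R^2}e^{-ix\cdot\xi}f(x)\,dx$, let $\sigma(\nabla)$ denote Fourier multipliers (so $\langle\nabla\rangle$ has symbol $\langle\xi\rangle$), and $\|w\|_{H^k}=\|\langle\nabla\rangle^k w\|_{L^2}$. For a scalar function $u(t,x)$ and a vector field $v(t,x)\in\mathbb C^2$ put $$G_1(u,v)=\nabla\cdot\big((v\cdot\nabla)v+u\nabla u\big)-\partial_t\big(v\cdot\nabla u+u\,\nabla\cdot v\big),$$ $$G_2(u,v)=\nabla\big(v\cdot\nabla u+u\,\nabla\cdot v\big)-\partial_t\big((v\cdot\nabla)v+u\nabla u\big)-\nabla\Delta^{-1}\nabla\cdot(uv).$$ For every integer $m\ge 0$ there is a constant $C$, depending only on $m$, such that the following holds. Let $f_1,g_1:\mathbb R^2\to\mathbb C$ and $f_2,g_2:\mathbb R^2\to\mathbb C^2$ be integrable functions whose Fourier transforms are $C^2$ and satisfy $$N:=\sup_{\xi\in\mathbb R^2}\langle\xi\rangle^{m+24}\sum_{i=1,2}\ \sum_{|\alpha|\le2}\big(|\partial_\xi^\alpha\hat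 f_i(\xi)|+|\partial_\xi^\alpha\hat g_i(\xi)|\big)<\infty .$$ Let $h_i(t)=\cos(t\langle\nabla\rangle)f_i+\frac{\sin(t\langle\nabla\rangle)}{\langle\nabla\rangle}g_i$ for $i=1,2$ be the linear Klein--Gordon solutions with these data. Then, for every $t\in\mathbb R$ and $i=1,2$, $G_i(h_1,h_2)(s)\in L^2$ for all $s$, the Duhamel integral from infinity $$\Phi_i(t)=\int_\infty^t\frac{\sin((t-s)\langle\nabla\rangle)}{\langle\nabla\rangle}\,G_i(h_1,h_2)(s)\,ds:=\lim_{T\to\infty}\int_T^t\frac{\sin((t-s)\langle\nabla\rangle)}{\langle\nabla\rangle}\,G_i(h_1,h_2)(s)\,ds$$ exists as a limit in $L^2$ of $L^2$-valued integrals, $\Phi_i$ is differentiable in $t$ with values in $L^2$, and $$\langle t\rangle\big(\|\Phi_i(t)\|_{H^{m+2}}+\|\partial_t\Phi_i(t)\|_{H^{m+2}}\big)\le C\,N^2 .$$ -/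

import Mathlib

open MeasureTheory Filter Topology
open scoped FourierTransform ENNReal NNReal

noncomputable section

namespace EulerPoisson

/-- The plane `ℝ²` with its Euclidean norm. -/
abbrev Plane : Type := EuclideanSpace ℝ (Fin 2)

/-- Values of vector fields, with the Euclidean norm. -/
abbrev Vec : Type := EuclideanSpace ℂ (Fin 2)

/-- Complex-valued square-integrable functions on the plane. -/
abbrev L2Scalar : Type := Lp (α := Plane) ℂ 2

/-- Square-integrable vector fields on the plane. -/
abbrev L2Vec : Type := Lp (α := Plane) Vec 2

/-- The Japanese bracket `⟨x⟩ = √(1 + |x|²)`. -/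
def bracket {W : Type*} [NormedAddCommGroup W] (x : W) : ℝ := √(1 + ‖x‖ ^ 2)

section General

variable {F : Type*} [NormedAddCommGroup F] [InnerProductSpace ℂ F] [CompleteSpace F]

/-- The partial derivative `∂_j`. -/
def pd (j : Fin 2) (w : Plane → F) (x : Plane) : F :=
  fderiv ℝ w x (EuclideanSpace.single j 1)

/-- The Fourier transform in angular frequency, `f̂(ξ) = ∫ e^{-i x·ξ} f(x) dx`.
Mathlib's transform is `𝓕 f ζ = ∫ e^{-2πi x·ζ} f(x) dx`. -/
def hat (f : Plane → F) (ξ : Plane) : F := 𝓕 f ((2 * Real.pi)⁻¹ • ξ)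

/-- The operator `σ(∇/i)` on integrable functions `f` whose transform is integrable against `σ`,
evaluated pointwise; the symbol `σ` is a function of the angular frequency. -/
def multiplier (σ : Plane → ℝ) (f : Plane → F) : Plane → F :=
  𝓕⁻ (fun ζ : Plane => (σ ((2 * Real.pi) • ζ) : ℂ) • 𝓕 f ζ)

/-- The linear Klein–Gordon solution `cos(t⟨∇⟩) f + (sin(t⟨∇⟩)/⟨∇⟩) g`. -/
def linearSol (f g : Plane → F) (t : ℝ) (x : Plane) : F :=
  multiplier (fun ξ => Real.cos (t * bracket ξ)) f x
    + multiplier (fun ξ => Real.sin (t * bracket ξ) / bracket ξ) g x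

open Classical in
/-- The class in `L²` of a square-integrable function (and `0` for other functions). -/
def toL2 (f : Plane → F) : Lp (α := Plane) F 2 :=
  if h : MemLp f 2 (volume : Measure Plane) then h.toLp f else 0

/-- The Fourier multiplier on `L²` with the bounded (possibly matrix-valued) symbol `M`, a function
of the angular frequency. The Fourier transform here is the one on `L²`. -/
def l2Multiplier (M : Plane → F → F) (u : Lp (α := Plane) F 2) : Lp (α := Plane) F 2 :=
  𝓕⁻ (toL2 (fun ζ : Plane => M ((2 * Real.pi) • ζ) ((𝓕 u : Lp F 2 (volume : Measure Plane)) ζ)))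

/-- The Klein–Gordon propagator `sin(t⟨∇⟩)/⟨∇⟩` on `L²`. -/
def propagator (t : ℝ) : Lp (α := Plane) F 2 → Lp (α := Plane) F 2 :=
  l2Multiplier (fun ξ v => ((Real.sin (t * bracket ξ) / bracket ξ : ℝ) : ℂ) • v)

/-- The norm of the Sobolev space `H^k`, namely `‖⟨∇⟩^k u‖_{L²}`; it is `∞` off `H^k`. -/
def sobolevNorm (k : ℕ) (u : Lp (α := Plane) F 2) : ℝ≥0∞ :=
  eLpNorm (fun ζ : Plane =>
    (bracket ((2 * Real.pi) • ζ) ^ k : ℝ) • (𝓕 u : Lp F 2 (volume : Measure Plane)) ζ) 2 volume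

/-- The Duhamel integral `∫_T^t (sin((t-s)⟨∇⟩)/⟨∇⟩) G(s) ds`, as an integral in `L²`. -/
def duhamel (G : ℝ → Lp (α := Plane) F 2) (T t : ℝ) : Lp (α := Plane) F 2 :=
  ∫ s in T..t, propagator (t - s) (G s)

/-- The Duhamel integral from infinity, `lim_{T → ∞} ∫_T^t (sin((t-s)⟨∇⟩)/⟨∇⟩) G(s) ds`. -/
def duhamelInfty (G : ℝ → Lp (α := Plane) F 2) (t : ℝ) : Lp (α := Plane) F 2 :=
  limUnder atTop (fun T : ℝ => duhamel G T t)

/-- `∑_{|α| ≤ 2} |∂^α w(ξ)|`, the sum over multi-indices `α` in two variables. -/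
def jetSum (w : Plane → F) (ξ : Plane) : ℝ :=
  ∑ k ∈ Finset.range 3, ∑ α ∈ Finset.HasAntidiagonal.antidiagonal k, ‖((pd 0)^[α.1] ((pd 1)^[α.2] w)) ξ‖

/-- `(v · ∇) w`. -/
def advect (v : Plane → Vec) (w : Plane → F) (x : Plane) : F := ∑ k, v x k • pd k w x

end General

/-- The gradient of a scalar function. -/
def grad (u : Plane → ℂ) (x : Plane) : Vec := WithLp.toLp 2 (fun j => pd j u x)

/-- The divergence of a vector field. -/
def divergence (v : Plane → Vec) (x : Plane) : ℂ := ∑ j, pd j v x j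

/-- `(v · ∇) v + u ∇u`. -/
def momentumFlux (u : Plane → ℂ) (v : Plane → Vec) (x : Plane) : Vec :=
  advect v v x + u x • grad u x

/-- `v · ∇u + u ∇ · v`. -/
def massFlux (u : Plane → ℂ) (v : Plane → Vec) (x : Plane) : ℂ :=
  advect v u x + u x * divergence v x

/-- The nonlinearity `G₁(u,v) = ∇·((v·∇)v + u∇u) - ∂_t(v·∇u + u∇·v)`. -/
def G₁ (u : ℝ → Plane → ℂ) (v : ℝ → Plane → Vec) (t : ℝ) (x : Plane) : ℂ :=
  divergence (momentumFlux (u t) (v t)) x - deriv (fun s => massFlux (u s) (v s) x) t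

/-- The local part `∇(v·∇u + u∇·v) - ∂_t((v·∇)v + u∇u)` of `G₂(u,v)`. -/
def G₂local (u : ℝ → Plane → ℂ) (v : ℝ → Plane → Vec) (t : ℝ) (x : Plane) : Vec :=
  grad (massFlux (u t) (v t)) x - deriv (fun s => momentumFlux (u s) (v s) x) t

/-- The operator `∇ Δ⁻¹ ∇·` on `L²` vector fields: its symbol sends `v` to
`(iξ) (-|ξ|²)⁻¹ (iξ · v)`. -/
def gradInvLapDiv : L2Vec → L2Vec :=
  l2Multiplier (fun ξ v => WithLp.toLp 2 (fun j =>
    (Complex.I * (ξ j : ℂ)) * (-((‖ξ‖ : ℂ) ^ 2))⁻¹ * ∑ k, (Complex.I * (ξ k : ℂ)) * v k))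

/-- `G₁(u,v)(t)` as an element of `L²`. -/
def G₁L2 (u : ℝ → Plane → ℂ) (v : ℝ → Plane → Vec) (t : ℝ) : L2Scalar := toL2 (G₁ u v t)

/-- `G₂(u,v)(t) = ∇(v·∇u + u∇·v) - ∂_t((v·∇)v + u∇u) - ∇Δ⁻¹∇·(uv)` as an element of `L²`. -/
def G₂L2 (u : ℝ → Plane → ℂ) (v : ℝ → Plane → Vec) (t : ℝ) : L2Vec :=
  toL2 (G₂local u v t) - gradInvLapDiv (toL2 (fun x => u t x • v t x))

/-- The resonant part `Φ₁` for the final data `(f₁,g₁,f₂,g₂)`. -/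
def Φ₁ (f₁ g₁ : Plane → ℂ) (f₂ g₂ : Plane → Vec) : ℝ → L2Scalar :=
  duhamelInfty (G₁L2 (linearSol f₁ g₁) (linearSol f₂ g₂))

/-- The resonant part `Φ₂` for the final data `(f₁,g₁,f₂,g₂)`. -/
def Φ₂ (f₁ g₁ : Plane → ℂ) (f₂ g₂ : Plane → Vec) : ℝ → L2Vec :=
  duhamelInfty (G₂L2 (linearSol f₁ g₁) (linearSol f₂ g₂))

/-- `sup_ξ ⟨ξ⟩^{m+24} ∑_{|α| ≤ 2, i = 1,2} (|∂^α f̂_i(ξ)| + |∂^α ĝ_i(ξ)|)`, possibly infinite. -/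
def dataNorm (m : ℕ) (f₁ g₁ : Plane → ℂ) (f₂ g₂ : Plane → Vec) : ℝ≥0∞ :=
  ⨆ ξ : Plane, ENNReal.ofReal (bracket ξ ^ (m + 24) *
    (jetSum (hat f₁) ξ + jetSum (hat f₂) ξ + jetSum (hat g₁) ξ + jetSum (hat g₂) ξ))

end EulerPoisson

end

open EulerPoisson

open MeasureTheory Filter Topology
open scoped FourierTransform ENNReal NNReal Convolution

set_option linter.unusedSectionVars false

noncomputable section

namespace EulerPoisson

/-! ### The Fourier transform on `L²` and its agreement with the Fourier integral -/

section FourierL2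

variable {F : Type*} [NormedAddCommGroup F] [InnerProductSpace ℂ F] [CompleteSpace F]

/-! Each component of a linear Klein–Gordon solution is a sum of two half waves `e^{±it⟨∇⟩}` with
smooth, rapidly decaying amplitudes, and the nonlinearities are finite sums of products of such
waves and their derivatives, up to the bounded multiplier `∇Δ⁻¹∇·`. So it suffices to treat one
product of half waves. Its Fourier transform at time `s` is, up to a constant, `g(s,ξ) = ∫ e^{isφ}
A(η) B(ξ-η) dη` with `φ = ε⟨η⟩ + ε'⟨ξ-η⟩` and signs `ε, ε'`.

The Duhamel integral solves `Q'' + ⟨ξ⟩² Q = g` at each frequency. One solution is explicit: divide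
the integrand by `⟨ξ⟩² - φ²`. The quotient is harmless because `|⟨ξ⟩² - φ²| ≥ 1` everywhere
(`one_le_abs_resSymbol`, a Cauchy–Schwarz inequality): there are no time resonances. If this `Q` and
its time derivative tend to zero in `L²`, the boundary term at `T` in the Duhamel integral
disappears as `T → ∞`, and `Q` is the transform of the integral from infinity
(`IsDecayingSolution.duhamelInfty_eq`). Everything is thus reduced to showing that `Q` has weighted
`L²` norm `O(⟨s⟩⁻¹)`; the time derivative is an integral of the same kind.

That decay comes from oscillation in `η`. For equal signs the phase is stationary only at `η = ξ/2`.
In polar coordinates about that point the Jacobian `ρ` compensates the vanishing of the gradient,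
and one integration by parts gives `|s|⁻¹` (`exists_osc_plus_bound`). For opposite signs the phase
has no stationary point unless `ξ = 0`; two integrations by parts in the direction of `ξ` give `(1 +
s²|ξ|²)⁻¹` (`exists_osc_minus_bound`). This does not decay uniformly in `ξ`, but in dimension two
its `L²` norm in `ξ` is again of size `|s|⁻¹`. `decayWeight` records both behaviours.

The integrations by parts never divide by the gradient of the phase. The identities
`ampBase_neg_one_mul` and `ampBase_one_mul` provide explicit amplitudes of polynomial growth whose
product with the directional derivative of the phase is exactly `|ξ|`, respectively `ρ`. Polynomial
losses in `⟨η⟩⟨ξ-η⟩` are paid for by the decay of the data. -/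

theorem integral_fourierInv_smul_eq (φ : Plane → ℂ) (a : Plane → F) (hφ : Integrable φ)
    (ha : Integrable a) : ∫ ξ, 𝓕⁻ φ ξ • a ξ = ∫ x, φ x • 𝓕⁻ a x := by
  have h := VectorFourier.integral_fourierIntegral_smul_eq_flip (μ := (volume : Measure Plane))
    (ν := (volume : Measure Plane)) (L := -innerₗ Plane) (e := Real.fourierChar) (f := φ) (g := a)
    Real.continuous_fourierChar (by simp only [LinearMap.neg_apply, innerₗ_apply_apply]; fun_prop) hφ ha
  have hflip : (-innerₗ Plane).flip = -innerₗ Plane := by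
    ext x y
    simp [real_inner_comm]
  rw [hflip] at h
  exact h

/-- On integrable square-integrable functions the inverse Fourier transform of `L²` is given by the
Fourier integral. -/
theorem fourierInv_toLp_ae_eq {a : Plane → F} (h1 : Integrable a)
    (h2 : MemLp a 2 (volume : Measure Plane)) :
    ((𝓕⁻ (h2.toLp a) : Lp F 2 (volume : Measure Plane)) : Plane → F) =ᵐ[volume] 𝓕⁻ a := by
  set u : Lp F 2 (volume : Measure Plane) := 𝓕⁻ (h2.toLp a) with hu
  refine ae_eq_of_integral_contDiff_smul_eq
    ((Lp.memLp u).locallyIntegrable (by norm_num)) ?_ ?_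
  · have : Continuous (𝓕⁻ a) := by
      rw [show 𝓕⁻ a = VectorFourier.fourierIntegral Real.fourierChar volume (-innerₗ Plane) a from
        by ext x; rfl]
      exact VectorFourier.fourierIntegral_continuous Real.continuous_fourierChar
        (by simp only [LinearMap.neg_apply, innerₗ_apply_apply]; fun_prop) h1
    exact this.locallyIntegrable
  intro g hg hgs
  have hgc : ContDiff ℝ ((⊤ : ℕ∞) : WithTop ℕ∞) (fun x => (g x : ℂ)) := Complex.ofRealCLM.contDiff.comp hg
  have hgcs : HasCompactSupport (fun x => (g x : ℂ)) := hgs.comp_left (g := fun r : ℝ => (r : ℂ)) rfl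
  let φ : SchwartzMap Plane ℂ := hgcs.toSchwartzMap hgc
  have hφ : ∀ x, φ x = (g x : ℂ) := fun x => rfl
  -- The `L²` transform agrees with the one on tempered distributions; against a test function the
  -- transform then moves to the other factor, for both candidates alike.
  have h := congrArg (fun T => T φ) (Lp.fourierInv_toTemperedDistribution_eq (h2.toLp a))
  simp only [TemperedDistribution.fourierInv_apply, Lp.toTemperedDistribution_apply] at h
  have l : ∫ x, (𝓕⁻ φ : SchwartzMap Plane ℂ) x • (h2.toLp a) x = ∫ x, φ x • 𝓕⁻ a x := by
    rw [← integral_fourierInv_smul_eq _ _ φ.integrable h1]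
    refine integral_congr_ae ?_
    filter_upwards [h2.coeFn_toLp] with x hx
    rw [hx, SchwartzMap.fourierInv_coe]
  rw [l] at h
  simp only [hφ, Complex.coe_smul] at h
  exact h.symm

theorem memLp_fourierInv {a : Plane → F} (h1 : Integrable a)
    (h2 : MemLp a 2 (volume : Measure Plane)) : MemLp (𝓕⁻ a) 2 (volume : Measure Plane) :=
  (memLp_congr_ae (fourierInv_toLp_ae_eq h1 h2)).1 (Lp.memLp _)

theorem toL2_of_memLp {a : Plane → F} (h : MemLp a 2 (volume : Measure Plane)) :
    toL2 a = h.toLp a := by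
  rw [toL2, dif_pos h]

theorem toL2_fourierInv {a : Plane → F} (h1 : Integrable a)
    (h2 : MemLp a 2 (volume : Measure Plane)) : toL2 (𝓕⁻ a) = 𝓕⁻ (toL2 a) := by
  rw [toL2_of_memLp (memLp_fourierInv h1 h2), toL2_of_memLp h2]
  refine Lp.ext ?_
  exact (MemLp.coeFn_toLp _).trans (fourierInv_toLp_ae_eq h1 h2).symm

theorem toL2_add {a b : Plane → F} (ha : MemLp a 2 (volume : Measure Plane))
    (hb : MemLp b 2 (volume : Measure Plane)) : toL2 (fun x => a x + b x) = toL2 a + toL2 b := by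
  rw [toL2_of_memLp ha, toL2_of_memLp hb, ← MemLp.toLp_add ha hb]
  exact toL2_of_memLp (ha.add hb)

theorem toL2_sub {a b : Plane → F} (ha : MemLp a 2 (volume : Measure Plane))
    (hb : MemLp b 2 (volume : Measure Plane)) : toL2 (fun x => a x - b x) = toL2 a - toL2 b := by
  rw [toL2_of_memLp ha, toL2_of_memLp hb, ← MemLp.toLp_sub ha hb]
  exact toL2_of_memLp (ha.sub hb)

theorem toL2_congr {a b : Plane → F} (h : a =ᵐ[volume] b) : toL2 a = toL2 b := by
  by_cases ha : MemLp a 2 (volume : Measure Plane)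
  · have hb := (memLp_congr_ae h).1 ha
    rw [toL2_of_memLp ha, toL2_of_memLp hb]
    exact MemLp.toLp_congr _ _ h
  · have hb : ¬ MemLp b 2 (volume : Measure Plane) := fun hb => ha ((memLp_congr_ae h).2 hb)
    rw [toL2, toL2, dif_neg ha, dif_neg hb]

theorem coeFn_toL2 {a : Plane → F} (h : MemLp a 2 (volume : Measure Plane)) :
    (toL2 a : Plane → F) =ᵐ[volume] a := by
  rw [toL2_of_memLp h]
  exact h.coeFn_toLp

theorem norm_toL2 {a : Plane → F} (h : MemLp a 2 (volume : Measure Plane)) :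
    ENNReal.ofReal ‖toL2 a‖ = eLpNorm a 2 (volume : Measure Plane) := by
  rw [toL2_of_memLp h, Lp.norm_toLp, ENNReal.ofReal_toReal h.2.ne]

end FourierL2

/-! ### The Japanese bracket and the integrability of its negative powers on the plane -/

section Bracket

variable {W : Type*} [NormedAddCommGroup W]

theorem bracket_sq (x : W) : bracket x ^ 2 = 1 + ‖x‖ ^ 2 :=
  Real.sq_sqrt (by positivity)

theorem one_le_bracket (x : W) : 1 ≤ bracket x := by
  rw [bracket, Real.one_le_sqrt]
  nlinarith [sq_nonneg ‖x‖]

theorem bracket_pos (x : W) : 0 < bracket x := lt_of_lt_of_le one_pos (one_le_bracket x)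

theorem norm_le_bracket (x : W) : ‖x‖ ≤ bracket x :=
  Real.le_sqrt_of_sq_le (by linarith)

theorem continuous_bracket : Continuous (bracket : W → ℝ) := by
  unfold bracket
  fun_prop

theorem integrable_inv_bracket_pow {k : ℕ} (hk : 3 ≤ k) :
    Integrable (fun ξ : Plane => (bracket ξ ^ k)⁻¹) := by
  have h := integrable_rpow_neg_one_add_norm_sq (E := Plane) (μ := volume) (r := (k : ℝ))
    (by rw [finrank_euclideanSpace_fin]; exact_mod_cast (by omega : 2 < k))
  refine h.congr (Eventually.of_forall fun x => ?_)
  have h0 : (0 : ℝ) ≤ 1 + ‖x‖ ^ 2 := by positivity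
  change (1 + ‖x‖ ^ 2) ^ (-(k : ℝ) / 2) = (bracket x ^ k)⁻¹
  rw [show bracket x = (1 + ‖x‖ ^ 2) ^ (1 / 2 : ℝ) from Real.sqrt_eq_rpow _, ← Real.rpow_natCast _ k, ← Real.rpow_mul h0, ← Real.rpow_neg h0]
  congr 1
  ring

theorem memLp_inv_bracket_pow {k : ℕ} (hk : 2 ≤ k) :
    MemLp (fun ξ : Plane => (bracket ξ ^ k)⁻¹) 2 (volume : Measure Plane) := by
  have hc : Continuous (fun ξ : Plane => (bracket ξ ^ k)⁻¹) :=
    (continuous_bracket.pow k).inv₀ fun x => (pow_pos (bracket_pos x) k).ne'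
  rw [memLp_two_iff_integrable_sq hc.aestronglyMeasurable]
  refine (integrable_inv_bracket_pow (k := k * 2) (by omega)).congr
    (Eventually.of_forall fun x => ?_)
  simp only [pow_mul, inv_pow]

end Bracket

/-! ### Passage between frequency and angular frequency -/

section Dilation

variable {F : Type*} [NormedAddCommGroup F]

/-- The dilation turning a function of the angular frequency into one of the frequency. -/
def dil (a : Plane → F) (ζ : Plane) : F := a ((2 * Real.pi) • ζ)

theorem integrable_dil {a : Plane → F} (h : Integrable a) : Integrable (dil a) :=
  h.comp_smul (by positivity)

/-- The Jacobian `r⁻²` of the plane becomes `r⁻¹` under the square root. With `r = ⟨s⟩` this is the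
source of the time decay for waves of opposite signs. -/
theorem eLpNorm_comp_smul (f : Plane → F) {r : ℝ} (hr : 0 < r) :
    eLpNorm (fun x => f (r • x)) 2 volume = ENNReal.ofReal r⁻¹ * eLpNorm f 2 volume := by
  have hmap : Measure.map (r • ·) (volume : Measure Plane)
      = ENNReal.ofReal |(r ^ Module.finrank ℝ Plane)⁻¹| • volume :=
    Measure.map_addHaar_smul volume hr.ne'
  have hemb : MeasurableEmbedding (fun x : Plane => r • x) :=
    (Homeomorph.smulOfNeZero r hr.ne').measurableEmbedding
  have h1 : eLpNorm (fun x => f (r • x)) 2 volume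
      = eLpNorm f 2 (Measure.map (r • ·) (volume : Measure Plane)) :=
    (hemb.eLpNorm_map_measure).symm
  rw [h1, hmap, eLpNorm_smul_measure_of_ne_top (by norm_num), finrank_euclideanSpace_fin, smul_eq_mul]
  congr 1
  rw [abs_of_pos (by positivity), ENNReal.ofReal_rpow_of_pos (by positivity)]
  congr 1
  rw [← inv_pow]
  have h2 : (1 / 2 : ℝ≥0∞).toReal = ((2 : ℕ) : ℝ)⁻¹ := by simp
  rw [h2]
  exact Real.pow_rpow_inv_natCast (n := 2) (by positivity) (by norm_num)

theorem memLp_dil {a : Plane → F} (h : MemLp a 2 (volume : Measure Plane)) :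
    MemLp (dil a) 2 (volume : Measure Plane) := by
  have hp : (0 : ℝ) < 2 * Real.pi := by positivity
  refine ⟨?_, ?_⟩
  · refine h.1.comp_quasiMeasurePreserving ⟨by fun_prop, ?_⟩
    rw [Measure.map_addHaar_smul volume hp.ne']
    exact Measure.smul_absolutelyContinuous
  · have := eLpNorm_comp_smul a hp
    rw [show dil a = fun x => a ((2 * Real.pi) • x) from rfl, this]
    exact ENNReal.mul_lt_top ENNReal.ofReal_lt_top h.2

end Dilation

/-! ### From pointwise derivatives in time to derivatives in `L²` -/

section DerivL2

variable {F : Type*} [NormedAddCommGroup F] [InnerProductSpace ℂ F] [CompleteSpace F]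

theorem norm_toL2_le {a : Plane → F} {W : Plane → ℝ} (ha : MemLp a 2 (volume : Measure Plane))
    (hW : MemLp W 2 (volume : Measure Plane)) {c : ℝ} (hc : 0 ≤ c) (h : ∀ x, ‖a x‖ ≤ c * W x) :
    ‖toL2 a‖ ≤ c * (eLpNorm W 2 volume).toReal := by
  rw [toL2_of_memLp ha, Lp.norm_toLp]
  have h1 := eLpNorm_le_mul_eLpNorm_of_ae_le_mul (μ := volume) (f := a) (g := W) (c := c)
    (Eventually.of_forall fun x => (h x).trans
      (mul_le_mul_of_nonneg_left (Real.le_norm_self _) hc)) 2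
  have h2 := ENNReal.toReal_mono (ENNReal.mul_lt_top ENNReal.ofReal_lt_top hW.2).ne h1
  rwa [ENNReal.toReal_mul, ENNReal.toReal_ofReal hc] at h2

theorem continuous_toL2 {k : ℝ → Plane → F} {W : Plane → ℝ}
    (hW : MemLp W 2 (volume : Measure Plane)) (hk : ∀ s, MemLp (k s) 2 (volume : Measure Plane))
    (lip : ∀ s r x, ‖k s x - k r x‖ ≤ |s - r| * W x) : Continuous fun s => toL2 (k s) := by
  refine (LipschitzWith.of_dist_le_mul (K := (eLpNorm W 2 volume).toNNReal) fun s r => ?_).continuous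
  rw [dist_eq_norm, ← toL2_sub (hk s) (hk r), Real.dist_eq, mul_comm]
  exact norm_toL2_le ((hk s).sub (hk r)) hW (abs_nonneg _) (lip s r)

/-- A derivative that is Lipschitz in time with an `L²` weight has a Taylor remainder bounded
pointwise by `|r - s|² W`, so the difference quotients converge in `L²`. -/
theorem hasDerivAt_toL2 {k k' : ℝ → Plane → F} {W : Plane → ℝ}
    (hW : MemLp W 2 (volume : Measure Plane)) (hk : ∀ s, MemLp (k s) 2 (volume : Measure Plane))
    (hk' : ∀ s, MemLp (k' s) 2 (volume : Measure Plane))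
    (h : ∀ s x, HasDerivAt (fun s => k s x) (k' s x) s)
    (lip : ∀ s r x, ‖k' s x - k' r x‖ ≤ |s - r| * W x) (s : ℝ) :
    HasDerivAt (fun s => toL2 (k s)) (toL2 (k' s)) s := by
  have key : ∀ r x, ‖k r x - k s x - (r - s) • k' s x‖ ≤ |r - s| ^ 2 * W x := by
    intro r x
    have hd : ∀ y ∈ Set.uIcc s r, HasDerivWithinAt (fun y => k y x - (y - s) • k' s x)
        (k' y x - k' s x) (Set.uIcc s r) y := by
      intro y _
      have h1 : HasDerivAt (fun y : ℝ => (y - s) • k' s x) ((1 : ℝ) • k' s x) y :=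
        ((hasDerivAt_id y).sub_const s).smul_const (k' s x)
      rw [one_smul] at h1
      exact ((h y x).sub h1).hasDerivWithinAt
    have hW0 : 0 ≤ |r - s| * W x := (norm_nonneg _).trans (lip r s x)
    have := Convex.norm_image_sub_le_of_norm_hasDerivWithin_le (C := |r - s| * W x) hd
      (fun y hy => ?_) (convex_uIcc s r) Set.left_mem_uIcc Set.right_mem_uIcc
    · simp only [sub_self, zero_smul, sub_zero] at this
      calc _ = ‖k r x - (r - s) • k' s x - k s x‖ := by congr 1; abel
        _ ≤ _ := this
        _ = _ := by rw [Real.norm_eq_abs]; ring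
    · refine (lip y s x).trans ?_
      -- Nonnegativity of `W x` is not assumed; it follows from `lip` as soon as the two times
      -- differ.
      rcases eq_or_ne r s with rfl | hrs
      · simp only [Set.uIcc_self, Set.mem_singleton_iff] at hy
        simp [hy]
      · have hpos : 0 < |r - s| := abs_pos.2 (sub_ne_zero.2 hrs)
        have hWx : 0 ≤ W x := by
          by_contra hneg
          exact absurd hW0 (not_le.2 (mul_neg_of_pos_of_neg hpos (not_le.1 hneg)))
        exact mul_le_mul_of_nonneg_right (Set.abs_sub_left_of_mem_uIcc hy) hWx
  rw [hasDerivAt_iff_isLittleO]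
  have hO : (fun r => toL2 (k r) - toL2 (k s) - (r - s) • toL2 (k' s))
      =O[𝓝 s] fun r => (r - s) ^ 2 := by
    refine Asymptotics.IsBigO.of_bound (eLpNorm W 2 volume).toReal (Eventually.of_forall fun r => ?_)
    have hsm : MemLp (fun x => (r - s) • k' s x) 2 (volume : Measure Plane) := (hk' s).const_smul _
    have e : (r - s) • toL2 (k' s) = toL2 (fun x => (r - s) • k' s x) := by
      rw [toL2_of_memLp (hk' s), toL2_of_memLp hsm]
      exact (MemLp.toLp_const_smul (r - s) (hk' s)).symm
    have hsub : MemLp (fun x => k r x - k s x) 2 (volume : Measure Plane) := (hk r).sub (hk s)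
    rw [e, ← toL2_sub (hk r) (hk s), ← toL2_sub hsub hsm, Real.norm_eq_abs, abs_pow, mul_comm]
    exact norm_toL2_le (hsub.sub hsm) hW (by positivity) (key r)
  refine hO.trans_isLittleO ?_
  have := (Asymptotics.isLittleO_pow_id (𝕜 := ℝ) (n := 2) (by norm_num)).comp_tendsto
    (tendsto_sub_nhds_zero_iff.2 (tendsto_id (x := 𝓝 s)))
  exact this

end DerivL2

/-! ### The Duhamel integral from infinity as a forced oscillator at each frequency -/

section Duhamel

variable {F : Type*} [NormedAddCommGroup F] [InnerProductSpace ℂ F] [CompleteSpace F]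

/-- A profile of frequency decay whose `L²` norm in `ξ` is of size `⟨s⟩⁻¹`. -/
def decayWeight (s : ℝ) (ξ : Plane) : ℝ :=
  (bracket s)⁻¹ * (bracket ξ ^ 2)⁻¹ + (bracket (bracket s • ξ) ^ 2)⁻¹

theorem decayWeight_nonneg (s : ℝ) (ξ : Plane) : 0 ≤ decayWeight s ξ := by
  have h1 := bracket_pos s
  have h2 := bracket_pos ξ
  have h3 := bracket_pos (bracket s • ξ)
  unfold decayWeight
  positivity

theorem decayWeight_le (s : ℝ) (ξ : Plane) : decayWeight s ξ ≤ 2 * (bracket ξ ^ 2)⁻¹ := by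
  have h1 := one_le_bracket s
  have h2 := bracket_pos ξ
  have h3 : bracket ξ ^ 2 ≤ bracket (bracket s • ξ) ^ 2 := by
    rw [bracket_sq, bracket_sq, norm_smul, mul_pow, Real.norm_eq_abs, sq_abs]
    nlinarith [sq_nonneg ‖ξ‖, mul_nonneg (sq_nonneg ‖ξ‖) (by nlinarith : 0 ≤ bracket s ^ 2 - 1)]
  have h4 : (bracket (bracket s • ξ) ^ 2)⁻¹ ≤ (bracket ξ ^ 2)⁻¹ := inv_anti₀ (by positivity) h3
  have h5 : (bracket s)⁻¹ * (bracket ξ ^ 2)⁻¹ ≤ 1 * (bracket ξ ^ 2)⁻¹ :=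
    mul_le_mul_of_nonneg_right (inv_le_one_of_one_le₀ h1) (by positivity)
  unfold decayWeight
  linarith

/-- The `L²` norm of `⟨2πζ⟩⁻²`. -/
def bracketMass : ℝ≥0∞ := eLpNorm (dil fun ξ : Plane => (bracket ξ ^ 2)⁻¹) 2 volume

theorem bracketMass_lt_top : bracketMass < ∞ := (memLp_dil (memLp_inv_bracket_pow le_rfl)).2

/-- The second summand of the weight is `⟨·⟩⁻²` dilated by `⟨s⟩`, so both summands have norm `⟨s⟩⁻¹`
times `bracketMass`. -/
theorem eLpNorm_decayWeight_le (s : ℝ) :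
    eLpNorm (dil (decayWeight s)) 2 volume ≤ 2 * ENNReal.ofReal (bracket s)⁻¹ * bracketMass := by
  have hm := memLp_dil (memLp_inv_bracket_pow (k := 2) le_rfl)
  have e : dil (decayWeight s) = (bracket s)⁻¹ • (dil fun ξ : Plane => (bracket ξ ^ 2)⁻¹)
      + fun ζ => (dil fun ξ : Plane => (bracket ξ ^ 2)⁻¹) (bracket s • ζ) := by
    ext ζ
    simp only [dil, decayWeight, Pi.add_apply, Pi.smul_apply, smul_eq_mul]
    rw [smul_comm (bracket s) (2 * Real.pi) ζ]
  have hc : Continuous fun ζ => (dil fun ξ : Plane => (bracket ξ ^ 2)⁻¹) (bracket s • ζ) := by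
    unfold dil
    refine Continuous.inv₀ ?_ fun x => (pow_pos (bracket_pos _) _).ne'
    exact (continuous_bracket.comp (by fun_prop)).pow 2
  rw [e]
  refine (eLpNorm_add_le (hm.1.const_smul _) hc.aestronglyMeasurable (by norm_num)).trans ?_
  rw [eLpNorm_const_smul, eLpNorm_comp_smul _ (bracket_pos s), mul_assoc, two_mul]
  refine le_of_eq ?_
  rw [Real.enorm_eq_ofReal (inv_nonneg.2 (bracket_pos s).le)]
  rfl

/-- `Q` solves `Q'' + ⟨ξ⟩² Q = g` in each frequency, with the decay that makes `Q` the Fourier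
transform of the Duhamel integral of `g` from infinity; `Q₁` is the time derivative of `Q`. -/
structure IsDecayingSolution (m : ℕ) (D : ℝ) (g Q Q₁ : ℝ → Plane → F) : Prop where
  nonneg : 0 ≤ D
  meas : ∀ s, StronglyMeasurable (g s)
  measQ : ∀ s, StronglyMeasurable (Q s)
  measQ₁ : ∀ s, StronglyMeasurable (Q₁ s)
  deriv : ∀ s ξ, HasDerivAt (fun s => Q s ξ) (Q₁ s ξ) s
  deriv₁ : ∀ s ξ, HasDerivAt (fun s => Q₁ s ξ) (g s ξ - ((bracket ξ ^ 2 : ℝ) : ℂ) • Q s ξ) s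
  bound : ∀ s ξ, bracket ξ ^ (m + 2) * ‖Q s ξ‖ ≤ D * decayWeight s ξ
  bound₁ : ∀ s ξ, bracket ξ ^ (m + 2) * ‖Q₁ s ξ‖ ≤ D * decayWeight s ξ
  -- The last two fields are qualitative: their constants serve integrability and `L²`
  -- differentiability and do not enter the final estimate.
  source : ∃ B, ∀ s ξ, ‖g s ξ‖ ≤ B * (bracket ξ ^ 2)⁻¹
  source_lip : ∃ B, ∀ s r ξ, ‖g s ξ - g r ξ‖ ≤ |s - r| * (B * (bracket ξ ^ 2)⁻¹)

theorem norm_smul_sub_smul_le (a b : ℝ) (u v : F) :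
    ‖(a : ℂ) • u - (b : ℂ) • v‖ ≤ |a - b| * ‖u‖ + |b| * ‖u - v‖ := by
  have e : (a : ℂ) • u - (b : ℂ) • v = ((a - b : ℝ) : ℂ) • u + (b : ℂ) • (u - v) := by
    push_cast
    rw [sub_smul, smul_sub]
    abel
  rw [e]
  refine (norm_add_le _ _).trans (le_of_eq ?_)
  rw [norm_smul, norm_smul, Complex.norm_real, Complex.norm_real, Real.norm_eq_abs,
    Real.norm_eq_abs]

/-- The symbol of the propagator `sin(t⟨∇⟩)/⟨∇⟩`. -/
def propSymbol (t : ℝ) (ξ : Plane) : ℝ := Real.sin (t * bracket ξ) / bracket ξ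

theorem abs_propSymbol_le (t : ℝ) (ξ : Plane) : |propSymbol t ξ| ≤ 1 := by
  rw [propSymbol, abs_div, abs_of_pos (bracket_pos ξ)]
  exact div_le_one_of_le₀ ((Real.abs_sin_le_one _).trans (one_le_bracket ξ)) (bracket_pos ξ).le

theorem abs_propSymbol_sub_le (t r : ℝ) (ξ : Plane) :
    |propSymbol t ξ - propSymbol r ξ| ≤ |t - r| := by
  have hb := bracket_pos ξ
  rw [propSymbol, propSymbol, ← sub_div, abs_div, abs_of_pos hb, div_le_iff₀ hb]
  have h : |Real.sin (t * bracket ξ) - Real.sin (r * bracket ξ)|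
      ≤ |t * bracket ξ - r * bracket ξ| := by
    have := Real.lipschitzWith_sin.dist_le_mul (t * bracket ξ) (r * bracket ξ)
    simpa [Real.dist_eq] using this
  rwa [← sub_mul, abs_mul, abs_of_pos hb] at h

theorem measurable_propSymbol (t : ℝ) : Measurable (propSymbol t) := by
  have h : Measurable (bracket : Plane → ℝ) := continuous_bracket.measurable
  exact (Real.measurable_sin.comp (h.const_mul t)).div h

theorem memLp_of_le_inv_bracket_sq {a : Plane → F} (ha : StronglyMeasurable a) {B : ℝ}
    (h : ∀ ξ, ‖a ξ‖ ≤ B * (bracket ξ ^ 2)⁻¹) : MemLp (dil a) 2 (volume : Measure Plane) := by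
  refine memLp_dil ?_
  exact ((memLp_inv_bracket_pow (k := 2) le_rfl).const_mul B).mono' ha.aestronglyMeasurable
    (Eventually.of_forall h)

variable {m : ℕ} {D : ℝ} {g Q Q₁ : ℝ → Plane → F}

namespace IsDecayingSolution

/-- Controls the term `⟨ξ⟩² Q` of the equation. Since `m + 2 ≥ 2`, it is dominated by an `L²`
function of `ξ` uniformly in time, which makes `Q₁` Lipschitz in time with an `L²` weight. -/
theorem bound_sq (h : IsDecayingSolution m D g Q Q₁) (s : ℝ) (ξ : Plane) :
    bracket ξ ^ 2 * ‖Q s ξ‖ ≤ 2 * D * (bracket ξ ^ 2)⁻¹ := by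
  have hb := one_le_bracket ξ
  calc bracket ξ ^ 2 * ‖Q s ξ‖ ≤ bracket ξ ^ (m + 2) * ‖Q s ξ‖ :=
        mul_le_mul_of_nonneg_right (pow_le_pow_right₀ hb (by omega)) (norm_nonneg _)
    _ ≤ D * decayWeight s ξ := h.bound s ξ
    _ ≤ D * (2 * (bracket ξ ^ 2)⁻¹) := mul_le_mul_of_nonneg_left (decayWeight_le s ξ) h.nonneg
    _ = _ := by ring

theorem norm_le (h : IsDecayingSolution m D g Q Q₁) (s : ℝ) (ξ : Plane) :
    ‖Q s ξ‖ ≤ D * decayWeight s ξ :=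
  (le_mul_of_one_le_left (norm_nonneg _) (one_le_pow₀ (one_le_bracket ξ))).trans (h.bound s ξ)

theorem norm_le₁ (h : IsDecayingSolution m D g Q Q₁) (s : ℝ) (ξ : Plane) :
    ‖Q₁ s ξ‖ ≤ D * decayWeight s ξ :=
  (le_mul_of_one_le_left (norm_nonneg _) (one_le_pow₀ (one_le_bracket ξ))).trans (h.bound₁ s ξ)

theorem memLp_source (h : IsDecayingSolution m D g Q Q₁) (s : ℝ) :
    MemLp (dil (g s)) 2 (volume : Measure Plane) := by
  obtain ⟨B, hB⟩ := h.source
  exact memLp_of_le_inv_bracket_sq (h.meas s) (hB s)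

theorem le_inv_bracket_sq (h : IsDecayingSolution m D g Q Q₁) (s : ℝ) (ξ : Plane) :
    D * decayWeight s ξ ≤ (2 * D) * (bracket ξ ^ 2)⁻¹ :=
  (mul_le_mul_of_nonneg_left (decayWeight_le s ξ) h.nonneg).trans (le_of_eq (by ring))

theorem memLp (h : IsDecayingSolution m D g Q Q₁) (s : ℝ) :
    MemLp (dil (Q s)) 2 (volume : Measure Plane) :=
  memLp_of_le_inv_bracket_sq (h.measQ s) fun ξ => (h.norm_le s ξ).trans (h.le_inv_bracket_sq s ξ)

theorem memLp₁ (h : IsDecayingSolution m D g Q Q₁) (s : ℝ) :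
    MemLp (dil (Q₁ s)) 2 (volume : Measure Plane) :=
  memLp_of_le_inv_bracket_sq (h.measQ₁ s) fun ξ => (h.norm_le₁ s ξ).trans (h.le_inv_bracket_sq s ξ)

theorem hasDerivAt_toL2_dil (h : IsDecayingSolution m D g Q Q₁) (s : ℝ) :
    HasDerivAt (fun s => toL2 (dil (Q s))) (toL2 (dil (Q₁ s))) s := by
  obtain ⟨B, hB⟩ := h.source
  refine hasDerivAt_toL2 (k := fun s => dil (Q s)) (k' := fun s => dil (Q₁ s))
    (W := dil fun ξ => (B + 2 * D) * (bracket ξ ^ 2)⁻¹)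
    (memLp_dil ((memLp_inv_bracket_pow le_rfl).const_mul _)) h.memLp h.memLp₁
    (fun s x => h.deriv s _) ?_ s
  intro s r x
  have := Convex.norm_image_sub_le_of_norm_hasDerivWithin_le (f := fun s => Q₁ s ((2 * Real.pi) • x))
    (s := Set.univ) (x := r) (y := s)
    (C := (B + 2 * D) * (bracket ((2 * Real.pi) • x) ^ 2)⁻¹)
    (fun y _ => (h.deriv₁ y _).hasDerivWithinAt) (fun y _ => ?_) convex_univ trivial trivial
  · rw [Real.norm_eq_abs] at this
    exact this.trans (le_of_eq (mul_comm _ _))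
  · refine (norm_sub_le _ _).trans ?_
    rw [norm_smul, Complex.norm_real, Real.norm_eq_abs, abs_of_nonneg (by positivity), add_mul]
    exact add_le_add (hB _ _) (h.bound_sq _ _)

/-- The primitive in `s` of `sin((t-s)⟨ξ⟩)/⟨ξ⟩ g(s)`. -/
def primitive (Q Q₁ : ℝ → Plane → F) (t s : ℝ) (ξ : Plane) : F :=
  (Real.cos ((t - s) * bracket ξ) : ℂ) • Q s ξ + (propSymbol (t - s) ξ : ℂ) • Q₁ s ξ

theorem stronglyMeasurable_propSymbol_smul {a : Plane → F} (ha : StronglyMeasurable a) (t : ℝ) :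
    StronglyMeasurable fun ξ => (propSymbol t ξ : ℂ) • a ξ :=
  (Complex.measurable_ofReal.comp (measurable_propSymbol t)).stronglyMeasurable.smul ha

theorem norm_primitive_le (h : IsDecayingSolution m D g Q Q₁) (t s : ℝ) (ξ : Plane) :
    ‖primitive Q Q₁ t s ξ‖ ≤ (2 * D) * decayWeight s ξ := by
  refine (norm_add_le _ _).trans ?_
  rw [norm_smul, norm_smul, Complex.norm_real, Complex.norm_real, Real.norm_eq_abs,
    Real.norm_eq_abs]
  have h1 : |Real.cos ((t - s) * bracket ξ)| * ‖Q s ξ‖ ≤ 1 * ‖Q s ξ‖ :=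
    mul_le_mul_of_nonneg_right (Real.abs_cos_le_one _) (norm_nonneg _)
  have h2 : |propSymbol (t - s) ξ| * ‖Q₁ s ξ‖ ≤ 1 * ‖Q₁ s ξ‖ :=
    mul_le_mul_of_nonneg_right (abs_propSymbol_le _ _) (norm_nonneg _)
  linarith [h.norm_le s ξ, h.norm_le₁ s ξ]

theorem memLp_primitive (h : IsDecayingSolution m D g Q Q₁) (t s : ℝ) :
    MemLp (dil (primitive Q Q₁ t s)) 2 (volume : Measure Plane) := by
  refine memLp_of_le_inv_bracket_sq (B := 4 * D) ?_ fun ξ => ?_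
  · refine StronglyMeasurable.add ?_ (stronglyMeasurable_propSymbol_smul (h.measQ₁ s) _)
    have hb : Measurable (bracket : Plane → ℝ) := continuous_bracket.measurable
    exact (Complex.measurable_ofReal.comp
      (Real.measurable_cos.comp (hb.const_mul (t - s)))).stronglyMeasurable.smul (h.measQ s)
  · refine (h.norm_primitive_le t s ξ).trans ?_
    have := mul_le_mul_of_nonneg_left (h.le_inv_bracket_sq s ξ) (zero_le_two (α := ℝ))
    linarith

/-- This is variation of constants: on differentiating in `s`, the terms with `cos · Q₁` cancel, and
those with `sin · Q` cancel by the equation for `Q`. -/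
theorem hasDerivAt_primitive (h : IsDecayingSolution m D g Q Q₁) (t s : ℝ) (ξ : Plane) :
    HasDerivAt (fun s => primitive Q Q₁ t s ξ) ((propSymbol (t - s) ξ : ℂ) • g s ξ) s := by
  have hb := (bracket_pos ξ).ne'
  have h0 : HasDerivAt (fun s => (t - s) * bracket ξ) (-bracket ξ) s := by
    simpa using ((hasDerivAt_id s).const_sub t).mul_const (bracket ξ)
  have h1 := (h0.cos.ofReal_comp).smul (h.deriv s ξ)
  have h2 := ((h0.sin.div_const (bracket ξ)).ofReal_comp).smul (h.deriv₁ s ξ)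
  have h3 := h1.add h2
  refine h3.congr_deriv ?_
  simp only [propSymbol]
  rw [smul_sub, smul_smul]
  have e1 : (((Real.cos ((t - s) * bracket ξ) * -bracket ξ / bracket ξ : ℝ)) : ℂ)
      = -(Real.cos ((t - s) * bracket ξ) : ℂ) := by
    rw [← Complex.ofReal_neg]
    congr 1
    field_simp
  have e2 : ((Real.sin ((t - s) * bracket ξ) / bracket ξ : ℝ) : ℂ) * ((bracket ξ ^ 2 : ℝ) : ℂ)
      = ((-Real.sin ((t - s) * bracket ξ) * -bracket ξ : ℝ) : ℂ) := by
    rw [← Complex.ofReal_mul]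
    congr 1
    field_simp
  rw [e1, e2, neg_smul]
  abel

theorem source_pair (h : IsDecayingSolution m D g Q Q₁) :
    ∃ B, (∀ s ξ, ‖g s ξ‖ ≤ B * (bracket ξ ^ 2)⁻¹) ∧
      ∀ s r ξ, ‖g s ξ - g r ξ‖ ≤ |s - r| * (B * (bracket ξ ^ 2)⁻¹) := by
  obtain ⟨B, hB⟩ := h.source
  obtain ⟨B', hB'⟩ := h.source_lip
  have hb : ∀ ξ : Plane, 0 ≤ (bracket ξ ^ 2)⁻¹ := fun ξ => by positivity
  refine ⟨max B B', fun s ξ => (hB s ξ).trans ?_, fun s r ξ => (hB' s r ξ).trans ?_⟩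
  · exact mul_le_mul_of_nonneg_right (le_max_left _ _) (hb ξ)
  · exact mul_le_mul_of_nonneg_left (mul_le_mul_of_nonneg_right (le_max_right _ _) (hb ξ))
      (abs_nonneg _)

theorem memLp_propSymbol_smul (h : IsDecayingSolution m D g Q Q₁) (t s : ℝ) :
    MemLp (dil fun ξ => (propSymbol t ξ : ℂ) • g s ξ) 2 (volume : Measure Plane) := by
  obtain ⟨B, hB⟩ := h.source
  refine memLp_of_le_inv_bracket_sq (B := B)
    (stronglyMeasurable_propSymbol_smul (h.meas s) t) fun ξ => ?_
  rw [norm_smul, Complex.norm_real, Real.norm_eq_abs]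
  exact (mul_le_of_le_one_left (norm_nonneg _) (abs_propSymbol_le _ _)).trans (hB s ξ)

theorem lipschitz_propSymbol_smul (h : IsDecayingSolution m D g Q Q₁) :
    ∃ B, ∀ t s r ξ, ‖(propSymbol (t - s) ξ : ℂ) • g s ξ - (propSymbol (t - r) ξ : ℂ) • g r ξ‖
      ≤ |s - r| * (B * (bracket ξ ^ 2)⁻¹) := by
  obtain ⟨B, hB, hB'⟩ := h.source_pair
  refine ⟨2 * B, fun t s r ξ => (norm_smul_sub_smul_le _ _ _ _).trans ?_⟩
  have h1 : |propSymbol (t - s) ξ - propSymbol (t - r) ξ| ≤ |s - r| := by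
    refine (abs_propSymbol_sub_le _ _ _).trans (le_of_eq ?_)
    rw [abs_sub_comm s r]
    congr 1
    ring
  have h2 := mul_le_mul h1 (hB s ξ) (norm_nonneg _) (abs_nonneg _)
  have h3 := (mul_le_of_le_one_left (norm_nonneg (g s ξ - g r ξ))
    (abs_propSymbol_le (t - r) ξ)).trans (hB' s r ξ)
  linarith

theorem hasDerivAt_toL2_primitive (h : IsDecayingSolution m D g Q Q₁) (t s : ℝ) :
    HasDerivAt (fun s => toL2 (dil (primitive Q Q₁ t s)))
      (toL2 (dil fun ξ => (propSymbol (t - s) ξ : ℂ) • g s ξ)) s := by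
  obtain ⟨B, hB⟩ := h.lipschitz_propSymbol_smul
  exact hasDerivAt_toL2 (k := fun s => dil (primitive Q Q₁ t s))
    (k' := fun s => dil fun ξ => (propSymbol (t - s) ξ : ℂ) • g s ξ)
    (W := dil fun ξ => B * (bracket ξ ^ 2)⁻¹)
    (memLp_dil ((memLp_inv_bracket_pow le_rfl).const_mul _)) (h.memLp_primitive t)
    (fun s => h.memLp_propSymbol_smul (t - s) s)
    (fun s x => h.hasDerivAt_primitive t s _) (fun s r x => hB t s r _) s

theorem continuous_toL2_propSymbol_smul (h : IsDecayingSolution m D g Q Q₁) (t : ℝ) :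
    Continuous fun s => toL2 (dil fun ξ => (propSymbol (t - s) ξ : ℂ) • g s ξ) := by
  obtain ⟨B, hB⟩ := h.lipschitz_propSymbol_smul
  exact continuous_toL2 (k := fun s => dil fun ξ => (propSymbol (t - s) ξ : ℂ) • g s ξ)
    (W := dil fun ξ => B * (bracket ξ ^ 2)⁻¹)
    (memLp_dil ((memLp_inv_bracket_pow le_rfl).const_mul _))
    (fun s => h.memLp_propSymbol_smul (t - s) s) (fun s r x => hB t s r _)

end IsDecayingSolution

/-- The inverse Fourier transform on `L²` as a real-linear continuous map. -/
def fourierInvCLM (F : Type*) [NormedAddCommGroup F] [InnerProductSpace ℂ F] [CompleteSpace F] :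
    Lp F 2 (volume : Measure Plane) →L[ℝ] Lp F 2 (volume : Measure Plane) :=
  ((Lp.fourierTransformₗᵢ Plane F).symm.toContinuousLinearEquiv :
    Lp F 2 (volume : Measure Plane) →L[ℂ] Lp F 2 (volume : Measure Plane)).restrictScalars ℝ

theorem fourierInvCLM_apply (u : Lp F 2 (volume : Measure Plane)) :
    fourierInvCLM F u = (𝓕⁻ u : Lp F 2 (volume : Measure Plane)) := rfl

theorem l2Multiplier_fourierInv (M : Plane → F → F) {a : Plane → F}
    (ha : MemLp (dil a) 2 (volume : Measure Plane)) :
    l2Multiplier M (𝓕⁻ (toL2 (dil a))) = 𝓕⁻ (toL2 (dil fun ξ => M ξ (a ξ))) := by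
  rw [l2Multiplier, FourierTransform.fourier_fourierInv_eq]
  congr 1
  refine toL2_congr ?_
  filter_upwards [coeFn_toL2 ha] with ζ hζ
  rw [hζ]
  rfl

theorem sobolevNorm_fourierInv (k : ℕ) {a : Plane → F}
    (ha : MemLp (dil a) 2 (volume : Measure Plane)) :
    sobolevNorm k (𝓕⁻ (toL2 (dil a)))
      = eLpNorm (dil fun ξ => bracket ξ ^ k • a ξ) 2 volume := by
  rw [sobolevNorm, FourierTransform.fourier_fourierInv_eq]
  refine eLpNorm_congr_ae ?_
  filter_upwards [coeFn_toL2 ha] with ζ hζ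
  rw [hζ]
  rfl

theorem eLpNorm_le_of_le_decayWeight {a : Plane → F} {D s : ℝ} (hD : 0 ≤ D)
    (h : ∀ ξ, ‖a ξ‖ ≤ D * decayWeight s ξ) :
    eLpNorm (dil a) 2 volume
      ≤ ENNReal.ofReal D * (2 * ENNReal.ofReal (bracket s)⁻¹ * bracketMass) := by
  refine (eLpNorm_le_mul_eLpNorm_of_ae_le_mul (g := dil (decayWeight s)) (c := D)
    (Eventually.of_forall fun x => ?_) 2).trans (mul_le_mul_right (eLpNorm_decayWeight_le s) _)
  exact (h _).trans (mul_le_mul_of_nonneg_left (Real.le_norm_self _) hD)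

namespace IsDecayingSolution

variable {G : ℝ → Lp F 2 (volume : Measure Plane)}

theorem propagator_eq (h : IsDecayingSolution m D g Q Q₁)
    (hG : ∀ s, G s = 𝓕⁻ (toL2 (dil (g s)))) (t s : ℝ) :
    propagator t (G s) = fourierInvCLM F (toL2 (dil fun ξ => (propSymbol t ξ : ℂ) • g s ξ)) := by
  rw [hG, propagator, l2Multiplier_fourierInv _ (h.memLp_source s)]
  rfl

theorem intervalIntegrable (h : IsDecayingSolution m D g Q Q₁)
    (hG : ∀ s, G s = 𝓕⁻ (toL2 (dil (g s)))) (t a b : ℝ) :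
    IntervalIntegrable (fun s => propagator (t - s) (G s)) volume a b := by
  simp only [fun s => h.propagator_eq hG (t - s) s]
  exact ((fourierInvCLM F).continuous.comp
    (h.continuous_toL2_propSymbol_smul t)).intervalIntegrable _ _

/-- The fundamental theorem of calculus in `L²`: the primitive equals `Q t` at `s = t`, because
there the cosine is one and the sine is zero. -/
theorem duhamel_eq (h : IsDecayingSolution m D g Q Q₁)
    (hG : ∀ s, G s = 𝓕⁻ (toL2 (dil (g s)))) (T t : ℝ) :
    duhamel G T t = fourierInvCLM F (toL2 (dil (Q t)))
      - fourierInvCLM F (toL2 (dil (primitive Q Q₁ t T))) := by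
  have hp : primitive Q Q₁ t t = Q t := by
    ext ξ
    simp [primitive, propSymbol]
  have hint := h.intervalIntegrable hG t T t
  rw [duhamel]
  simp only [fun s => h.propagator_eq hG (t - s) s] at hint ⊢
  rw [intervalIntegral.integral_eq_sub_of_hasDerivAt
    (f := fun s => fourierInvCLM F (toL2 (dil (primitive Q Q₁ t s))))
    (fun s _ => (fourierInvCLM F).hasFDerivAt.comp_hasDerivAt s (h.hasDerivAt_toL2_primitive t s))
    hint, hp]

/-- The boundary term at `T` is controlled by `decayWeight T`, hence is `O(⟨T⟩⁻¹)` in `L²`. The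
decay of `Q` and `Q₁` thus removes any homogeneous solution from the limit. -/
theorem tendsto_duhamel (h : IsDecayingSolution m D g Q Q₁)
    (hG : ∀ s, G s = 𝓕⁻ (toL2 (dil (g s)))) (t : ℝ) :
    Tendsto (fun T => duhamel G T t) atTop (𝓝 (fourierInvCLM F (toL2 (dil (Q t))))) := by
  have h0 : Tendsto (fun T => toL2 (dil (primitive Q Q₁ t T))) atTop (𝓝 0) := by
    rw [tendsto_zero_iff_norm_tendsto_zero]
    have hb : Tendsto (fun T : ℝ => (2 * D) * (2 * (bracket T)⁻¹ * bracketMass.toReal)) atTop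
        (𝓝 ((2 * D) * (2 * 0 * bracketMass.toReal))) := by
      have : Tendsto (fun T : ℝ => bracket T) atTop atTop :=
        tendsto_atTop_mono (fun T => (le_abs_self T).trans (norm_le_bracket T)) tendsto_id
      exact ((this.inv_tendsto_atTop.const_mul 2).mul_const _).const_mul _
    rw [mul_zero, zero_mul, mul_zero] at hb
    refine squeeze_zero (fun _ => norm_nonneg _) (fun T => ?_) hb
    have h1 := eLpNorm_le_of_le_decayWeight (mul_nonneg zero_le_two h.nonneg)
      (h.norm_primitive_le t T)
    rw [← norm_toL2 (h.memLp_primitive t T)] at h1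
    have hT := bracket_pos T
    have h2 := ENNReal.toReal_mono (ENNReal.mul_lt_top ENNReal.ofReal_lt_top (ENNReal.mul_lt_top
      (ENNReal.mul_lt_top ENNReal.ofNat_lt_top ENNReal.ofReal_lt_top) bracketMass_lt_top)).ne h1
    simpa only [ENNReal.toReal_mul, ENNReal.toReal_ofNat, ENNReal.toReal_ofReal (norm_nonneg _),
      ENNReal.toReal_ofReal (inv_pos.2 hT).le,
      ENNReal.toReal_ofReal (mul_nonneg zero_le_two h.nonneg)] using h2
  have h1 := ((fourierInvCLM F).continuous.tendsto 0).comp h0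
  rw [map_zero] at h1
  simp only [h.duhamel_eq hG]
  simpa using tendsto_const_nhds.sub h1

theorem duhamelInfty_eq (h : IsDecayingSolution m D g Q Q₁)
    (hG : ∀ s, G s = 𝓕⁻ (toL2 (dil (g s)))) (t : ℝ) :
    duhamelInfty G t = fourierInvCLM F (toL2 (dil (Q t))) :=
  (h.tendsto_duhamel hG t).limUnder_eq

theorem hasDerivAt_duhamelInfty (h : IsDecayingSolution m D g Q Q₁)
    (hG : ∀ s, G s = 𝓕⁻ (toL2 (dil (g s)))) (t : ℝ) :
    HasDerivAt (duhamelInfty G) (fourierInvCLM F (toL2 (dil (Q₁ t)))) t := by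
  rw [show duhamelInfty G = fun t => fourierInvCLM F (toL2 (dil (Q t))) from
    funext (h.duhamelInfty_eq hG)]
  exact (fourierInvCLM F).hasFDerivAt.comp_hasDerivAt t (h.hasDerivAt_toL2_dil t)

theorem sobolevNorm_le {a : Plane → F} (hD : 0 ≤ D) {t : ℝ}
    (ha : MemLp (dil a) 2 (volume : Measure Plane))
    (h : ∀ ξ, bracket ξ ^ (m + 2) * ‖a ξ‖ ≤ D * decayWeight t ξ) :
    sobolevNorm (m + 2) (fourierInvCLM F (toL2 (dil a)))
      ≤ ENNReal.ofReal D * (2 * ENNReal.ofReal (bracket t)⁻¹ * bracketMass) := by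
  rw [fourierInvCLM_apply, sobolevNorm_fourierInv _ ha]
  refine eLpNorm_le_of_le_decayWeight hD fun ξ => ?_
  rw [norm_smul, Real.norm_of_nonneg (pow_nonneg (bracket_pos ξ).le _)]
  exact h ξ

/-- The factor `4` is the `2` of `eLpNorm_decayWeight_le`, once for `Q` and once for `Q₁`. -/
theorem estimate (h : IsDecayingSolution m D g Q Q₁)
    (hG : ∀ s, G s = 𝓕⁻ (toL2 (dil (g s)))) (t : ℝ) :
    ENNReal.ofReal (bracket t) * (sobolevNorm (m + 2) (duhamelInfty G t)
        + sobolevNorm (m + 2) (_root_.deriv (duhamelInfty G) t))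
      ≤ ENNReal.ofReal D * (4 * bracketMass) := by
  rw [(h.hasDerivAt_duhamelInfty hG t).deriv, h.duhamelInfty_eq hG]
  refine (mul_le_mul_right (add_le_add (sobolevNorm_le h.nonneg (h.memLp t) (h.bound t))
    (sobolevNorm_le h.nonneg (h.memLp₁ t) (h.bound₁ t))) _).trans (le_of_eq ?_)
  have hb : ENNReal.ofReal (bracket t) * ENNReal.ofReal (bracket t)⁻¹ = 1 := by
    rw [← ENNReal.ofReal_mul (bracket_pos t).le, mul_inv_cancel₀ (bracket_pos t).ne',
      ENNReal.ofReal_one]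
  calc _ = (ENNReal.ofReal (bracket t) * ENNReal.ofReal (bracket t)⁻¹)
        * (ENNReal.ofReal D * (4 * bracketMass)) := by ring
    _ = _ := by rw [hb, one_mul]

end IsDecayingSolution

end Duhamel

/-! ### A symbol calculus for two derivatives in a fixed direction -/

section SymbolCalculus

/-- The directional derivative. -/
def dd (v : Plane) (A : Plane → ℂ) (η : Plane) : ℂ := fderiv ℝ A η v

/-- `A` and its first two derivatives in the direction `v` are bounded by `D w`. -/
structure Bd (v : Plane) (w : Plane → ℝ) (D : ℝ) (A : Plane → ℂ) : Prop where
  smooth : ContDiff ℝ 2 A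
  b0 : ∀ η, ‖A η‖ ≤ D * w η
  b1 : ∀ η, ‖dd v A η‖ ≤ D * w η
  b2 : ∀ η, ‖dd v (dd v A) η‖ ≤ D * w η

variable {v : Plane} {w w' : Plane → ℝ} {D D' : ℝ} {A B : Plane → ℂ}

theorem contDiff_dd {n : WithTop ℕ∞} (hA : ContDiff ℝ (n + 1) A) : ContDiff ℝ n (dd v A) :=
  (hA.fderiv_right le_rfl).clm_apply contDiff_const

theorem dd_mul (hA : Differentiable ℝ A) (hB : Differentiable ℝ B) :
    dd v (fun η => A η * B η) = fun η => dd v A η * B η + A η * dd v B η := by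
  ext η
  rw [dd, fderiv_fun_mul (hA η) (hB η)]
  simp [dd]
  ring

theorem dd_add (hA : Differentiable ℝ A) (hB : Differentiable ℝ B) :
    dd v (fun η => A η + B η) = fun η => dd v A η + dd v B η := by
  ext η
  rw [dd, fderiv_fun_add (hA η) (hB η)]
  simp [dd]

theorem dd_inv (hA : Differentiable ℝ A) (h0 : ∀ η, A η ≠ 0) :
    dd v (fun η => (A η)⁻¹) = fun η => -(dd v A η * ((A η)⁻¹ * (A η)⁻¹)) := by
  ext η
  have h1 : HasFDerivAt (fun η => (A η)⁻¹)
      (((ContinuousLinearMap.toSpanSingleton ℂ (-(A η ^ 2)⁻¹)).restrictScalars ℝ).comp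
        (fderiv ℝ A η)) η :=
    ((hasFDerivAt_inv (h0 η)).restrictScalars ℝ).comp η (hA η).hasFDerivAt
  rw [dd, h1.fderiv]
  simp [dd, sq]

theorem dd_comp_const_sub (ξ : Plane) (hA : Differentiable ℝ A) :
    dd v (fun η => A (ξ - η)) = fun η => -dd v A (ξ - η) := by
  ext η
  have h : HasFDerivAt (fun η : Plane => ξ - η) (-ContinuousLinearMap.id ℝ Plane) η :=
    (hasFDerivAt_id η).const_sub ξ
  have h1 := (hA (ξ - η)).hasFDerivAt.comp η h
  rw [dd, show (fun η => A (ξ - η)) = A ∘ fun η => ξ - η from rfl, h1.fderiv]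
  simp [dd]

theorem dd_neg (A : Plane → ℂ) : dd v (fun η => -A η) = fun η => -dd v A η := by
  ext η
  rw [dd, fderiv_fun_neg]
  simp [dd]

namespace Bd

theorem differentiable (hA : Bd v w D A) : Differentiable ℝ A :=
  hA.smooth.differentiable (by norm_num)

theorem contDiff_one (hA : Bd v w D A) : ContDiff ℝ 1 (dd v A) :=
  contDiff_dd (n := 1) (by simpa [one_add_one_eq_two] using hA.smooth)

theorem differentiable_dd (hA : Bd v w D A) : Differentiable ℝ (dd v A) :=
  hA.contDiff_one.differentiable (by norm_num)

theorem continuous_dd_dd (hA : Bd v w D A) : Continuous (dd v (dd v A)) :=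
  (contDiff_dd (n := 0) (by simpa using hA.contDiff_one)).continuous

theorem bound_nonneg (hA : Bd v w D A) (η : Plane) : 0 ≤ D * w η :=
  (norm_nonneg _).trans (hA.b0 η)

theorem congr (hA : Bd v w D A) (h : ∀ η, A η = B η) : Bd v w D B := by
  rwa [← funext h]

theorem mono (hA : Bd v w D A) (h : ∀ η, D * w η ≤ D' * w' η) : Bd v w' D' A :=
  ⟨hA.smooth, fun η => (hA.b0 η).trans (h η), fun η => (hA.b1 η).trans (h η),
    fun η => (hA.b2 η).trans (h η)⟩

theorem add (hA : Bd v w D A) (hB : Bd v w D' B) : Bd v w (D + D') (fun η => A η + B η) := by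
  refine ⟨hA.smooth.add hB.smooth, fun η => ?_, fun η => ?_, fun η => ?_⟩
  · rw [add_mul]
    exact (norm_add_le _ _).trans (add_le_add (hA.b0 η) (hB.b0 η))
  · rw [dd_add hA.differentiable hB.differentiable, add_mul]
    exact (norm_add_le _ _).trans (add_le_add (hA.b1 η) (hB.b1 η))
  · rw [dd_add hA.differentiable hB.differentiable, dd_add hA.differentiable_dd
      hB.differentiable_dd, add_mul]
    exact (norm_add_le _ _).trans (add_le_add (hA.b2 η) (hB.b2 η))

/-- The factor `4 = 1 + 2 + 1` counts the Leibniz terms of the second derivative. -/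
theorem mul (hA : Bd v w D A) (hB : Bd v w' D' B) :
    Bd v (fun η => w η * w' η) (4 * D * D') (fun η => A η * B η) := by
  have e1 := dd_mul (v := v) hA.differentiable hB.differentiable
  have e2 : dd v (dd v fun η => A η * B η) = fun η =>
      dd v (dd v A) η * B η + dd v A η * dd v B η + (dd v A η * dd v B η + A η * dd v (dd v B) η) := by
    rw [e1, dd_add (hA.differentiable_dd.fun_mul hB.differentiable)
      (hA.differentiable.fun_mul hB.differentiable_dd),
      dd_mul hA.differentiable_dd hB.differentiable, dd_mul hA.differentiable hB.differentiable_dd]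
  have key : ∀ η {x y : ℂ}, ‖x‖ ≤ D * w η → ‖y‖ ≤ D' * w' η → ‖x * y‖ ≤ D * w η * (D' * w' η) :=
    fun η x y hx hy => by
      rw [norm_mul]
      exact mul_le_mul hx hy (norm_nonneg _) (hA.bound_nonneg η)
  have hn : ∀ η, 0 ≤ D * w η * (D' * w' η) := fun η =>
    mul_nonneg (hA.bound_nonneg η) (hB.bound_nonneg η)
  refine ⟨hA.smooth.mul hB.smooth, fun η => ?_, fun η => ?_, fun η => ?_⟩
  · linarith [key η (hA.b0 η) (hB.b0 η), hn η]
  · rw [e1]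
    refine (norm_add_le _ _).trans ?_
    linarith [key η (hA.b1 η) (hB.b0 η), key η (hA.b0 η) (hB.b1 η), hn η]
  · rw [e2]
    refine (norm_add_le _ _).trans ?_
    refine (add_le_add (norm_add_le _ _) (norm_add_le _ _)).trans ?_
    linarith [key η (hA.b2 η) (hB.b0 η), key η (hA.b1 η) (hB.b1 η), key η (hA.b0 η) (hB.b2 η)]

/-- The second derivative of `1/A` contains `A''/A²` and `2A'²/A³`. With `|A| ≥ 1` these are at most
`Dw + 2(Dw)² ≤ 3D²w²`, whence the squared weight. -/
theorem inv (hA : Bd v w D A) (hD : 1 ≤ D) (hw : ∀ η, 1 ≤ w η) (h : ∀ η, 1 ≤ ‖A η‖) :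
    Bd v (fun η => w η ^ 2) (3 * D ^ 2) (fun η => (A η)⁻¹) := by
  have h0 : ∀ η, A η ≠ 0 := fun η h' => by
    have := h η
    rw [h', norm_zero] at this
    linarith
  have hd : Differentiable ℝ fun η => (A η)⁻¹ := fun η => (hA.differentiable η).inv (h0 η)
  have hi : ∀ η, ‖(A η)⁻¹‖ ≤ 1 := fun η => by
    rw [norm_inv]
    exact inv_le_one_of_one_le₀ (h η)
  have hDw : ∀ η, 1 ≤ D * w η := fun η => one_le_mul_of_one_le_of_one_le hD (hw η)
  have hsq : ∀ η, D * w η ≤ D ^ 2 * w η ^ 2 := fun η => by nlinarith [hDw η]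
  have e1 := dd_inv (v := v) hA.differentiable h0
  have e2 : dd v (dd v fun η => (A η)⁻¹) = fun η =>
      -(dd v (dd v A) η * ((A η)⁻¹ * (A η)⁻¹) + dd v A η *
        (-(dd v A η * ((A η)⁻¹ * (A η)⁻¹)) * (A η)⁻¹
          + (A η)⁻¹ * -(dd v A η * ((A η)⁻¹ * (A η)⁻¹)))) := by
    rw [e1, dd_neg, dd_mul hA.differentiable_dd (hd.fun_mul hd), dd_mul hd hd, e1]
  have i2 : ∀ η, ‖(A η)⁻¹ * (A η)⁻¹‖ ≤ 1 := fun η => by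
    rw [norm_mul]
    exact mul_le_one₀ (hi η) (norm_nonneg _) (hi η)
  have key : ∀ x y : ℂ, ‖y‖ ≤ 1 → ‖x * y‖ ≤ ‖x‖ := fun x y hy => by
    rw [norm_mul]
    exact mul_le_of_le_one_right (norm_nonneg _) hy
  refine ⟨hA.smooth.inv h0, fun η => ?_, fun η => ?_, fun η => ?_⟩
  · nlinarith [hi η, hsq η, hDw η]
  · rw [e1]
    simp only [norm_neg]
    nlinarith [key (dd v A η) _ (i2 η), hA.b1 η, hsq η, hDw η]
  · rw [e2]
    simp only [norm_neg]
    refine (norm_add_le _ _).trans ?_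
    have h1 := (key (dd v (dd v A) η) _ (i2 η)).trans (hA.b2 η)
    have h2 : ‖dd v A η * ((A η)⁻¹ * (A η)⁻¹)‖ ≤ D * w η :=
      (key (dd v A η) _ (i2 η)).trans (hA.b1 η)
    have h3 : ‖-(dd v A η * ((A η)⁻¹ * (A η)⁻¹)) * (A η)⁻¹
          + (A η)⁻¹ * -(dd v A η * ((A η)⁻¹ * (A η)⁻¹))‖ ≤ 2 * (D * w η) := by
      refine (norm_add_le _ _).trans ?_
      have h4 := key (-(dd v A η * ((A η)⁻¹ * (A η)⁻¹))) _ (hi η)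
      have h6 := congrArg norm (mul_comm (A η)⁻¹ (-(dd v A η * ((A η)⁻¹ * (A η)⁻¹))))
      rw [norm_neg] at h4
      linarith
    have h5 : ‖dd v A η * (-(dd v A η * ((A η)⁻¹ * (A η)⁻¹)) * (A η)⁻¹
          + (A η)⁻¹ * -(dd v A η * ((A η)⁻¹ * (A η)⁻¹)))‖ ≤ D * w η * (2 * (D * w η)) := by
      rw [norm_mul]
      exact mul_le_mul (hA.b1 η) h3 (norm_nonneg _) (hA.bound_nonneg η)
    nlinarith [hsq η]

theorem const (c : ℂ) : Bd v (fun _ => 1) ‖c‖ fun _ => c := by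
  have e : dd v (fun _ : Plane => c) = fun _ => 0 := by
    ext η
    simp [dd]
  have e' : dd v (fun _ : Plane => (0 : ℂ)) = fun _ => 0 := by
    ext η
    simp [dd]
  refine ⟨contDiff_const, fun η => by simp, fun η => ?_, fun η => ?_⟩
  · rw [e]
    simp
  · rw [e, e']
    simp

theorem const_mul (c : ℂ) (hA : Bd v w D A) : Bd v w (4 * ‖c‖ * D) fun η => c * A η := by
  have := (const (v := v) c).mul hA
  simpa only [one_mul] using this

theorem comp_const_sub (ξ : Plane) (hA : Bd v w D A) :
    Bd v (fun η => w (ξ - η)) D fun η => A (ξ - η) := by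
  refine ⟨hA.smooth.comp (contDiff_const.sub contDiff_id), fun η => hA.b0 _, fun η => ?_,
    fun η => ?_⟩
  · rw [dd_comp_const_sub ξ hA.differentiable, norm_neg]
    exact hA.b1 _
  · rw [dd_comp_const_sub ξ hA.differentiable, dd_neg, dd_comp_const_sub ξ hA.differentiable_dd]
    simpa using hA.b2 _

/-- Meant for factors depending only on the component of `η` transverse to `v`: they cost no weight,
whatever their transverse derivatives. -/
theorem of_invariant (hs : ContDiff ℝ 2 A) (hi : ∀ (η : Plane) (t : ℝ), A (η + t • v) = A η)
    (h : ∀ η, ‖A η‖ ≤ D) : Bd v (fun _ => 1) D A := by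
  have e : dd v A = fun _ => 0 := by
    ext η
    have h1 := ((hs.differentiable (by norm_num)) η).hasFDerivAt.hasLineDerivAt v
    rw [dd, ← h1.lineDeriv, lineDeriv]
    simp [hi]
  have e' : dd v (fun _ : Plane => (0 : ℂ)) = fun _ => 0 := by
    ext η
    simp [dd]
  have hD : 0 ≤ D := (norm_nonneg _).trans (h 0)
  refine ⟨hs, fun η => by simpa using h η, fun η => ?_, fun η => ?_⟩
  · rw [e]
    simpa using hD
  · rw [e, e']
    simpa using hD

theorem coord (j : Fin 2) (hv : ‖v‖ ≤ 1) : Bd v bracket 1 fun η => ((η j : ℝ) : ℂ) := by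
  let L : Plane →L[ℝ] ℂ := Complex.ofRealCLM.comp (EuclideanSpace.proj j)
  have eL : (fun η : Plane => ((η j : ℝ) : ℂ)) = L := by
    ext η
    simp [L]
  have e : dd v L = fun _ => L v := by
    ext η
    simp [dd]
  have e' : dd v (fun _ : Plane => L v) = fun _ => 0 := by
    ext η
    simp [dd]
  have hL : ∀ u : Plane, ‖L u‖ ≤ ‖u‖ := fun u => by
    simpa [L] using PiLp.norm_apply_le u j
  rw [eL]
  refine ⟨L.contDiff, fun η => ?_, fun η => ?_, fun η => ?_⟩
  · rw [one_mul]
    exact (hL η).trans (norm_le_bracket η)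
  · rw [e, one_mul]
    exact ((hL v).trans hv).trans (one_le_bracket η)
  · rw [e, e', one_mul, norm_zero]
    exact (bracket_pos η).le

end Bd

theorem contDiff_bracket {n : WithTop ℕ∞} : ContDiff ℝ n (bracket : Plane → ℝ) := by
  refine ContDiff.sqrt (contDiff_const.add (contDiff_id.norm_sq ℝ)) fun x => ?_
  have : 0 < 1 + ‖x‖ ^ 2 := by positivity
  exact this.ne'

theorem hasFDerivAt_bracket (η : Plane) :
    HasFDerivAt (bracket : Plane → ℝ) ((bracket η)⁻¹ • innerSL ℝ η) η := by
  have h0 : (1 : ℝ) + ‖η‖ ^ 2 ≠ 0 := by positivity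
  have h1 : HasFDerivAt (fun x : Plane => 1 + ‖x‖ ^ 2) (2 • innerSL ℝ η) η :=
    (hasStrictFDerivAt_norm_sq η).hasFDerivAt.const_add 1
  have h2 := h1.sqrt h0
  refine h2.congr_fderiv ?_
  ext u
  simp [bracket]
  ring

theorem dd_bracket (v : Plane) : dd v (fun η => ((bracket η : ℝ) : ℂ))
    = fun η => ((inner ℝ η v / bracket η : ℝ) : ℂ) := by
  ext η
  have h1 : HasFDerivAt (fun η => ((bracket η : ℝ) : ℂ))
      (Complex.ofRealCLM.comp ((bracket η)⁻¹ • innerSL ℝ η)) η :=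
    Complex.ofRealCLM.hasFDerivAt.comp η (hasFDerivAt_bracket η)
  rw [dd, h1.fderiv]
  simp
  ring

theorem dd_dd_bracket (v : Plane) : dd v (dd v fun η => ((bracket η : ℝ) : ℂ))
    = fun η => ((‖v‖ ^ 2 / bracket η - (inner ℝ η v) ^ 2 / bracket η ^ 3 : ℝ) : ℂ) := by
  rw [dd_bracket]
  ext η
  have hb := (bracket_pos η).ne'
  have h0 : HasFDerivAt (fun η : Plane => inner ℝ η v) (innerSL ℝ v) η := by
    have := (innerSL ℝ v).hasFDerivAt (x := η)
    refine this.congr_of_eventuallyEq (Eventually.of_forall fun x => ?_)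
    simp [real_inner_comm]
  have h1 := h0.mul ((hasDerivAt_inv hb).comp_hasFDerivAt η (hasFDerivAt_bracket η))
  have h2 := Complex.ofRealCLM.hasFDerivAt.comp η h1
  rw [dd]
  have e : (fun η => ((inner ℝ η v / bracket η : ℝ) : ℂ))
      = Complex.ofRealCLM ∘ ((fun η => inner ℝ η v) * (Inv.inv ∘ bracket)) := by
    ext x
    simp [div_eq_mul_inv]
  rw [e, h2.fderiv]
  have : inner ℝ v v = ‖v‖ ^ 2 := real_inner_self_eq_norm_sq v
  simp
  field_simp
  ring

theorem Bd.bracket (hv : ‖v‖ ≤ 1) : Bd v bracket 2 fun η => ((bracket η : ℝ) : ℂ) := by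
  have hin : ∀ η : Plane, |inner ℝ η v| ≤ EulerPoisson.bracket η := fun η =>
    (abs_real_inner_le_norm η v).trans
      ((mul_le_of_le_one_right (norm_nonneg _) hv).trans (norm_le_bracket η))
  refine ⟨Complex.ofRealCLM.contDiff.comp contDiff_bracket, fun η => ?_, fun η => ?_, fun η => ?_⟩
  · rw [Complex.norm_real, Real.norm_of_nonneg (bracket_pos η).le]
    linarith [bracket_pos η]
  · rw [dd_bracket, Complex.norm_real, Real.norm_eq_abs, abs_div, abs_of_pos (bracket_pos η)]
    have := div_le_one_of_le₀ (hin η) (bracket_pos η).le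
    linarith [one_le_bracket η]
  · rw [dd_dd_bracket, Complex.norm_real, Real.norm_eq_abs]
    have hb := one_le_bracket η
    have h1 : ‖v‖ ^ 2 / EulerPoisson.bracket η ≤ 1 := by
      rw [div_le_one (bracket_pos η)]
      nlinarith [norm_nonneg v]
    have h2 : (inner ℝ η v) ^ 2 / EulerPoisson.bracket η ^ 3 ≤ 1 := by
      rw [div_le_one (by positivity)]
      have := sq_le_sq' (neg_le_of_abs_le (hin η)) (le_of_abs_le (hin η))
      nlinarith [sq_nonneg (EulerPoisson.bracket η)]
    have h3 : 0 ≤ ‖v‖ ^ 2 / EulerPoisson.bracket η := by positivity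
    have h4 : 0 ≤ (inner ℝ η v) ^ 2 / EulerPoisson.bracket η ^ 3 := by positivity
    rw [abs_le]
    constructor <;> linarith

end SymbolCalculus

/-! ### Absence of time resonances -/

section Geometry

theorem eq_one_or_of_sq {x : ℝ} (h : x ^ 2 = 1) : x = 1 ∨ x = -1 :=
  sq_eq_sq_iff_eq_or_eq_neg.1 (h.trans (one_pow 2).symm)

theorem abs_eq_one_of_sq {x : ℝ} (h : x ^ 2 = 1) : |x| = 1 := by
  rcases eq_one_or_of_sq h with h | h <;> simp [h]

theorem bracket_sq_coord (η : Plane) : bracket η ^ 2 = 1 + η 0 ^ 2 + η 1 ^ 2 := by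
  rw [bracket_sq, EuclideanSpace.real_norm_sq_eq, Fin.sum_univ_two]
  ring

/-- The weight `⟨η⟩⟨ξ - η⟩`. -/
def wt (ξ η : Plane) : ℝ := bracket η * bracket (ξ - η)

/-- The inner product `η · (ξ - η)`. -/
def dot (ξ η : Plane) : ℝ := η 0 * (ξ - η) 0 + η 1 * (ξ - η) 1

theorem one_le_wt (ξ η : Plane) : 1 ≤ wt ξ η :=
  one_le_mul_of_one_le_of_one_le (one_le_bracket _) (one_le_bracket _)

theorem wt_pos (ξ η : Plane) : 0 < wt ξ η := lt_of_lt_of_le one_pos (one_le_wt ξ η)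

theorem continuous_wt (ξ : Plane) : Continuous (wt ξ) := by
  unfold wt
  exact continuous_bracket.mul (continuous_bracket.comp (by fun_prop))

theorem wt_sq (ξ η : Plane) : wt ξ η ^ 2
    = (1 + η 0 ^ 2 + η 1 ^ 2) * (1 + (ξ - η) 0 ^ 2 + (ξ - η) 1 ^ 2) := by
  rw [wt, mul_pow, bracket_sq_coord, bracket_sq_coord]

/-- Cauchy–Schwarz for `(1, η)` and `(1, -ζ)` with `ζ = ξ - η`. By Lagrange's identity the
difference of the squares is `|η + ζ|² + (η ∧ ζ)²`. -/
theorem abs_one_sub_dot_le (ξ η : Plane) : |1 - dot ξ η| ≤ wt ξ η := by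
  refine abs_le_of_sq_le_sq ?_ (wt_pos ξ η).le
  rw [wt_sq, dot]
  nlinarith [sq_nonneg (η 0 + (ξ - η) 0), sq_nonneg (η 1 + (ξ - η) 1),
    sq_nonneg (η 0 * (ξ - η) 1 - η 1 * (ξ - η) 0)]

theorem abs_one_add_dot_le (ξ η : Plane) : |1 + dot ξ η| ≤ wt ξ η := by
  refine abs_le_of_sq_le_sq ?_ (wt_pos ξ η).le
  rw [wt_sq, dot]
  nlinarith [sq_nonneg (η 0 - (ξ - η) 0), sq_nonneg (η 1 - (ξ - η) 1),
    sq_nonneg (η 0 * (ξ - η) 1 - η 1 * (ξ - η) 0)]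

theorem bracket_le_two_mul_wt (ξ η : Plane) : bracket ξ ≤ 2 * wt ξ η := by
  refine abs_le_of_sq_le_sq' ?_ (by linarith [wt_pos ξ η]) |>.2
  rw [mul_pow, wt_sq, bracket_sq_coord]
  simp only [PiLp.sub_apply]
  nlinarith [sq_nonneg (ξ 0 - 2 * η 0), sq_nonneg (ξ 1 - 2 * η 1),
    mul_nonneg (add_nonneg (sq_nonneg (η 0)) (sq_nonneg (η 1)))
      (add_nonneg (sq_nonneg (ξ 0 - η 0)) (sq_nonneg (ξ 1 - η 1)))]

/-- The time-resonance function `⟨ξ⟩² - (ε⟨η⟩ + ε'⟨ξ-η⟩)²`. -/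
def resSymbol (ε ε' : ℝ) (ξ η : Plane) : ℝ :=
  bracket ξ ^ 2 - (ε * bracket η + ε' * bracket (ξ - η)) ^ 2

variable {ε ε' : ℝ}

theorem resSymbol_eq (hε : ε ^ 2 = 1) (hε' : ε' ^ 2 = 1) (ξ η : Plane) :
    resSymbol ε ε' ξ η = 2 * dot ξ η - 1 - 2 * (ε * ε') * wt ξ η := by
  have h1 := bracket_sq_coord η
  have h2 := bracket_sq_coord (ξ - η)
  rw [resSymbol, bracket_sq_coord, dot, wt]
  simp only [PiLp.sub_apply] at h2 ⊢
  linear_combination (-bracket η ^ 2) * hε - bracket (ξ - η) ^ 2 * hε' - h1 - h2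

/-- By `resSymbol_eq` the function is `2η·ζ - 1 ∓ 2⟨η⟩⟨ζ⟩` with `ζ = ξ - η`. For equal signs `1 +
η·ζ ≤ ⟨η⟩⟨ζ⟩` makes it negative, for opposite signs `1 - η·ζ ≤ ⟨η⟩⟨ζ⟩` makes it positive. The `1`
comes from the positive mass. -/
theorem one_le_abs_resSymbol (hε : ε ^ 2 = 1) (hε' : ε' ^ 2 = 1) (ξ η : Plane) :
    1 ≤ |resSymbol ε ε' ξ η| := by
  rw [resSymbol_eq hε hε', le_abs]
  have h1 := abs_le.1 (abs_one_sub_dot_le ξ η)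
  have h2 := abs_le.1 (abs_one_add_dot_le ξ η)
  rcases eq_one_or_of_sq (show (ε * ε') ^ 2 = 1 by rw [mul_pow, hε, hε', one_mul])
    with h | h
  · right
    rw [h]
    linarith [one_le_wt ξ η]
  · left
    rw [h]
    linarith

end Geometry

/-! ### Symbol bounds for the inverse resonance function and the amplitudes -/

section SymbolBounds

variable {v : Plane} {ε ε' : ℝ}

theorem bd_one (ξ : Plane) : Bd v (wt ξ) 1 fun _ => (1 : ℂ) :=
  (Bd.const (v := v) 1).mono fun η => by simpa using one_le_wt ξ η

theorem bd_wt (ξ : Plane) (hv : ‖v‖ ≤ 1) : Bd v (wt ξ) 16 fun η => ((wt ξ η : ℝ) : ℂ) := by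
  have h := (Bd.bracket hv).mul ((Bd.bracket hv).comp_const_sub ξ)
  refine (h.congr fun η => ?_).mono fun η => ?_
  · rw [wt, Complex.ofReal_mul]
  · rw [wt]
    exact le_of_eq (by ring)

theorem bd_dot (ξ : Plane) (hv : ‖v‖ ≤ 1) : Bd v (wt ξ) 8 fun η => ((dot ξ η : ℝ) : ℂ) := by
  have h := fun j => (Bd.coord j hv).mul ((Bd.coord j hv).comp_const_sub ξ)
  refine (((h 0).add (h 1)).congr fun η => ?_).mono fun η => ?_
  · rw [dot]
    push_cast
    rfl
  · rw [wt]
    exact le_of_eq (by ring)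

theorem bd_bracket_add (ξ : Plane) (hv : ‖v‖ ≤ 1) :
    Bd v (wt ξ) 4 fun η => ((bracket η + bracket (ξ - η) : ℝ) : ℂ) := by
  have h1 : Bd v (wt ξ) 2 fun η => ((bracket η : ℝ) : ℂ) :=
    (Bd.bracket hv).mono fun η => by
      rw [wt]
      nlinarith [bracket_pos η, one_le_bracket (ξ - η)]
  have h2 : Bd v (wt ξ) 2 fun η => ((bracket (ξ - η) : ℝ) : ℂ) :=
    ((Bd.bracket hv).comp_const_sub ξ).mono fun η => by
      rw [wt]
      nlinarith [bracket_pos (ξ - η), one_le_bracket η]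
  refine ((h1.add h2).congr fun η => ?_).mono fun η => ?_
  · push_cast
    rfl
  · exact le_of_eq (by ring)

theorem exists_bd_resSymbol_inv : ∃ K, 0 ≤ K ∧ ∀ {ε ε' : ℝ} {ξ v : Plane}, ε ^ 2 = 1 → ε' ^ 2 = 1 →
    ‖v‖ ≤ 1 → Bd v (fun η => wt ξ η ^ 2) K fun η => (((resSymbol ε ε' ξ η)⁻¹ : ℝ) : ℂ) := by
  -- The three summands are those of `resSymbol_eq`, each with the factor `4‖c‖` of `Bd.const_mul`;
  -- the outer `3 (·)²` is that of `Bd.inv`.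
  refine ⟨3 * (4 * 2 * 8 + 4 * 1 * 1 + 4 * 2 * 16) ^ 2, by norm_num, ?_⟩
  intro ε ε' ξ v hε hε' hv
  have hk : ‖((-2 * (ε * ε') : ℝ) : ℂ)‖ = 2 := by
    rw [Complex.norm_real, Real.norm_eq_abs, abs_mul, abs_mul, abs_eq_one_of_sq hε,
      abs_eq_one_of_sq hε']
    norm_num
  have h := (((bd_dot ξ hv).const_mul ((2 : ℝ) : ℂ)).add ((bd_one ξ).const_mul ((-1 : ℝ) : ℂ))).add
    ((bd_wt ξ hv).const_mul ((-2 * (ε * ε') : ℝ) : ℂ))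
  rw [hk, Complex.norm_real, Complex.norm_real] at h
  have h' := (h.congr (B := fun η => ((resSymbol ε ε' ξ η : ℝ) : ℂ)) fun η => by
    rw [resSymbol_eq hε hε']
    push_cast
    ring).mono (D' := 4 * 2 * 8 + 4 * 1 * 1 + 4 * 2 * 16) (w' := wt ξ) fun η => by
      norm_num
  refine (h'.inv (by norm_num) (one_le_wt ξ) fun η => ?_).congr fun η => ?_
  · rw [Complex.norm_real]
    exact one_le_abs_resSymbol hε hε' ξ η
  · rw [Complex.ofReal_inv]

/-- `⟨η⟩⟨ζ⟩(⟨η⟩⟨ζ⟩ + 1 + κ η·ζ)/(⟨η⟩ + ⟨ζ⟩)` with `ζ = ξ - η`. -/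
def ampBase (κ : ℝ) (ξ η : Plane) : ℝ :=
  wt ξ η * (wt ξ η + 1 + κ * dot ξ η) * (bracket η + bracket (ξ - η))⁻¹

/-- Four powers of the weight: one for each of the first two factors and two for the inverse of `⟨η⟩
+ ⟨ξ-η⟩`, which is at least one. -/
theorem exists_bd_ampBase : ∃ K, 0 ≤ K ∧ ∀ {κ : ℝ} {ξ v : Plane}, κ ^ 2 = 1 → ‖v‖ ≤ 1 →
    Bd v (fun η => wt ξ η ^ 4) K fun η => ((ampBase κ ξ η : ℝ) : ℂ) := by
  refine ⟨4 * (4 * 16 * (16 + 1 + 4 * 1 * 8)) * (3 * 4 ^ 2), by norm_num, ?_⟩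
  intro κ ξ v hκ hv
  have hk : ‖(κ : ℂ)‖ = 1 := by
    rw [Complex.norm_real, Real.norm_eq_abs, abs_eq_one_of_sq hκ]
  have h1 := ((bd_wt ξ hv).add (bd_one ξ)).add ((bd_dot ξ hv).const_mul (κ : ℂ))
  have h2 := (bd_bracket_add ξ hv).inv (by norm_num) (one_le_wt ξ) fun η => by
    rw [Complex.norm_real]
    refine le_trans ?_ (Real.le_norm_self _)
    linarith [one_le_bracket η, one_le_bracket (ξ - η)]
  rw [hk] at h1
  refine ((((bd_wt ξ hv).mul h1).mul h2).congr fun η => ?_).mono fun η => ?_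
  · rw [ampBase]
    push_cast
    ring
  · exact le_of_eq (by ring)

end SymbolBounds

/-! ### Weighted integrals, integration by parts and the exact amplitude identities -/

section Oscillatory

/-- Since both `⟨ξ⟩ ≤ 2 wt` and `⟨η⟩ ≤ wt`, `n` powers are spent on decay in `ξ` and three on
integrability in `η`. -/
theorem inv_wt_pow_le (n : ℕ) (ξ η : Plane) :
    (wt ξ η ^ (n + 3))⁻¹ ≤ 2 ^ n * (bracket ξ ^ n)⁻¹ * (bracket η ^ 3)⁻¹ := by
  have h1 : bracket ξ ^ n * bracket η ^ 3 ≤ 2 ^ n * wt ξ η ^ (n + 3) := by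
    rw [pow_add, ← mul_assoc, ← mul_pow]
    refine mul_le_mul (pow_le_pow_left₀ (bracket_pos ξ).le (bracket_le_two_mul_wt ξ η) n)
      (pow_le_pow_left₀ (bracket_pos η).le ?_ 3) (by have := bracket_pos η; positivity)
      (by have := wt_pos ξ η; positivity)
    exact le_mul_of_one_le_right (bracket_pos η).le (one_le_bracket _)
  have h2 := wt_pos ξ η
  have h3 := bracket_pos ξ
  have h4 := bracket_pos η
  rw [mul_assoc, ← mul_inv, ← div_eq_mul_inv, le_div_iff₀ (by positivity), inv_mul_le_iff₀ (by positivity)]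
  linarith

theorem integrable_inv_wt_pow (n : ℕ) (ξ : Plane) :
    Integrable fun η => (wt ξ η ^ (n + 3))⁻¹ := by
  refine ((integrable_inv_bracket_pow le_rfl).const_mul (2 ^ n * (bracket ξ ^ n)⁻¹)).mono'
    ?_ (Eventually.of_forall fun η => ?_)
  · exact (((continuous_wt ξ).pow _).inv₀ fun η =>
      (pow_pos (wt_pos ξ η) _).ne').aestronglyMeasurable
  · rw [Real.norm_of_nonneg (inv_nonneg.2 (pow_pos (wt_pos ξ η) _).le)]
    exact inv_wt_pow_le n ξ η

/-- The total mass of `⟨η⟩⁻³`. -/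
def cubeMass : ℝ := ∫ η : Plane, (bracket η ^ 3)⁻¹

theorem cubeMass_nonneg : 0 ≤ cubeMass :=
  integral_nonneg fun η => inv_nonneg.2 (pow_pos (bracket_pos η) _).le

theorem integrable_of_le_inv_wt {n : ℕ} {ξ : Plane} {D : ℝ} {H : Plane → ℂ} (hH : Continuous H)
    (h : ∀ η, ‖H η‖ ≤ D * (wt ξ η ^ (n + 3))⁻¹) : Integrable H :=
  ((integrable_inv_wt_pow n ξ).const_mul D).mono' hH.aestronglyMeasurable (Eventually.of_forall h)

theorem norm_integral_le_of_le_inv_wt {n : ℕ} {ξ : Plane} {D : ℝ} (hD : 0 ≤ D) {H : Plane → ℂ}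
    (h : ∀ η, ‖H η‖ ≤ D * (wt ξ η ^ (n + 3))⁻¹) :
    ‖∫ η, H η‖ ≤ 2 ^ n * cubeMass * D * (bracket ξ ^ n)⁻¹ := by
  have h1 := norm_integral_le_of_norm_le
    ((integrable_inv_bracket_pow le_rfl).const_mul (D * (2 ^ n * (bracket ξ ^ n)⁻¹)))
    (Eventually.of_forall fun η => (h η).trans (by
      rw [mul_assoc]
      exact mul_le_mul_of_nonneg_left (inv_wt_pow_le n ξ η) hD))
  rw [integral_const_mul] at h1
  refine h1.trans (le_of_eq ?_)
  rw [cubeMass]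
  ring

/-- The unimodular function with phase `x`. -/
def osc (x : ℝ) : ℂ := Complex.exp (Complex.I * x)

theorem norm_osc (x : ℝ) : ‖osc x‖ = 1 := by
  rw [osc, mul_comm]
  exact Complex.norm_exp_ofReal_mul_I x

theorem continuous_osc : Continuous osc := by
  unfold osc
  fun_prop

theorem hasDerivAt_osc (x : ℝ) : HasDerivAt osc (Complex.I * osc x) x := by
  have h : HasDerivAt (fun x : ℝ => Complex.I * (x : ℂ)) (Complex.I * 1) x :=
    (Complex.ofRealCLM.hasDerivAt (x := x)).const_mul Complex.I
  have h2 := h.cexp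
  rw [mul_one, mul_comm] at h2
  exact h2

variable {ξ ω : Plane} {lam : ℝ}

/-- The amplitude `c` turns `∂_ω` into an operator that reproduces `E` with a constant factor `z`;
its transpose `H ↦ -∂_ω(cH)` can be applied repeatedly without ever differentiating `z`. -/
theorem integral_mul_by_parts {E c H : Plane → ℂ} {z : ℂ} (hE : Differentiable ℝ E)
    (hE1 : ∀ η, ‖E η‖ ≤ 1) (hc : ∀ η, c η * dd ω E η = z * E η)
    (hcH : Differentiable ℝ fun η => c η * H η) (h0 : Integrable H)
    (h1 : Integrable fun η => c η * H η) (h2 : Integrable (dd ω fun η => c η * H η)) :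
    z * ∫ η, E η * H η = -∫ η, E η * dd ω (fun η => c η * H η) η := by
  have e : ∀ η, (c η * H η) * fderiv ℝ E η ω = z * (E η * H η) := fun η => by
    have := hc η
    rw [dd] at this
    linear_combination H η * this
  have hEm : AEStronglyMeasurable E := hE.continuous.aestronglyMeasurable
  have hb : ∀ᵐ η, ‖E η‖ ≤ 1 := Eventually.of_forall hE1
  have key := integral_mul_fderiv_eq_neg_fderiv_mul_of_integrable (μ := (volume : Measure Plane))
    (f := fun η => c η * H η) (g := E) (v := ω)
    (h2.mul_bdd (c := 1) hEm hb)
    (by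
      simp only [e]
      exact (h0.bdd_mul (c := 1) hEm hb).const_mul z)
    (h1.mul_bdd (c := 1) hEm hb) (fun x _ => hcH x) (fun x _ => hE x)
  simp only [e] at key
  rw [integral_const_mul] at key
  rw [key]
  congr 1
  refine integral_congr_ae (Eventually.of_forall fun η => ?_)
  exact mul_comm _ _

/-- The phase `⟨η⟩ + κ⟨ξ - η⟩`. -/
def phase (κ : ℝ) (ξ η : Plane) : ℝ := bracket η + κ * bracket (ξ - η)

theorem continuous_phase (κ : ℝ) (ξ : Plane) : Continuous (phase κ ξ) := by
  unfold phase
  exact continuous_bracket.add ((continuous_bracket.comp (by fun_prop)).const_mul κ)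

theorem hasFDerivAt_phase (κ : ℝ) (ξ η : Plane) :
    HasFDerivAt (phase κ ξ)
      ((bracket η)⁻¹ • innerSL ℝ η - (κ * (bracket (ξ - η))⁻¹) • innerSL ℝ (ξ - η)) η := by
  have h : HasFDerivAt (fun η : Plane => ξ - η) (-ContinuousLinearMap.id ℝ Plane) η :=
    (hasFDerivAt_id η).const_sub ξ
  have h1 := (hasFDerivAt_bracket (ξ - η)).comp η h
  refine ((hasFDerivAt_bracket η).add (h1.const_mul κ)).congr_fderiv ?_
  ext u
  simp
  ring

theorem hasFDerivAt_osc_phase (κ : ℝ) (ξ η : Plane) (lam : ℝ) :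
    HasFDerivAt (fun η => osc (lam * phase κ ξ η))
      ((lam • ((bracket η)⁻¹ • innerSL ℝ η
        - (κ * (bracket (ξ - η))⁻¹) • innerSL ℝ (ξ - η))).smulRight
          (Complex.I * osc (lam * phase κ ξ η))) η := by
  have h := (hasDerivAt_osc (lam * phase κ ξ η)).hasFDerivAt.comp η
    ((hasFDerivAt_phase κ ξ η).const_mul lam)
  refine h.congr_fderiv ?_
  ext u
  simp
  ring

theorem dd_osc_phase (κ : ℝ) (ξ : Plane) (lam : ℝ) (ω η : Plane) :
    dd ω (fun η => osc (lam * phase κ ξ η)) η = Complex.I * lam *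
      ((inner ℝ η ω / bracket η - κ * (inner ℝ (ξ - η) ω / bracket (ξ - η)) : ℝ) : ℂ)
        * osc (lam * phase κ ξ η) := by
  rw [dd, (hasFDerivAt_osc_phase κ ξ η lam).fderiv]
  simp [inner_sub_left]
  ring

theorem inner_coord (x y : Plane) : inner ℝ x y = x 0 * y 0 + x 1 * y 1 := by
  rw [PiLp.inner_apply, Fin.sum_univ_two]
  simp
  ring

/-- The wedge product of two vectors of the plane. -/
def wedge (x y : Plane) : ℝ := x 0 * y 1 - x 1 * y 0

/-- Write `ζ = ξ - η`, `a = ⟨η⟩`, `b = ⟨ζ⟩`, `d = η·ζ`. Expanding `(η + ζ)·(bη + aζ)` with `|η|² =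
a² - 1`, `|ζ|² = b² - 1` gives `(a + b)(ab - 1 + d)`. The conjugate factor `ab + 1 - d` in `ampBase`
rationalizes this: `a²b² - (1 - d)² = |ξ|² + (η ∧ ξ)² = r²(1 + (η ∧ ω)²)`. A factor `r` then
cancels. -/
theorem ampBase_neg_one_mul (η : Plane) {r : ℝ} (hr : 0 < r) (hω : ω 0 ^ 2 + ω 1 ^ 2 = 1)
    (hξ : ξ = r • ω) :
    ampBase (-1) ξ η * (1 + wedge η ω ^ 2)⁻¹
      * (inner ℝ η ω / bracket η - (-1) * (inner ℝ (ξ - η) ω / bracket (ξ - η))) = r := by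
  have ha := bracket_pos η
  have hb := bracket_pos (ξ - η)
  have hA := bracket_sq_coord η
  have hB := bracket_sq_coord (ξ - η)
  have hx0 : ξ 0 = r * ω 0 := by rw [hξ]; simp
  have hx1 : ξ 1 = r * ω 1 := by rw [hξ]; simp
  have hk : 0 < 1 + wedge η ω ^ 2 := by positivity
  rw [inner_coord, inner_coord]
  simp only [ampBase, wt, dot]
  set a := bracket η
  set b := bracket (ξ - η)
  simp only [PiLp.sub_apply, hx0, hx1] at hB ⊢
  rw [wedge] at hk ⊢
  set x := η 0
  set y := η 1
  set o := ω 0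
  set p := ω 1
  have hN : r * ((x * o + y * p) * b + ((r * o - x) * o + (r * p - y) * p) * a)
      = (a + b) * (a * b - 1 + (x * (r * o - x) + y * (r * p - y))) := by
    linear_combination (-b) * hA - a * hB
  have hM : (a * b + 1 - (x * (r * o - x) + y * (r * p - y)))
      * (a * b - 1 + (x * (r * o - x) + y * (r * p - y))) = r ^ 2 * (1 + (x * p - y * o) ^ 2) := by
    linear_combination (b ^ 2) * hA + (1 + x ^ 2 + y ^ 2) * hB + r ^ 2 * hω
  have hab : 0 < a + b := by positivity
  have key : (a * b + 1 - (x * (r * o - x) + y * (r * p - y)))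
      * ((x * o + y * p) * b + ((r * o - x) * o + (r * p - y) * p) * a)
      = r * ((a + b) * (1 + (x * p - y * o) ^ 2)) := by
    refine mul_left_cancel₀ hr.ne' ?_
    linear_combination (a * b + 1 - (x * (r * o - x) + y * (r * p - y))) * hN + (a + b) * hM
  field_simp
  linear_combination key

/-- The same computation with `η - ζ = 2ρω` in place of `η + ζ = rω`. Now `a²b² - (1 + d)² = |η -
ζ|² + (η ∧ ζ)² = ρ²(4 + (ω ∧ ξ)²)`, because `η ∧ ζ = ρ ω ∧ ξ` for points symmetric about `ξ/2`. -/
theorem ampBase_one_mul {η : Plane} {ρ : ℝ} (hρ : 0 < ρ) (hω : ω 0 ^ 2 + ω 1 ^ 2 = 1)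
    (hη : η = (1 / 2 : ℝ) • ξ + ρ • ω) :
    2 * ampBase 1 ξ η * (4 + wedge ω ξ ^ 2)⁻¹
      * (inner ℝ η ω / bracket η - 1 * (inner ℝ (ξ - η) ω / bracket (ξ - η))) = ρ := by
  have ha := bracket_pos η
  have hb := bracket_pos (ξ - η)
  have hA := bracket_sq_coord η
  have hB := bracket_sq_coord (ξ - η)
  have hx0 : η 0 = ξ 0 / 2 + ρ * ω 0 := by rw [hη]; simp; ring
  have hx1 : η 1 = ξ 1 / 2 + ρ * ω 1 := by rw [hη]; simp; ring
  have hk : 0 < 4 + wedge ω ξ ^ 2 := by positivity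
  rw [inner_coord, inner_coord]
  simp only [ampBase, wt, dot]
  set a := bracket η
  set b := bracket (ξ - η)
  simp only [PiLp.sub_apply, hx0, hx1] at hA hB ⊢
  rw [wedge] at hk ⊢
  set x := ξ 0
  set y := ξ 1
  set o := ω 0
  set p := ω 1
  set d := (x / 2 + ρ * o) * (x - (x / 2 + ρ * o)) + (y / 2 + ρ * p) * (y - (y / 2 + ρ * p)) with hd
  have hN : 2 * ρ * (((x / 2 + ρ * o) * o + (y / 2 + ρ * p) * p) * b
      - ((x - (x / 2 + ρ * o)) * o + (y - (y / 2 + ρ * p)) * p) * a)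
      = (a + b) * (a * b - 1 - d) := by
    rw [hd]
    linear_combination (-b) * hA - a * hB
  have hM : (a * b + 1 + d) * (a * b - 1 - d) = ρ ^ 2 * (4 + (o * y - p * x) ^ 2) := by
    rw [hd]
    linear_combination (b ^ 2) * hA + (1 + (x / 2 + ρ * o) ^ 2 + (y / 2 + ρ * p) ^ 2) * hB
      + 4 * ρ ^ 2 * hω
  have hab : 0 < a + b := by positivity
  have key : 2 * (a * b + 1 + d) * (((x / 2 + ρ * o) * o + (y / 2 + ρ * p) * p) * b
      - ((x - (x / 2 + ρ * o)) * o + (y - (y / 2 + ρ * p)) * p) * a)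
      = ρ * ((a + b) * (4 + (o * y - p * x) ^ 2)) := by
    refine mul_left_cancel₀ hρ.ne' ?_
    linear_combination (a * b + 1 + d) * hN + (a + b) * hM
  clear_value d
  generalize (x / 2 + ρ * o) * o + (y / 2 + ρ * p) * p = u at key ⊢
  generalize (x - (x / 2 + ρ * o)) * o + (y - (y / 2 + ρ * p)) * p = u' at key ⊢
  field_simp
  linear_combination key

end Oscillatory

/-! ### Opposite signs: decay away from frequency zero -/

section Estimates

variable {ξ : Plane} {lam : ℝ}

/-- The room of ten powers is what two integrations by parts consume: two for the inverse resonance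
function and four for each use of the amplitude. -/
theorem pow_mul_inv_wt_le {n j : ℕ} (hj : j ≤ 10) (ξ η : Plane) :
    (wt ξ η ^ (n + 13))⁻¹ * wt ξ η ^ j ≤ (wt ξ η ^ (n + 3))⁻¹ := by
  have h := wt_pos ξ η
  have h1 : wt ξ η ^ j ≤ wt ξ η ^ 10 := pow_le_pow_right₀ (one_le_wt ξ η) hj
  rw [inv_mul_le_iff₀ (by positivity), show n + 13 = 10 + (n + 3) by ring, pow_add, mul_assoc,
    mul_inv_cancel₀ (by positivity), mul_one]
  exact h1

theorem contDiff_wedge (ω : Plane) : ContDiff ℝ 2 fun η => wedge η ω := by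
  unfold wedge
  fun_prop

theorem exists_bd_ampMinus : ∃ K, 0 ≤ K ∧ ∀ {ξ ω : Plane}, ‖ω‖ ≤ 1 →
    Bd ω (fun η => wt ξ η ^ 4) K
      fun η => ((ampBase (-1) ξ η * (1 + wedge η ω ^ 2)⁻¹ : ℝ) : ℂ) := by
  obtain ⟨K, hK, hb⟩ := exists_bd_ampBase
  refine ⟨4 * K * 1, by positivity, fun {ξ ω} hω => ?_⟩
  have hp : ∀ η, 0 < 1 + wedge η ω ^ 2 := fun η => by positivity
  -- The wedge with `ω` does not change along `ω`, so this factor is a constant for the calculus in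
  -- that direction.
  have h1 : Bd ω (fun _ => 1) 1 fun η => (((1 + wedge η ω ^ 2)⁻¹ : ℝ) : ℂ) := by
    refine Bd.of_invariant ?_ ?_ ?_
    · refine Complex.ofRealCLM.contDiff.comp (ContDiff.inv ?_ fun η => (hp η).ne')
      exact contDiff_const.add ((contDiff_wedge ω).pow 2)
    · intro η t
      have : wedge (η + t • ω) ω = wedge η ω := by
        simp [wedge]
        ring
      rw [this]
    · intro η
      rw [Complex.norm_real, Real.norm_of_nonneg (inv_nonneg.2 (hp η).le)]
      exact inv_le_one_of_one_le₀ (by nlinarith [sq_nonneg (wedge η ω)])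
  refine (((hb (κ := -1) (ξ := ξ) (by norm_num) hω).mul h1).congr fun η => ?_).mono fun η => ?_
  · push_cast
    rfl
  · rw [mul_one, mul_one]

theorem Bd.trivial_bound {n : ℕ} {v : Plane} {D : ℝ} {F : Plane → ℂ}
    (hF : Bd v (fun η => (wt ξ η ^ (n + 13))⁻¹ * wt ξ η ^ 2) D F) (hD : 0 ≤ D) (η : Plane) :
    ‖F η‖ ≤ D * (wt ξ η ^ (n + 3))⁻¹ :=
  (hF.b0 η).trans (mul_le_mul_of_nonneg_left (pow_mul_inv_wt_le (by norm_num) ξ η) hD)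

/-- Decay of the oscillatory integral with the phase `⟨η⟩ - ⟨ξ - η⟩`, which is stationary only at
the frequency `ξ = 0`. -/
theorem exists_osc_minus_bound (n : ℕ) : ∃ K, 0 ≤ K ∧ ∀ (ξ : Plane) (lam : ℝ) (D : ℝ)
    (F : Plane → ℂ), 0 ≤ D →
    (∀ v, ‖v‖ ≤ 1 → Bd v (fun η => (wt ξ η ^ (n + 13))⁻¹ * wt ξ η ^ 2) D F) →
    ‖∫ η, osc (lam * phase (-1) ξ η) * F η‖ * (1 + lam ^ 2 * ‖ξ‖ ^ 2)
      ≤ K * D * (bracket ξ ^ n)⁻¹ := by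
  obtain ⟨K, hK, hc⟩ := exists_bd_ampMinus
  have hM := cubeMass_nonneg
  refine ⟨2 ^ n * cubeMass * (1 + 2 * K * (4 * K)), by positivity, ?_⟩
  intro ξ lam D F hD hF
  have hX : 0 ≤ (bracket ξ ^ n)⁻¹ := inv_nonneg.2 (pow_nonneg (bracket_pos ξ).le _)
  set J := ∫ η, osc (lam * phase (-1) ξ η) * F η with hJ
  have htriv : ‖J‖ ≤ 2 ^ n * cubeMass * D * (bracket ξ ^ n)⁻¹ := by
    refine norm_integral_le_of_le_inv_wt hD fun η => ?_
    rw [norm_mul, norm_osc, one_mul]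
    exact (hF 0 (by simp)).trivial_bound hD η
  have hmain : ‖J‖ * (lam ^ 2 * ‖ξ‖ ^ 2)
      ≤ 2 ^ n * cubeMass * (2 * K * (4 * K) * D) * (bracket ξ ^ n)⁻¹ := by
    -- At `ξ = 0` there is no direction to integrate along, but the factor `‖ξ‖²` on the left
    -- vanishes.
    rcases eq_or_ne ξ 0 with h0 | h0
    · rw [h0, norm_zero]
      have := bracket_pos (0 : Plane)
      rw [h0] at hX
      ring_nf
      positivity
    set r := ‖ξ‖ with hr
    have hr0 : 0 < r := norm_pos_iff.2 h0
    set ω : Plane := r⁻¹ • ξ with hω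
    have hω1 : ‖ω‖ = 1 := by
      rw [hω, norm_smul, norm_inv, Real.norm_of_nonneg hr0.le, ← hr, inv_mul_cancel₀ hr0.ne']
    have hω2 : ω 0 ^ 2 + ω 1 ^ 2 = 1 := by
      rw [← Fin.sum_univ_two (fun i => ω i ^ 2), ← EuclideanSpace.real_norm_sq_eq, hω1, one_pow]
    have hξ : ξ = r • ω := by rw [hω, smul_smul, mul_inv_cancel₀ hr0.ne', one_smul]
    have bc := hc (ξ := ξ) hω1.le
    have bF := hF ω hω1.le
    have bcF := bc.mul bF
    set c : Plane → ℂ := fun η => ((ampBase (-1) ξ η * (1 + wedge η ω ^ 2)⁻¹ : ℝ) : ℂ) with hcdef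
    set E : Plane → ℂ := fun η => osc (lam * phase (-1) ξ η) with hE
    have hEd : Differentiable ℝ E := fun η =>
      (hasFDerivAt_osc_phase (-1) ξ η lam).differentiableAt
    have hE1 : ∀ η, ‖E η‖ ≤ 1 := fun η => (norm_osc _).le
    have hcE : ∀ η, c η * dd ω E η = (Complex.I * lam * r) * E η := fun η => by
      have h := ampBase_neg_one_mul (ξ := ξ) (ω := ω) η hr0 hω2 hξ
      have h' := congrArg (fun x : ℝ => (x : ℂ)) h
      simp only [Complex.ofReal_mul] at h'
      rw [hE, dd_osc_phase, hcdef]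
      simp only [Complex.ofReal_mul]
      linear_combination (Complex.I * lam * osc (lam * phase (-1) ξ η)) * h'
    have w6 : ∀ η, wt ξ η ^ 4 * ((wt ξ η ^ (n + 13))⁻¹ * wt ξ η ^ 2) ≤ (wt ξ η ^ (n + 3))⁻¹ :=
      fun η => (le_of_eq (by ring)).trans (pow_mul_inv_wt_le (j := 6) (by norm_num) ξ η)
    have w10 : ∀ η, wt ξ η ^ 4 * (wt ξ η ^ 4 * ((wt ξ η ^ (n + 13))⁻¹ * wt ξ η ^ 2))
        ≤ (wt ξ η ^ (n + 3))⁻¹ :=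
      fun η => (le_of_eq (by ring)).trans (pow_mul_inv_wt_le (j := 10) (by norm_num) ξ η)
    have hD' : 0 ≤ 4 * K * D := by positivity
    have i0 : Integrable F := integrable_of_le_inv_wt bF.smooth.continuous (bF.trivial_bound hD)
    have i1 : Integrable fun η => c η * F η :=
      integrable_of_le_inv_wt bcF.smooth.continuous
        fun η => (bcF.b0 η).trans (mul_le_mul_of_nonneg_left (w6 η) hD')
    have i2 : Integrable (dd ω fun η => c η * F η) :=
      integrable_of_le_inv_wt bcF.contDiff_one.continuous
        fun η => (bcF.b1 η).trans (mul_le_mul_of_nonneg_left (w6 η) hD')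
    have key : ∀ η, ∀ {x y : ℂ}, ‖x‖ ≤ K * wt ξ η ^ 4 →
        ‖y‖ ≤ 4 * K * D * (wt ξ η ^ 4 * ((wt ξ η ^ (n + 13))⁻¹ * wt ξ η ^ 2)) →
        ‖x * y‖ ≤ K * (4 * K) * D * (wt ξ η ^ (n + 3))⁻¹ := fun η x y hx hy => by
      rw [norm_mul]
      refine (mul_le_mul hx hy (norm_nonneg _) (bc.bound_nonneg η)).trans ?_
      have h10 := mul_le_mul_of_nonneg_left (w10 η) (by positivity : 0 ≤ K * (4 * K) * D)
      linarith
    have hcd : Differentiable ℝ fun η => c η * dd ω (fun η => c η * F η) η :=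
      bc.differentiable.mul bcF.differentiable_dd
    have e3 := dd_mul (v := ω) bc.differentiable bcF.differentiable_dd
    -- The first integration by parts leaves `∂_ω(cF)` with constant `4KD`; the second gives the two
    -- Leibniz terms of `∂_ω(c ∂_ω(cF))`, each at most `K · 4KD`.
    have b3 : ∀ η, ‖dd ω (fun η => c η * dd ω (fun η => c η * F η) η) η‖
        ≤ 2 * K * (4 * K) * D * (wt ξ η ^ (n + 3))⁻¹ := fun η => by
      rw [e3]
      refine (norm_add_le _ _).trans ?_
      linarith [key η (bc.b1 η) (bcF.b1 η), key η (bc.b0 η) (bcF.b2 η)]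
    have i3 : Integrable fun η => c η * dd ω (fun η => c η * F η) η :=
      integrable_of_le_inv_wt hcd.continuous fun η => key η (bc.b0 η) (bcF.b1 η)
    have c4 : Continuous (dd ω fun η => c η * dd ω (fun η => c η * F η) η) := by
      rw [e3]
      exact (bc.contDiff_one.continuous.mul bcF.contDiff_one.continuous).add
        (bc.smooth.continuous.mul bcF.continuous_dd_dd)
    have i4 : Integrable (dd ω fun η => c η * dd ω (fun η => c η * F η) η) :=
      integrable_of_le_inv_wt c4 b3
    have p1 := integral_mul_by_parts hEd hE1 hcE bcF.differentiable i0 i1 i2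
    have p2 := integral_mul_by_parts hEd hE1 hcE hcd i2 i3 i4
    have p3 : (Complex.I * lam * r) ^ 2 * J
        = ∫ η, E η * dd ω (fun η => c η * dd ω (fun η => c η * F η) η) η := by
      rw [hJ]
      linear_combination (Complex.I * lam * r) * p1 - p2
    have hn : ‖(Complex.I * lam * r) ^ 2 * J‖ = ‖J‖ * (lam ^ 2 * r ^ 2) := by
      rw [norm_mul, norm_pow, norm_mul, norm_mul, Complex.norm_I, Complex.norm_real,
        Complex.norm_real, one_mul, mul_pow, Real.norm_eq_abs, Real.norm_eq_abs, sq_abs, sq_abs,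
        mul_comm]
    rw [← hn, p3]
    refine norm_integral_le_of_le_inv_wt (by positivity) fun η => ?_
    rw [norm_mul]
    exact (mul_le_of_le_one_left (norm_nonneg _) (hE1 η)).trans (b3 η)
  linarith

end Estimates

/-! ### Polar coordinates in the plane and integration by parts on a ray -/

section Polar

/-- The unit vector at angle `φ`. -/
def dir (φ : ℝ) : Plane := !₂[Real.cos φ, Real.sin φ]

theorem dir_sq (φ : ℝ) : dir φ 0 ^ 2 + dir φ 1 ^ 2 = 1 := by
  simp [dir]

theorem norm_dir (φ : ℝ) : ‖dir φ‖ = 1 := by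
  rw [← sq_eq_sq₀ (norm_nonneg _) zero_le_one, EuclideanSpace.real_norm_sq_eq, Fin.sum_univ_two,
    dir_sq, one_pow]

theorem continuous_dir : Continuous dir := by
  unfold dir
  fun_prop

theorem integral_plane_eq (G : Plane → ℂ) : ∫ η, G η = ∫ p : ℝ × ℝ, G !₂[p.1, p.2] := by
  let e : Plane ≃ᵐ ℝ × ℝ :=
    (MeasurableEquiv.toLp 2 (Fin 2 → ℝ)).symm.trans MeasurableEquiv.finTwoArrow
  have he : MeasurePreserving e volume volume :=
    (EuclideanSpace.volume_preserving_symm_measurableEquiv_toLp (Fin 2)).trans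
      (volume_preserving_finTwoArrow ℝ)
  rw [← he.integral_comp']
  refine integral_congr_ae (Eventually.of_forall fun η => ?_)
  have h : (!₂[(e η).1, (e η).2] : Plane) = η := by
    ext i
    fin_cases i <;> rfl
  exact congrArg G h.symm

theorem integral_eq_polar (G : Plane → ℂ) :
    ∫ η, G η = ∫ p in Set.Ioi (0 : ℝ) ×ˢ Set.Ioo (-Real.pi) Real.pi,
      (p.1 : ℂ) * G (p.1 • dir p.2) := by
  rw [integral_plane_eq, ← integral_comp_polarCoord_symm]
  refine integral_congr_ae (Eventually.of_forall fun p => ?_)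
  have h : (!₂[(polarCoord.symm p).1, (polarCoord.symm p).2] : Plane) = p.1 • dir p.2 := by
    ext i
    fin_cases i <;> simp [dir]
  simp only [h, Complex.real_smul]

/-- The majorant with constant `B` only justifies Fubini, so `B` may depend on the oscillation
parameter; the bound itself uses only the uniform control `M` on rays. -/
theorem norm_integral_le_polar {G : Plane → ℂ} (hG : Continuous G) {B M : ℝ}
    (hB : ∀ ρ φ : ℝ, 0 < ρ → ‖(ρ : ℂ) * G (ρ • dir φ)‖ ≤ B * (1 + ρ ^ 2)⁻¹)
    (hM : ∀ φ, ‖∫ ρ in Set.Ioi (0 : ℝ), (ρ : ℂ) * G (ρ • dir φ)‖ ≤ M) :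
    ‖∫ η, G η‖ ≤ 2 * Real.pi * M := by
  have hint : Integrable (fun p : ℝ × ℝ => (p.1 : ℂ) * G (p.1 • dir p.2))
      ((volume.restrict (Set.Ioi (0 : ℝ))).prod
        (volume.restrict (Set.Ioo (-Real.pi) Real.pi))) := by
    have h1 : Integrable (fun p : ℝ × ℝ => B * (1 + p.1 ^ 2)⁻¹ * (1 : ℝ))
        ((volume.restrict (Set.Ioi (0 : ℝ))).prod
          (volume.restrict (Set.Ioo (-Real.pi) Real.pi))) :=
      Integrable.mul_prod (f := fun ρ : ℝ => B * (1 + ρ ^ 2)⁻¹) (g := fun _ : ℝ => (1 : ℝ))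
        (integrable_inv_one_add_sq.const_mul B).integrableOn
        (integrable_const (1 : ℝ))
    refine h1.mono' ?_ ?_
    · have : Continuous fun p : ℝ × ℝ => (p.1 : ℂ) * G (p.1 • dir p.2) := by
        refine (Complex.continuous_ofReal.comp continuous_fst).mul (hG.comp ?_)
        exact continuous_fst.smul (continuous_dir.comp continuous_snd)
      exact this.aestronglyMeasurable
    · rw [Measure.prod_restrict]
      filter_upwards [ae_restrict_mem (measurableSet_Ioi.prod measurableSet_Ioo)] with p hp
      rw [mul_one]
      exact hB p.1 p.2 hp.1
  rw [integral_eq_polar, Measure.volume_eq_prod, ← Measure.prod_restrict, integral_prod_symm _ hint]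
  refine (norm_integral_le_of_norm_le_const (Eventually.of_forall hM)).trans (le_of_eq ?_)
  rw [measureReal_restrict_apply_univ, Real.volume_real_Ioo_of_le (by linarith [Real.pi_pos])]
  ring

/-- The boundary term at the origin contributes `M`, and `∫ (1 + x²)⁻¹ = π` over the line bounds the
remaining integral. -/
theorem norm_integral_Ioi_mul_deriv_le {H H' E E' : ℝ → ℂ} {M : ℝ}
    (hH : ∀ x, HasDerivAt H (H' x) x) (hE : ∀ x, HasDerivAt E (E' x) x) (hE1 : ∀ x, ‖E x‖ ≤ 1)
    (b0 : ∀ x, ‖H x‖ ≤ M * (1 + x ^ 2)⁻¹) (b1 : ∀ x, ‖H' x‖ ≤ M * (1 + x ^ 2)⁻¹)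
    (hc : Continuous H') (hint : IntegrableOn (fun x => H x * E' x) (Set.Ioi 0)) :
    ‖∫ x in Set.Ioi (0 : ℝ), H x * E' x‖ ≤ M * (1 + Real.pi) := by
  have hEc : Continuous E := continuous_iff_continuousAt.2 fun x => (hE x).continuousAt
  have hHc : Continuous H := continuous_iff_continuousAt.2 fun x => (hH x).continuousAt
  have hM : 0 ≤ M := by simpa using (norm_nonneg _).trans (b0 0)
  have bHE : ∀ x, ‖H' x * E x‖ ≤ M * (1 + x ^ 2)⁻¹ := fun x => by
    rw [norm_mul]
    exact (mul_le_of_le_one_right (norm_nonneg _) (hE1 x)).trans (b1 x)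
  have i1 : Integrable fun x => H' x * E x :=
    (integrable_inv_one_add_sq.const_mul M).mono' (hc.mul hEc).aestronglyMeasurable
      (Eventually.of_forall bHE)
  have hlim : Tendsto (H * E) atTop (𝓝 0) := by
    rw [tendsto_zero_iff_norm_tendsto_zero]
    have h0 : Tendsto (fun x : ℝ => M * (1 + x ^ 2)⁻¹) atTop (𝓝 (M * 0)) := by
      refine Tendsto.const_mul M (tendsto_inv_atTop_zero.comp ?_)
      exact tendsto_atTop_add_const_left _ _ (tendsto_pow_atTop (by norm_num))
    rw [mul_zero] at h0
    refine squeeze_zero (fun _ => norm_nonneg _) (fun x => ?_) h0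
    rw [Pi.mul_apply, norm_mul]
    exact (mul_le_of_le_one_right (norm_nonneg _) (hE1 x)).trans (b0 x)
  have key := integral_Ioi_mul_deriv_eq_deriv_mul (a := (0 : ℝ)) (u := H) (v := E) (u' := H')
    (v' := E') (a' := H 0 * E 0) (b' := 0) (fun x _ => hH x) (fun x _ => hE x) hint
    i1.integrableOn ((hHc.mul hEc).continuousWithinAt) hlim
  rw [key, zero_sub]
  refine (norm_sub_le _ _).trans ?_
  have h1 : ‖-(H 0 * E 0)‖ ≤ M := by
    rw [norm_neg, norm_mul]
    refine (mul_le_of_le_one_right (norm_nonneg _) (hE1 0)).trans ?_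
    simpa using b0 0
  have h2 : ‖∫ x in Set.Ioi (0 : ℝ), H' x * E x‖ ≤ M * Real.pi := by
    refine (norm_integral_le_of_norm_le (integrable_inv_one_add_sq.const_mul M).integrableOn
      (Eventually.of_forall bHE)).trans ?_
    rw [← integral_univ_inv_one_add_sq, ← integral_const_mul]
    refine setIntegral_le_integral (integrable_inv_one_add_sq.const_mul M)
      (Eventually.of_forall fun x => ?_)
    change 0 ≤ M * (1 + x ^ 2)⁻¹
    positivity
  linarith

end Polar

/-! ### Equal signs: decay around the stationary point `ξ/2` -/

section Estimates

variable {ξ : Plane}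

theorem one_add_sq_le_wt_sq (ξ ω : Plane) (hω : ω 0 ^ 2 + ω 1 ^ 2 = 1) (ρ : ℝ) :
    1 + ρ ^ 2 ≤ wt ξ ((1 / 2 : ℝ) • ξ + ρ • ω) ^ 2 := by
  rw [wt_sq]
  simp only [PiLp.sub_apply, PiLp.add_apply, PiLp.smul_apply, smul_eq_mul]
  set x := ξ 0
  set y := ξ 1
  have h : (1 / 2 * x + ρ * ω 0) ^ 2 + (1 / 2 * y + ρ * ω 1) ^ 2
      + (x - (1 / 2 * x + ρ * ω 0)) ^ 2 + (y - (1 / 2 * y + ρ * ω 1)) ^ 2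
      = (x ^ 2 + y ^ 2) / 2 + 2 * ρ ^ 2 := by
    linear_combination (2 * ρ ^ 2) * hω
  nlinarith [sq_nonneg x, sq_nonneg y, sq_nonneg ρ,
    mul_nonneg (add_nonneg (sq_nonneg (1 / 2 * x + ρ * ω 0)) (sq_nonneg (1 / 2 * y + ρ * ω 1)))
      (add_nonneg (sq_nonneg (x - (1 / 2 * x + ρ * ω 0))) (sq_nonneg (y - (1 / 2 * y + ρ * ω 1))))]

/-- On a ray from `ξ/2` the weight is at least `√(1 + ρ²)`. Of the `n + 3` powers, `n` give decay in
`ξ`, one absorbs the Jacobian and two give integrability in `ρ`. -/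
theorem inv_wt_pow_le_radial (n : ℕ) (ξ ω : Plane) (hω : ω 0 ^ 2 + ω 1 ^ 2 = 1) (ρ : ℝ) :
    (1 + |ρ|) * (wt ξ ((1 / 2 : ℝ) • ξ + ρ • ω) ^ (n + 3))⁻¹
      ≤ 2 * 2 ^ n * (bracket ξ ^ n)⁻¹ * (1 + ρ ^ 2)⁻¹ := by
  set W := wt ξ ((1 / 2 : ℝ) • ξ + ρ • ω) with hW
  have hW1 : 1 ≤ W := one_le_wt _ _
  have h1 : 1 + ρ ^ 2 ≤ W ^ 2 := one_add_sq_le_wt_sq ξ ω hω ρ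
  have h2 : 1 + |ρ| ≤ 2 * W := by
    have : |ρ| ≤ W := abs_le_of_sq_le_sq (by linarith) (by linarith)
    linarith
  have h3 := pow_le_pow_left₀ (bracket_pos ξ).le (bracket_le_two_mul_wt ξ ((1 / 2 : ℝ) • ξ + ρ • ω)) n
  have hb := bracket_pos ξ
  rw [← hW, mul_pow] at h3
  have h4 : (1 + |ρ|) * (bracket ξ ^ n * (1 + ρ ^ 2)) ≤ (2 * W) * ((2 ^ n * W ^ n) * W ^ 2) := by
    gcongr
  rw [mul_assoc, ← mul_inv, ← div_eq_mul_inv, ← div_eq_mul_inv, div_le_div_iff₀ (by positivity) (by positivity)]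
  refine h4.trans (le_of_eq ?_)
  ring

theorem hasDerivAt_comp_ray {A : Plane → ℂ} (hA : Differentiable ℝ A) (p ω : Plane) (ρ : ℝ) :
    HasDerivAt (fun ρ : ℝ => A (p + ρ • ω)) (dd ω A (p + ρ • ω)) ρ := by
  have h : HasDerivAt (fun ρ : ℝ => p + ρ • ω) ω ρ := by
    simpa using ((hasDerivAt_id ρ).smul_const ω).const_add p
  exact (hA (p + ρ • ω)).hasFDerivAt.comp_hasDerivAt ρ h

/-- Decay of the oscillatory integral with the phase `⟨η⟩ + ⟨ξ - η⟩`, which is stationary at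
`η = ξ / 2`. -/
theorem exists_osc_plus_bound (n : ℕ) : ∃ K, 0 ≤ K ∧ ∀ (ξ : Plane) (lam : ℝ) (D : ℝ)
    (F : Plane → ℂ), 0 ≤ D →
    (∀ v, ‖v‖ ≤ 1 → Bd v (fun η => (wt ξ η ^ (n + 13))⁻¹ * wt ξ η ^ 2) D F) →
    ‖∫ η, osc (lam * phase 1 ξ η) * F η‖ * (1 + |lam|) ≤ K * D * (bracket ξ ^ n)⁻¹ := by
  obtain ⟨K, hK, hc⟩ := exists_bd_ampBase
  have hM := cubeMass_nonneg
  refine ⟨2 ^ n * cubeMass + 2 * Real.pi * (16 * K * (2 * 2 ^ n) * (1 + Real.pi)),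
    by positivity, ?_⟩
  intro ξ lam D F hD hF
  have hX : 0 ≤ (bracket ξ ^ n)⁻¹ := inv_nonneg.2 (pow_nonneg (bracket_pos ξ).le _)
  set J := ∫ η, osc (lam * phase 1 ξ η) * F η with hJ
  have htriv : ‖J‖ ≤ 2 ^ n * cubeMass * D * (bracket ξ ^ n)⁻¹ := by
    refine norm_integral_le_of_le_inv_wt hD fun η => ?_
    rw [norm_mul, norm_osc, one_mul]
    exact (hF 0 (by simp)).trivial_bound hD η
  have hFb : ∀ η, ‖F η‖ ≤ D * (wt ξ η ^ (n + 3))⁻¹ := (hF 0 (by simp)).trivial_bound hD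
  have hFc : Continuous F := (hF 0 (by simp)).smooth.continuous
  have hmain : ‖J‖ * |lam| ≤ 2 * Real.pi * (16 * K * (2 * 2 ^ n) * (1 + Real.pi)
      * D * (bracket ξ ^ n)⁻¹) := by
    -- The integral is recentred at the stationary point, and the factor `iλ` to be gained is put
    -- inside.
    set G : Plane → ℂ := fun y => (Complex.I * lam) *
      (osc (lam * phase 1 ξ ((1 / 2 : ℝ) • ξ + y)) * F ((1 / 2 : ℝ) • ξ + y)) with hG
    have hJG : ∫ y, G y = (Complex.I * lam) * J := by
      rw [hG, integral_const_mul, hJ]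
      congr 1
      exact integral_add_left_eq_self (fun η => osc (lam * phase 1 ξ η) * F η) _
    have hn : ‖J‖ * |lam| = ‖∫ y, G y‖ := by
      rw [hJG, norm_mul, norm_mul, Complex.norm_I, Complex.norm_real, one_mul, Real.norm_eq_abs,
        mul_comm]
    have hGc : Continuous G := by
      refine continuous_const.mul (Continuous.mul ?_ (hFc.comp (by fun_prop)))
      exact continuous_osc.comp (continuous_const.mul ((continuous_phase 1 ξ).comp (by fun_prop)))
    -- This bound grows with `|lam|`; it is needed for integrability only.
    have hGn : ∀ ρ φ : ℝ, 0 < ρ → ‖(ρ : ℂ) * G (ρ • dir φ)‖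
        ≤ (|lam| * D * (2 * 2 ^ n * (bracket ξ ^ n)⁻¹)) * (1 + ρ ^ 2)⁻¹ := by
      intro ρ φ hρ
      have h1 := inv_wt_pow_le_radial n ξ (dir φ) (dir_sq φ) ρ
      have h2 := hFb ((1 / 2 : ℝ) • ξ + ρ • dir φ)
      rw [abs_of_pos hρ] at h1
      set W := (wt ξ ((1 / 2 : ℝ) • ξ + ρ • dir φ) ^ (n + 3))⁻¹
      have hW : 0 ≤ W := inv_nonneg.2 (pow_nonneg (wt_pos _ _).le _)
      simp only [hG]
      rw [norm_mul, norm_mul, norm_mul, norm_mul, norm_osc, Complex.norm_I, Complex.norm_real,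
        Complex.norm_real, one_mul, one_mul, Real.norm_eq_abs, Real.norm_eq_abs, abs_of_pos hρ]
      calc ρ * (|lam| * ‖F ((1 / 2 : ℝ) • ξ + ρ • dir φ)‖) ≤ ρ * (|lam| * (D * W)) := by gcongr
        _ ≤ |lam| * D * ((1 + ρ) * W) := by
            nlinarith [mul_nonneg (mul_nonneg (abs_nonneg lam) hD) hW]
        _ ≤ |lam| * D * (2 * 2 ^ n * (bracket ξ ^ n)⁻¹ * (1 + ρ ^ 2)⁻¹) := by gcongr
        _ = _ := by ring
    rw [hn]
    refine norm_integral_le_polar hGc hGn fun φ => ?_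
    set ω := dir φ with hω
    have hω1 : ‖ω‖ ≤ 1 := (norm_dir φ).le
    have hω2 : ω 0 ^ 2 + ω 1 ^ 2 = 1 := dir_sq φ
    have hk : 0 < 4 + wedge ω ξ ^ 2 := by positivity
    set z : ℂ := ((2 * (4 + wedge ω ξ ^ 2)⁻¹ : ℝ) : ℂ) with hz
    have hz1 : ‖z‖ ≤ 1 := by
      rw [hz, Complex.norm_real, Real.norm_of_nonneg (by positivity), ← div_eq_mul_inv,
        div_le_one hk]
      nlinarith [sq_nonneg (wedge ω ξ)]
    have bc := (hc (κ := 1) (ξ := ξ) (by norm_num) hω1).const_mul z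
    have bcF := bc.mul (hF ω hω1)
    set c : Plane → ℂ := fun η => z * ((ampBase 1 ξ η : ℝ) : ℂ) with hcdef
    set E : Plane → ℂ := fun η => osc (lam * phase 1 ξ η) with hE
    have hEd : Differentiable ℝ E := fun η =>
      (hasFDerivAt_osc_phase 1 ξ η lam).differentiableAt
    set p : Plane := (1 / 2 : ℝ) • ξ with hp
    -- The polar Jacobian `ρ` is exactly what the amplitude produces, so `iλρE` is `c` times the
    -- radial derivative of `E`, with no singularity at the origin.
    have hcE : ∀ ρ : ℝ, 0 < ρ → c (p + ρ • ω) * dd ω E (p + ρ • ω)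
        = (Complex.I * lam) * (ρ * E (p + ρ • ω)) := fun ρ hρ => by
      have h := ampBase_one_mul (ξ := ξ) (ω := ω) hρ hω2 (η := p + ρ • ω) rfl
      have h' := congrArg (fun x : ℝ => (x : ℂ)) h
      simp only [Complex.ofReal_mul] at h'
      rw [hE, dd_osc_phase, hcdef, hz]
      simp only [Complex.ofReal_mul]
      linear_combination (Complex.I * lam * osc (lam * phase 1 ξ (p + ρ • ω))) * h'
    have e : ∀ ρ : ℝ, 0 < ρ → (ρ : ℂ) * G (ρ • ω)
        = (c (p + ρ • ω) * F (p + ρ • ω)) * dd ω E (p + ρ • ω) := fun ρ hρ => by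
      simp only [hG]
      linear_combination (-F (p + ρ • ω)) * hcE ρ hρ
    have ec : ∫ ρ in Set.Ioi (0 : ℝ), (ρ : ℂ) * G (ρ • ω)
        = ∫ ρ in Set.Ioi (0 : ℝ), (c (p + ρ • ω) * F (p + ρ • ω)) * dd ω E (p + ρ • ω) :=
      setIntegral_congr_fun measurableSet_Ioi fun ρ hρ => e ρ hρ
    rw [ec]
    have hb : ∀ (ρ : ℝ) (x : ℂ), ‖x‖ ≤ 4 * (4 * ‖z‖ * K) * D * (wt ξ (p + ρ • ω) ^ 4
        * ((wt ξ (p + ρ • ω) ^ (n + 13))⁻¹ * wt ξ (p + ρ • ω) ^ 2)) →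
        ‖x‖ ≤ (16 * K * (2 * 2 ^ n) * D * (bracket ξ ^ n)⁻¹) * (1 + ρ ^ 2)⁻¹ := fun ρ x hx => by
      have h1 := inv_wt_pow_le_radial n ξ ω hω2 ρ
      rw [← hp] at h1
      have h6 := pow_mul_inv_wt_le (n := n) (j := 6) (by norm_num) ξ (p + ρ • ω)
      have hwp := wt_pos ξ (p + ρ • ω)
      set W := wt ξ (p + ρ • ω)
      have hWi : 0 ≤ (W ^ (n + 3))⁻¹ := by positivity
      calc ‖x‖ ≤ 4 * (4 * ‖z‖ * K) * D * (W ^ 4 * ((W ^ (n + 13))⁻¹ * W ^ 2)) := hx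
        _ = 16 * K * D * ‖z‖ * ((W ^ (n + 13))⁻¹ * W ^ 6) := by ring
        _ ≤ 16 * K * D * 1 * (W ^ (n + 3))⁻¹ := by gcongr
        _ ≤ 16 * K * D * ((1 + |ρ|) * (W ^ (n + 3))⁻¹) := by
            rw [mul_one]
            refine mul_le_mul_of_nonneg_left ?_ (by positivity)
            nlinarith [abs_nonneg ρ]
        _ ≤ 16 * K * D * (2 * 2 ^ n * (bracket ξ ^ n)⁻¹ * (1 + ρ ^ 2)⁻¹) := by gcongr
        _ = _ := by ring
    refine (norm_integral_Ioi_mul_deriv_le (H := fun ρ => c (p + ρ • ω) * F (p + ρ • ω))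
      (H' := fun ρ => dd ω (fun η => c η * F η) (p + ρ • ω))
      (E := fun ρ => E (p + ρ • ω)) (E' := fun ρ => dd ω E (p + ρ • ω))
      (M := 16 * K * (2 * 2 ^ n) * D * (bracket ξ ^ n)⁻¹)
      (fun ρ => hasDerivAt_comp_ray bcF.differentiable p ω ρ)
      (fun ρ => hasDerivAt_comp_ray hEd p ω ρ) (fun ρ => (norm_osc _).le)
      (fun ρ => hb ρ _ (bcF.b0 _)) (fun ρ => hb ρ _ (bcF.b1 _))
      (bcF.contDiff_one.continuous.comp (by fun_prop)) ?_).trans (le_of_eq (by ring))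
    -- On the ray the integrand `H E'` coincides with `ρ G`, whose integrability is already known
    -- from `hGn`.
    have hi : IntegrableOn (fun ρ : ℝ => (ρ : ℂ) * G (ρ • ω)) (Set.Ioi 0) := by
      refine (integrable_inv_one_add_sq.const_mul
        (|lam| * D * (2 * 2 ^ n * (bracket ξ ^ n)⁻¹))).integrableOn.mono' ?_ ?_
      · exact ((Complex.continuous_ofReal).mul (hGc.comp (by fun_prop))).aestronglyMeasurable
      · filter_upwards [ae_restrict_mem measurableSet_Ioi] with ρ hρ
        exact hGn ρ φ hρ
    exact hi.congr_fun (fun ρ hρ => e ρ hρ) measurableSet_Ioi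
  linarith

end Estimates

/-! ### Amplitudes with prescribed decay -/

section Profiles

/-- `A` is a `C²` function which together with its first two derivatives is bounded by
`D ⟨η⟩⁻ᵏ`. -/
structure Prof (k : ℕ) (D : ℝ) (A : Plane → ℂ) : Prop where
  nonneg : 0 ≤ D
  bd : ∀ v, ‖v‖ ≤ 1 → Bd v (fun η => (bracket η ^ k)⁻¹) D A

namespace Prof

variable {k : ℕ} {D D' : ℝ} {A B : Plane → ℂ}

theorem smooth (hA : Prof k D A) : ContDiff ℝ 2 A := (hA.bd 0 (by simp)).smooth

theorem continuous (hA : Prof k D A) : Continuous A := hA.smooth.continuous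

theorem norm_le (hA : Prof k D A) (η : Plane) : ‖A η‖ ≤ D * (bracket η ^ k)⁻¹ :=
  (hA.bd 0 (by simp)).b0 η

theorem mono (hA : Prof k D A) {j : ℕ} (hj : j ≤ k) (hD : D ≤ D') : Prof j D' A := by
  refine ⟨hA.nonneg.trans hD, fun v hv => (hA.bd v hv).mono fun η => ?_⟩
  have hb := bracket_pos η
  refine mul_le_mul hD (inv_anti₀ (by positivity) (pow_le_pow_right₀ (one_le_bracket η) hj))
    (by positivity) (hA.nonneg.trans hD)

theorem add (hA : Prof k D A) (hB : Prof k D' B) : Prof k (D + D') fun η => A η + B η :=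
  ⟨add_nonneg hA.nonneg hB.nonneg, fun v hv => (hA.bd v hv).add (hB.bd v hv)⟩

theorem const_mul (hA : Prof k D A) (c : ℂ) : Prof k (4 * ‖c‖ * D) fun η => c * A η := by
  have := hA.nonneg
  exact ⟨by positivity, fun v hv => (hA.bd v hv).const_mul c⟩

theorem bracket_mul (hA : Prof (k + 1) D A) : Prof k (8 * D) fun η => (bracket η : ℂ) * A η := by
  have := hA.nonneg
  refine ⟨by positivity, fun v hv => ((Bd.bracket hv).mul (hA.bd v hv)).mono fun η => ?_⟩
  have hb := (bracket_pos η).ne'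
  refine le_of_eq ?_
  rw [pow_succ]
  field_simp
  ring

theorem coord_mul (hA : Prof (k + 1) D A) (j : Fin 2) :
    Prof k (4 * D) fun η => ((η j : ℝ) : ℂ) * A η := by
  have := hA.nonneg
  refine ⟨by positivity, fun v hv => ((Bd.coord j hv).mul (hA.bd v hv)).mono fun η => ?_⟩
  have hb := (bracket_pos η).ne'
  refine le_of_eq ?_
  rw [pow_succ]
  field_simp

/-- `Bd.inv` treats `⟨η⟩⁻¹` as a symbol of size `⟨η⟩²`. The resulting loss of two powers is crude
but affordable. -/
theorem inv_bracket_mul (hA : Prof (k + 2) D A) :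
    Prof k (48 * D) fun η => (((bracket η)⁻¹ : ℝ) : ℂ) * A η := by
  have := hA.nonneg
  refine ⟨by positivity, fun v hv => ?_⟩
  have h1 := ((Bd.bracket hv).inv (by norm_num) one_le_bracket fun η => by
    rw [Complex.norm_real]
    exact (one_le_bracket η).trans (Real.le_norm_self _)).mul (hA.bd v hv)
  refine (h1.congr fun η => by rw [Complex.ofReal_inv]).mono fun η => ?_
  have hb := (bracket_pos η).ne'
  refine le_of_eq ?_
  rw [pow_add]
  field_simp
  ring

theorem integrable (hA : Prof k D A) (hk : 3 ≤ k) : Integrable A :=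
  ((integrable_inv_bracket_pow hk).const_mul D).mono' hA.continuous.aestronglyMeasurable
    (Eventually.of_forall hA.norm_le)

end Prof

end Profiles

/-! ### The bilinear source and its explicit oscillator solution -/

section Bilinear

variable {ε ε' : ℝ} {A B : Plane → ℂ} {DA DB : ℝ}

/-- The phase `ε⟨η⟩ + ε'⟨ξ - η⟩`. -/
def biphase (ε ε' : ℝ) (ξ η : Plane) : ℝ := ε * bracket η + ε' * bracket (ξ - η)

/-- The Fourier transform of the product of two half waves, up to normalization. -/
def srcInt (ε ε' : ℝ) (A B : Plane → ℂ) (s : ℝ) (ξ : Plane) : ℂ :=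
  ∫ η, osc (s * biphase ε ε' ξ η) * (A η * B (ξ - η))

/-- The solution of the forced oscillator with source `srcInt`. -/
def solInt (ε ε' : ℝ) (A B : Plane → ℂ) (s : ℝ) (ξ : Plane) : ℂ :=
  ∫ η, osc (s * biphase ε ε' ξ η) * (A η * B (ξ - η) * (((resSymbol ε ε' ξ η)⁻¹ : ℝ) : ℂ))

/-- The time derivative of `solInt`. -/
def solInt₁ (ε ε' : ℝ) (A B : Plane → ℂ) (s : ℝ) (ξ : Plane) : ℂ :=
  ∫ η, osc (s * biphase ε ε' ξ η) * (Complex.I * biphase ε ε' ξ η *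
    (A η * B (ξ - η) * (((resSymbol ε ε' ξ η)⁻¹ : ℝ) : ℂ)))

theorem biphase_eq (hε : ε ^ 2 = 1) (ξ η : Plane) :
    biphase ε ε' ξ η = ε * phase (ε * ε') ξ η := by
  rw [biphase, phase]
  linear_combination (-ε' * bracket (ξ - η)) * hε

theorem abs_biphase_le (hε : ε ^ 2 = 1) (hε' : ε' ^ 2 = 1) (ξ η : Plane) :
    |biphase ε ε' ξ η| ≤ 2 * wt ξ η := by
  have h1 := one_le_bracket η
  have h2 := one_le_bracket (ξ - η)
  refine (abs_add_le _ _).trans ?_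
  rw [abs_mul, abs_mul, abs_eq_one_of_sq hε, abs_eq_one_of_sq hε', abs_of_pos (bracket_pos _),
    abs_of_pos (bracket_pos _), wt]
  nlinarith

theorem continuous_biphase : Continuous fun p : Plane × Plane => biphase ε ε' p.1 p.2 := by
  unfold biphase
  exact ((continuous_bracket.comp continuous_snd).const_mul ε).add
    ((continuous_bracket.comp (continuous_fst.sub continuous_snd)).const_mul ε')

theorem continuous_resSymbol_inv (hε : ε ^ 2 = 1) (hε' : ε' ^ 2 = 1) :
    Continuous fun p : Plane × Plane => (((resSymbol ε ε' p.1 p.2)⁻¹ : ℝ) : ℂ) := by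
  refine Complex.continuous_ofReal.comp (Continuous.inv₀ ?_ fun p h => ?_)
  · exact ((continuous_bracket.comp continuous_fst).pow 2).sub (continuous_biphase.pow 2)
  · have := one_le_abs_resSymbol hε hε' p.1 p.2
    rw [h, abs_zero] at this
    linarith

theorem hasDerivAt_integral_osc {θ : Plane → ℝ} {Ψ : Plane → ℂ} (hθ : Continuous θ)
    (hΨ : Continuous Ψ) (h0 : Integrable Ψ) (h1 : Integrable fun η => (θ η : ℂ) * Ψ η) (s : ℝ) :
    HasDerivAt (fun s : ℝ => ∫ η, osc (s * θ η) * Ψ η)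
      (∫ η, osc (s * θ η) * (Complex.I * θ η * Ψ η)) s := by
  have hc : ∀ s : ℝ, Continuous fun η => osc (s * θ η) := fun s =>
    continuous_osc.comp (continuous_const.mul hθ)
  refine (hasDerivAt_integral_of_dominated_loc_of_deriv_le (μ := (volume : Measure Plane))
    (F := fun s η => osc (s * θ η) * Ψ η)
    (F' := fun s η => osc (s * θ η) * (Complex.I * θ η * Ψ η)) (x₀ := s) (s := Set.univ)
    (bound := fun η => ‖(θ η : ℂ) * Ψ η‖) Filter.univ_mem ?_ ?_ ?_ ?_ h1.norm ?_).2
  · exact Eventually.of_forall fun s => ((hc s).mul hΨ).aestronglyMeasurable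
  · exact h0.bdd_mul (c := 1) (hc s).aestronglyMeasurable
      (Eventually.of_forall fun η => (norm_osc _).le)
  · refine ((hc s).mul (Continuous.mul ?_ hΨ)).aestronglyMeasurable
    exact continuous_const.mul (Complex.continuous_ofReal.comp hθ)
  · refine Eventually.of_forall fun η r _ => le_of_eq ?_
    rw [norm_mul, norm_osc, one_mul, mul_assoc, norm_mul, Complex.norm_I, one_mul]
  · refine Eventually.of_forall fun η r _ => ?_
    have h := ((hasDerivAt_osc (r * θ η)).scomp r ((hasDerivAt_id r).mul_const (θ η))).mul_const
      (Ψ η)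
    refine h.congr_deriv ?_
    simp
    ring

theorem norm_profile_mul_le {k : ℕ} (hA : Prof k DA A) (hB : Prof k DB B) (ξ η : Plane) :
    ‖A η * B (ξ - η)‖ ≤ DA * DB * (wt ξ η ^ k)⁻¹ := by
  rw [norm_mul]
  refine (mul_le_mul (hA.norm_le η) (hB.norm_le (ξ - η)) (norm_nonneg _)
    ((norm_nonneg _).trans (hA.norm_le η))).trans (le_of_eq ?_)
  rw [wt, mul_pow, mul_inv]
  ring

theorem norm_resSymbol_inv_le (hε : ε ^ 2 = 1) (hε' : ε' ^ 2 = 1) (ξ η : Plane) :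
    ‖(((resSymbol ε ε' ξ η)⁻¹ : ℝ) : ℂ)‖ ≤ 1 := by
  rw [Complex.norm_real, norm_inv]
  exact inv_le_one_of_one_le₀ (one_le_abs_resSymbol hε hε' ξ η)

theorem exists_bd_product (n : ℕ) : ∃ K, 0 ≤ K ∧ ∀ {ε ε' : ℝ} {A B : Plane → ℂ} {DA DB : ℝ}
    {ξ v : Plane}, ε ^ 2 = 1 → ε' ^ 2 = 1 → Prof n DA A → Prof n DB B → ‖v‖ ≤ 1 →
    Bd v (fun η => (wt ξ η ^ n)⁻¹ * wt ξ η ^ 2) (K * (DA * DB))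
      fun η => A η * B (ξ - η) * (((resSymbol ε ε' ξ η)⁻¹ : ℝ) : ℂ) := by
  obtain ⟨K, hK, hμ⟩ := exists_bd_resSymbol_inv
  refine ⟨16 * K, by positivity, ?_⟩
  intro ε ε' A B DA DB ξ v hε hε' hA hB hv
  refine (((hA.bd v hv).mul ((hB.bd v hv).comp_const_sub ξ)).mul (hμ hε hε' hv)).mono fun η => ?_
  have e : (wt ξ η ^ n)⁻¹ = (bracket η ^ n)⁻¹ * (bracket (ξ - η) ^ n)⁻¹ := by
    rw [wt, mul_pow, mul_inv]
  rw [e]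
  exact le_of_eq (by ring)

/-- The exponent is `17 = 4 + 13`: the oscillatory estimates with `n = m + 4` need `n + 13` powers,
and `⟨ξ⟩^{-(m+4)}` leaves `⟨ξ⟩⁻²` after multiplication by the Sobolev weight. The sign of `ε ε'`
decides which of the two estimates applies. -/
theorem exists_solInt_bound (m : ℕ) : ∃ K, 0 ≤ K ∧ ∀ {ε ε' : ℝ} {A B : Plane → ℂ} {DA DB : ℝ},
    ε ^ 2 = 1 → ε' ^ 2 = 1 → Prof (m + 17) DA A → Prof (m + 17) DB B → ∀ s ξ,
    bracket ξ ^ (m + 2) * ‖solInt ε ε' A B s ξ‖ ≤ K * (DA * DB) * decayWeight s ξ := by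
  obtain ⟨K, hK, hp⟩ := exists_bd_product (m + 17)
  obtain ⟨K₁, hK₁, h₁⟩ := exists_osc_plus_bound (m + 4)
  obtain ⟨K₂, hK₂, h₂⟩ := exists_osc_minus_bound (m + 4)
  refine ⟨(K₁ + K₂) * K, by positivity, ?_⟩
  intro ε ε' A B DA DB hε hε' hA hB s ξ
  have hD : 0 ≤ K * (DA * DB) := mul_nonneg hK (mul_nonneg hA.nonneg hB.nonneg)
  have hb := bracket_pos ξ
  have hs := bracket_pos s
  have hss := bracket_pos (bracket s • ξ)
  have hF : ∀ v, ‖v‖ ≤ 1 → Bd v (fun η => (wt ξ η ^ (m + 4 + 13))⁻¹ * wt ξ η ^ 2)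
      (K * (DA * DB)) fun η => A η * B (ξ - η) * (((resSymbol ε ε' ξ η)⁻¹ : ℝ) : ℂ) :=
    fun v hv => hp hε hε' hA hB hv
  have hpow : bracket ξ ^ (m + 2) * (bracket ξ ^ (m + 4))⁻¹ = (bracket ξ ^ 2)⁻¹ := by
    rw [show m + 4 = (m + 2) + 2 by ring, pow_add _ (m + 2) 2, mul_inv, ← mul_assoc,
      mul_inv_cancel₀ (by positivity), one_mul]
  have e : ∀ κ, ε * ε' = κ → solInt ε ε' A B s ξ = ∫ η, osc ((s * ε) * phase κ ξ η)
      * (A η * B (ξ - η) * (((resSymbol ε ε' ξ η)⁻¹ : ℝ) : ℂ)) := by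
    intro κ hκ
    refine integral_congr_ae (Eventually.of_forall fun η => ?_)
    simp only [biphase_eq hε, hκ, mul_assoc]
  rcases eq_one_or_of_sq (show (ε * ε') ^ 2 = 1 by rw [mul_pow, hε, hε', one_mul]) with hκ | hκ
  · have h := h₁ ξ (s * ε) _ _ hD hF
    rw [← e 1 hκ, abs_mul, abs_eq_one_of_sq hε, mul_one] at h
    have hbs : bracket s ≤ 1 + |s| := by
      refine abs_le_of_sq_le_sq' ?_ (by positivity) |>.2
      rw [bracket_sq, Real.norm_eq_abs]
      nlinarith [abs_nonneg s]
    have h' : ‖solInt ε ε' A B s ξ‖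
        ≤ K₁ * (K * (DA * DB)) * (bracket ξ ^ (m + 4))⁻¹ * (bracket s)⁻¹ := by
      rw [← div_eq_mul_inv, le_div_iff₀ hs]
      exact (mul_le_mul_of_nonneg_left hbs (norm_nonneg _)).trans h
    calc bracket ξ ^ (m + 2) * ‖solInt ε ε' A B s ξ‖
        ≤ bracket ξ ^ (m + 2) *
          (K₁ * (K * (DA * DB)) * (bracket ξ ^ (m + 4))⁻¹ * (bracket s)⁻¹) := by gcongr
      _ = K₁ * (K * (DA * DB)) * ((bracket s)⁻¹ *
          (bracket ξ ^ (m + 2) * (bracket ξ ^ (m + 4))⁻¹)) := by ring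
      _ = K₁ * (K * (DA * DB)) * ((bracket s)⁻¹ * (bracket ξ ^ 2)⁻¹) := by rw [hpow]
      _ ≤ (K₁ + K₂) * (K * (DA * DB)) * decayWeight s ξ := by
        refine mul_le_mul (mul_le_mul_of_nonneg_right (by linarith) hD) ?_ (by positivity)
          (by positivity)
        rw [decayWeight]
        have : 0 ≤ (bracket (bracket s • ξ) ^ 2)⁻¹ := by positivity
        linarith
      _ = _ := by ring
  · have h := h₂ ξ (s * ε) _ _ hD hF
    rw [← e (-1) hκ, mul_pow, hε, mul_one] at h
    have hq : 0 < 1 + s ^ 2 * ‖ξ‖ ^ 2 := by positivity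
    have h' : ‖solInt ε ε' A B s ξ‖
        ≤ K₂ * (K * (DA * DB)) * (bracket ξ ^ (m + 4))⁻¹ * (1 + s ^ 2 * ‖ξ‖ ^ 2)⁻¹ := by
      rw [← div_eq_mul_inv, le_div_iff₀ hq]
      exact h
    -- Since `(1 + |ξ|²)(1 + s²|ξ|²) ≥ 1 + (1 + s²)|ξ|²`, the two spare powers of `⟨ξ⟩` replace `s`
    -- by `⟨s⟩`.
    have hw : (bracket ξ ^ 2)⁻¹ * (1 + s ^ 2 * ‖ξ‖ ^ 2)⁻¹ ≤ (bracket (bracket s • ξ) ^ 2)⁻¹ := by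
      rw [← mul_inv]
      refine inv_anti₀ (by positivity) ?_
      rw [bracket_sq, bracket_sq, norm_smul, mul_pow, Real.norm_eq_abs, sq_abs, bracket_sq,
        Real.norm_eq_abs, sq_abs]
      nlinarith [mul_nonneg (sq_nonneg s) (mul_nonneg (sq_nonneg ‖ξ‖) (sq_nonneg ‖ξ‖))]
    calc bracket ξ ^ (m + 2) * ‖solInt ε ε' A B s ξ‖
        ≤ bracket ξ ^ (m + 2) *
          (K₂ * (K * (DA * DB)) * (bracket ξ ^ (m + 4))⁻¹ * (1 + s ^ 2 * ‖ξ‖ ^ 2)⁻¹) := by gcongr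
      _ = K₂ * (K * (DA * DB)) * ((bracket ξ ^ (m + 2) * (bracket ξ ^ (m + 4))⁻¹) *
          (1 + s ^ 2 * ‖ξ‖ ^ 2)⁻¹) := by ring
      _ = K₂ * (K * (DA * DB)) * ((bracket ξ ^ 2)⁻¹ * (1 + s ^ 2 * ‖ξ‖ ^ 2)⁻¹) := by rw [hpow]
      _ ≤ (K₁ + K₂) * (K * (DA * DB)) * decayWeight s ξ := by
        refine mul_le_mul (mul_le_mul_of_nonneg_right (by linarith) hD) ?_ (by positivity)
          (by positivity)
        rw [decayWeight]
        have : 0 ≤ (bracket s)⁻¹ * (bracket ξ ^ 2)⁻¹ := by positivity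
        linarith
      _ = _ := by ring

section Derivatives

variable {k : ℕ}

theorem continuous_profile_mul (hA : Prof k DA A) (hB : Prof k DB B) :
    Continuous fun p : Plane × Plane => A p.2 * B (p.1 - p.2) :=
  (hA.continuous.comp continuous_snd).mul (hB.continuous.comp (continuous_fst.sub continuous_snd))

theorem continuous_profile_mul_inv (hε : ε ^ 2 = 1) (hε' : ε' ^ 2 = 1) (hA : Prof k DA A)
    (hB : Prof k DB B) : Continuous fun p : Plane × Plane =>
    A p.2 * B (p.1 - p.2) * (((resSymbol ε ε' p.1 p.2)⁻¹ : ℝ) : ℂ) :=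
  (continuous_profile_mul hA hB).mul (continuous_resSymbol_inv hε hε')

theorem stronglyMeasurable_integral_of_continuous {f : Plane × Plane → ℂ} (hf : Continuous f) :
    StronglyMeasurable fun ξ => ∫ η, f (ξ, η) :=
  hf.stronglyMeasurable.integral_prod_right'

theorem norm_profile_mul_inv_le (hε : ε ^ 2 = 1) (hε' : ε' ^ 2 = 1) (hA : Prof k DA A)
    (hB : Prof k DB B) (ξ η : Plane) :
    ‖A η * B (ξ - η) * (((resSymbol ε ε' ξ η)⁻¹ : ℝ) : ℂ)‖ ≤ DA * DB * (wt ξ η ^ k)⁻¹ := by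
  rw [norm_mul]
  exact (mul_le_of_le_one_right (norm_nonneg _) (norm_resSymbol_inv_le hε hε' ξ η)).trans
    (norm_profile_mul_le hA hB ξ η)

theorem biphase_mul_le (hε : ε ^ 2 = 1) (hε' : ε' ^ 2 = 1) {D : ℝ} {z : ℂ} {ξ η : Plane}
    (h : ‖z‖ ≤ D * (wt ξ η ^ (k + 1))⁻¹) :
    ‖(biphase ε ε' ξ η : ℂ) * z‖ ≤ 2 * D * (wt ξ η ^ k)⁻¹ := by
  have hw := wt_pos ξ η
  rw [norm_mul, Complex.norm_real]
  refine (mul_le_mul (abs_biphase_le hε hε' ξ η) h (norm_nonneg _) (by positivity)).trans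
    (le_of_eq ?_)
  rw [pow_succ]
  field_simp

theorem continuous_slice {f : Plane × Plane → ℂ} (hf : Continuous f) (ξ : Plane) :
    Continuous fun η => f (ξ, η) := hf.comp (Continuous.prodMk_right ξ)

theorem continuous_biphase_slice (ξ : Plane) : Continuous (biphase ε ε' ξ) := by
  have h : Continuous fun η : Plane => ε * bracket η + ε' * bracket (ξ - η) :=
    (continuous_bracket.const_mul ε).add
      ((continuous_bracket.comp (continuous_const.sub continuous_id)).const_mul ε')
  exact h

end Derivatives

theorem hasDerivAt_srcInt (hε : ε ^ 2 = 1) (hε' : ε' ^ 2 = 1) {k : ℕ}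
    (hA : Prof (k + 4) DA A) (hB : Prof (k + 4) DB B) (s : ℝ) (ξ : Plane) :
    HasDerivAt (fun s => srcInt ε ε' A B s ξ) (∫ η, osc (s * biphase ε ε' ξ η) *
      (Complex.I * biphase ε ε' ξ η * (A η * B (ξ - η)))) s := by
  have hc := continuous_slice (continuous_profile_mul hA hB) ξ
  have hθ : Continuous fun η => (biphase ε ε' ξ η : ℂ) :=
    Complex.continuous_ofReal.comp (continuous_biphase_slice ξ)
  refine hasDerivAt_integral_osc (continuous_biphase_slice ξ) hc ?_ ?_ s
  · exact integrable_of_le_inv_wt (n := k + 1) hc fun η => norm_profile_mul_le hA hB ξ η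
  · exact integrable_of_le_inv_wt (n := k) (hθ.mul hc)
      fun η => biphase_mul_le hε hε' (norm_profile_mul_le hA hB ξ η)

theorem hasDerivAt_solInt (hε : ε ^ 2 = 1) (hε' : ε' ^ 2 = 1) {k : ℕ}
    (hA : Prof (k + 4) DA A) (hB : Prof (k + 4) DB B) (s : ℝ) (ξ : Plane) :
    HasDerivAt (fun s => solInt ε ε' A B s ξ) (solInt₁ ε ε' A B s ξ) s := by
  have hc := continuous_slice (continuous_profile_mul_inv hε hε' hA hB) ξ
  have hθ : Continuous fun η => (biphase ε ε' ξ η : ℂ) :=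
    Complex.continuous_ofReal.comp (continuous_biphase_slice ξ)
  refine hasDerivAt_integral_osc (continuous_biphase_slice ξ) hc ?_ ?_ s
  · exact integrable_of_le_inv_wt (n := k + 1) hc fun η => norm_profile_mul_inv_le hε hε' hA hB ξ η
  · exact integrable_of_le_inv_wt (n := k) (hθ.mul hc)
      fun η => biphase_mul_le hε hε' (norm_profile_mul_inv_le hε hε' hA hB ξ η)

/-- Two time derivatives bring down `-φ²`, where `φ` is `biphase`; adding `⟨ξ⟩²` restores the
resonance function and cancels its inverse. Each derivative costs one power of the weight, hence the
larger exponent. -/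
theorem hasDerivAt_solInt₁ (hε : ε ^ 2 = 1) (hε' : ε' ^ 2 = 1) {k : ℕ}
    (hA : Prof (k + 5) DA A) (hB : Prof (k + 5) DB B) (s : ℝ) (ξ : Plane) :
    HasDerivAt (fun s => solInt₁ ε ε' A B s ξ)
      (srcInt ε ε' A B s ξ - ((bracket ξ ^ 2 : ℝ) : ℂ) • solInt ε ε' A B s ξ) s := by
  have hc := continuous_slice (continuous_profile_mul_inv hε hε' hA hB) ξ
  have hc0 := continuous_slice (continuous_profile_mul hA hB) ξ
  have hθ : Continuous fun η => (biphase ε ε' ξ η : ℂ) :=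
    Complex.continuous_ofReal.comp (continuous_biphase_slice ξ)
  have hcI : Continuous fun η => Complex.I * biphase ε ε' ξ η *
      (A η * B (ξ - η) * (((resSymbol ε ε' ξ η)⁻¹ : ℝ) : ℂ)) :=
    (continuous_const.mul hθ).mul hc
  have b1 : ∀ η, ‖Complex.I * biphase ε ε' ξ η *
      (A η * B (ξ - η) * (((resSymbol ε ε' ξ η)⁻¹ : ℝ) : ℂ))‖
        ≤ 2 * (DA * DB) * (wt ξ η ^ (k + 4))⁻¹ := fun η => by
    rw [mul_assoc, norm_mul, Complex.norm_I, one_mul]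
    exact biphase_mul_le hε hε' (norm_profile_mul_inv_le hε hε' hA hB ξ η)
  have key := hasDerivAt_integral_osc (continuous_biphase_slice ξ) hcI
    (integrable_of_le_inv_wt (n := k + 1) hcI b1)
    (integrable_of_le_inv_wt (n := k) (hθ.mul hcI) fun η => biphase_mul_le hε hε' (b1 η)) s
  refine key.congr_deriv ?_
  have i0 : Integrable fun η => osc (s * biphase ε ε' ξ η) * (A η * B (ξ - η)) := by
    refine (integrable_of_le_inv_wt (n := k + 2) hc0
      fun η => norm_profile_mul_le hA hB ξ η).bdd_mul (c := 1) ?_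
      (Eventually.of_forall fun η => (norm_osc _).le)
    exact (continuous_osc.comp
      (continuous_const.mul (continuous_biphase_slice ξ))).aestronglyMeasurable
  have i1 : Integrable fun η => osc (s * biphase ε ε' ξ η) *
      (A η * B (ξ - η) * (((resSymbol ε ε' ξ η)⁻¹ : ℝ) : ℂ)) := by
    refine (integrable_of_le_inv_wt (n := k + 2) hc
      fun η => norm_profile_mul_inv_le hε hε' hA hB ξ η).bdd_mul (c := 1) ?_
      (Eventually.of_forall fun η => (norm_osc _).le)
    exact (continuous_osc.comp
      (continuous_const.mul (continuous_biphase_slice ξ))).aestronglyMeasurable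
  rw [srcInt, solInt, smul_eq_mul, ← integral_const_mul, ← integral_sub i0 (i1.const_mul _)]
  refine integral_congr_ae (Eventually.of_forall fun η => ?_)
  have hμ : ((resSymbol ε ε' ξ η : ℝ) : ℂ) * (((resSymbol ε ε' ξ η)⁻¹ : ℝ) : ℂ) = 1 := by
    rw [← Complex.ofReal_mul, mul_inv_cancel₀, Complex.ofReal_one]
    intro h
    have := one_le_abs_resSymbol hε hε' ξ η
    rw [h, abs_zero] at this
    linarith
  have hμ' : ((resSymbol ε ε' ξ η : ℝ) : ℂ)
      = ((bracket ξ ^ 2 : ℝ) : ℂ) - (biphase ε ε' ξ η : ℂ) ^ 2 := by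
    rw [resSymbol, biphase]
    push_cast
    ring
  rw [hμ'] at hμ
  simp only
  have hI := Complex.I_sq
  generalize (((resSymbol ε ε' ξ η)⁻¹ : ℝ) : ℂ) = μ at hμ ⊢
  linear_combination (osc (s * biphase ε ε' ξ η) * (biphase ε ε' ξ η : ℂ) ^ 2 * A η * B (ξ - η) * μ) * hI
    + (osc (s * biphase ε ε' ξ η) * A η * B (ξ - η)) * hμ

/-- The factor `i(ε⟨η⟩ + ε'⟨ξ-η⟩)` is distributed over the two amplitudes, so the estimate for
`solInt` also covers its time derivative at the price of one power of decay. -/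
theorem solInt₁_eq (hε : ε ^ 2 = 1) (hε' : ε' ^ 2 = 1) {k : ℕ}
    (hA : Prof (k + 4) DA A) (hB : Prof (k + 4) DB B) (s : ℝ) (ξ : Plane) :
    solInt₁ ε ε' A B s ξ
      = solInt ε ε' (fun η => (Complex.I * ε) * ((bracket η : ℂ) * A η)) B s ξ
        + solInt ε ε' A (fun η => (Complex.I * ε') * ((bracket η : ℂ) * B η)) s ξ := by
  have hA' := (hA.bracket_mul).const_mul (Complex.I * ε)
  have hB' := (hB.bracket_mul).const_mul (Complex.I * ε')
  have hA3 := hA.mono (j := k + 3) (by omega) le_rfl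
  have hB3 := hB.mono (j := k + 3) (by omega) le_rfl
  have hosc : AEStronglyMeasurable (fun η => osc (s * biphase ε ε' ξ η)) := (continuous_osc.comp
      (continuous_const.mul (continuous_biphase_slice ξ))).aestronglyMeasurable
  have hosc1 : ∀ᵐ η, ‖osc (s * biphase ε ε' ξ η)‖ ≤ 1 :=
    Eventually.of_forall fun η => (norm_osc _).le
  have i1 := (integrable_of_le_inv_wt (n := k)
    (continuous_slice (continuous_profile_mul_inv hε hε' hA' hB3) ξ)
    fun η => norm_profile_mul_inv_le hε hε' hA' hB3 ξ η).bdd_mul hosc hosc1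
  have i2 := (integrable_of_le_inv_wt (n := k)
    (continuous_slice (continuous_profile_mul_inv hε hε' hA3 hB') ξ)
    fun η => norm_profile_mul_inv_le hε hε' hA3 hB' ξ η).bdd_mul hosc hosc1
  rw [solInt, solInt, ← integral_add i1 i2, solInt₁]
  refine integral_congr_ae (Eventually.of_forall fun η => ?_)
  simp only [biphase]
  push_cast
  ring

theorem exists_srcInt_bound {k : ℕ} (hA : Prof (k + 5) DA A) (hB : Prof (k + 5) DB B) :
    ∃ K, ∀ s ξ, ‖srcInt ε ε' A B s ξ‖ ≤ K * (bracket ξ ^ 2)⁻¹ := by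
  refine ⟨2 ^ 2 * cubeMass * (DA * DB), fun s ξ => ?_⟩
  refine norm_integral_le_of_le_inv_wt (mul_nonneg hA.nonneg hB.nonneg) fun η => ?_
  rw [norm_mul, norm_osc, one_mul]
  exact norm_profile_mul_le (hA.mono (j := 5) (by omega) le_rfl)
    (hB.mono (j := 5) (by omega) le_rfl) ξ η

theorem exists_srcInt_lip (hε : ε ^ 2 = 1) (hε' : ε' ^ 2 = 1) {k : ℕ}
    (hA : Prof (k + 6) DA A) (hB : Prof (k + 6) DB B) :
    ∃ K, ∀ s r ξ, ‖srcInt ε ε' A B s ξ - srcInt ε ε' A B r ξ‖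
      ≤ |s - r| * (K * (bracket ξ ^ 2)⁻¹) := by
  have hA6 := hA.mono (j := 6) (by omega) le_rfl
  have hB6 := hB.mono (j := 6) (by omega) le_rfl
  refine ⟨2 ^ 2 * cubeMass * (2 * (DA * DB)), fun s r ξ => ?_⟩
  have h := Convex.norm_image_sub_le_of_norm_hasDerivWithin_le
    (f := fun s => srcInt ε ε' A B s ξ) (s := Set.univ) (x := r) (y := s)
    (C := 2 ^ 2 * cubeMass * (2 * (DA * DB)) * (bracket ξ ^ 2)⁻¹)
    (fun y _ => (hasDerivAt_srcInt hε hε' (k := 2) hA6 hB6 y ξ).hasDerivWithinAt) (fun y _ => ?_)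
    convex_univ trivial trivial
  · rw [Real.norm_eq_abs] at h
    exact h.trans (le_of_eq (mul_comm _ _))
  · refine norm_integral_le_of_le_inv_wt (by
      have := mul_nonneg hA.nonneg hB.nonneg
      positivity) fun η => ?_
    rw [norm_mul, norm_osc, one_mul, mul_assoc, norm_mul, Complex.norm_I, one_mul]
    exact biphase_mul_le hε hε' (norm_profile_mul_le hA6 hB6 ξ η)

end Bilinear

/-! ### Products of half waves have decaying solutions -/

section BilinearSolution

variable {F : Type*} [NormedAddCommGroup F] [InnerProductSpace ℂ F] [CompleteSpace F]

/-- The bilinear interaction of two half waves, followed by a bounded multiplier, has a decaying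
solution. -/
theorem exists_isDecayingSolution (m : ℕ) : ∃ K, 0 ≤ K ∧ ∀ {ε ε' : ℝ} {A B : Plane → ℂ}
    {DA DB : ℝ} {q : Plane → F}, ε ^ 2 = 1 → ε' ^ 2 = 1 → Prof (m + 18) DA A →
    Prof (m + 18) DB B → StronglyMeasurable q → (∀ ξ, ‖q ξ‖ ≤ 1) →
    ∃ Q Q₁, IsDecayingSolution m (K * (DA * DB)) (fun s ξ => srcInt ε ε' A B s ξ • q ξ) Q Q₁ := by
  obtain ⟨K, hK, hb⟩ := exists_solInt_bound m
  -- `Q₁` has two terms by `solInt₁_eq`, each with one amplitude enlarged by `4 · 8 = 32`.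
  refine ⟨64 * K, by positivity, ?_⟩
  intro ε ε' A B DA DB q hε hε' hA hB hq hq1
  have hD : 0 ≤ DA * DB := mul_nonneg hA.nonneg hB.nonneg
  have hA17 := hA.mono (j := m + 17) (by omega) le_rfl
  have hB17 := hB.mono (j := m + 17) (by omega) le_rfl
  have hA' := (hA.bracket_mul).const_mul (Complex.I * ε)
  have hB' := (hB.bracket_mul).const_mul (Complex.I * ε')
  have n1 : ∀ {x : ℝ}, x ^ 2 = 1 → ‖Complex.I * (x : ℂ)‖ = 1 := fun {x} hx => by
    rw [norm_mul, Complex.norm_I, Complex.norm_real, one_mul, Real.norm_eq_abs,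
      abs_eq_one_of_sq hx]
  rw [n1 hε] at hA'
  rw [n1 hε'] at hB'
  have hsm : ∀ (z : ℂ) ξ, ‖z • q ξ‖ ≤ ‖z‖ := fun z ξ => by
    rw [norm_smul]
    exact mul_le_of_le_one_right (norm_nonneg _) (hq1 ξ)
  have hosc : ∀ s : ℝ, Continuous fun p : Plane × Plane => osc (s * biphase ε ε' p.1 p.2) :=
    fun s => continuous_osc.comp (continuous_const.mul continuous_biphase)
  have hw : ∀ s ξ, 0 ≤ K * (DA * DB) * decayWeight s ξ := fun s ξ =>
    mul_nonneg (mul_nonneg hK hD) (decayWeight_nonneg s ξ)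
  refine ⟨fun s ξ => solInt ε ε' A B s ξ • q ξ, fun s ξ => solInt₁ ε ε' A B s ξ • q ξ, ?_⟩
  constructor
  · positivity
  · intro s
    refine StronglyMeasurable.smul ?_ hq
    exact stronglyMeasurable_integral_of_continuous
      ((hosc s).mul (continuous_profile_mul hA hB))
  · intro s
    refine StronglyMeasurable.smul ?_ hq
    exact stronglyMeasurable_integral_of_continuous
      ((hosc s).mul (continuous_profile_mul_inv hε hε' hA hB))
  · intro s
    refine StronglyMeasurable.smul ?_ hq
    have hI : Continuous fun p : Plane × Plane => Complex.I * (biphase ε ε' p.1 p.2 : ℂ) :=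
      continuous_const.mul (Complex.continuous_ofReal.comp continuous_biphase)
    exact stronglyMeasurable_integral_of_continuous
      ((hosc s).mul (hI.mul (continuous_profile_mul_inv hε hε' hA hB)))
  · intro s ξ
    exact (hasDerivAt_solInt hε hε' (k := m + 14) hA hB s ξ).smul_const (q ξ)
  · intro s ξ
    have h := (hasDerivAt_solInt₁ hε hε' (k := m + 13) hA hB s ξ).smul_const (q ξ)
    refine h.congr_deriv ?_
    rw [sub_smul, smul_assoc]
  · intro s ξ
    refine (mul_le_mul_of_nonneg_left (hsm _ ξ) (pow_nonneg (bracket_pos ξ).le _)).trans ?_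
    refine (hb hε hε' hA17 hB17 s ξ).trans ?_
    linarith [hw s ξ]
  · intro s ξ
    refine (mul_le_mul_of_nonneg_left (hsm _ ξ) (pow_nonneg (bracket_pos ξ).le _)).trans ?_
    rw [solInt₁_eq hε hε' (k := m + 14) hA hB]
    refine (mul_le_mul_of_nonneg_left (norm_add_le _ _) (pow_nonneg (bracket_pos ξ).le _)).trans ?_
    rw [mul_add]
    refine (add_le_add (hb hε hε' hA' hB17 s ξ) (hb hε hε' hA17 hB' s ξ)).trans (le_of_eq ?_)
    ring
  · obtain ⟨L, hL⟩ := exists_srcInt_bound (ε := ε) (ε' := ε') (k := m + 13) hA hB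
    exact ⟨L, fun s ξ => (hsm _ ξ).trans (hL s ξ)⟩
  · obtain ⟨L, hL⟩ := exists_srcInt_lip hε hε' (k := m + 12) hA hB
    refine ⟨L, fun s r ξ => ?_⟩
    rw [← sub_smul]
    exact (hsm _ ξ).trans (hL s r ξ)

end BilinearSolution

/-! ### Closure of the admissible sources under linear operations and multipliers -/

section Closure

theorem toL2_neg {F : Type*} [NormedAddCommGroup F] {a : Plane → F}
    (ha : MemLp a 2 (volume : Measure Plane)) : toL2 (fun x => -a x) = -toL2 a := by
  rw [toL2, dif_pos (show MemLp (fun x => -a x) 2 volume from ha.neg), toL2, dif_pos ha]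
  exact MemLp.toLp_neg ha

variable {F : Type*} [NormedAddCommGroup F] [InnerProductSpace ℂ F] [CompleteSpace F]
variable {m : ℕ} {D D' : ℝ} {g Q Q₁ g' Q' Q₁' : ℝ → Plane → F}

namespace IsDecayingSolution

theorem add (h : IsDecayingSolution m D g Q Q₁) (h' : IsDecayingSolution m D' g' Q' Q₁') :
    IsDecayingSolution m (D + D') (fun s ξ => g s ξ + g' s ξ) (fun s ξ => Q s ξ + Q' s ξ)
      (fun s ξ => Q₁ s ξ + Q₁' s ξ) where
  nonneg := add_nonneg h.nonneg h'.nonneg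
  meas s := (h.meas s).add (h'.meas s)
  measQ s := (h.measQ s).add (h'.measQ s)
  measQ₁ s := (h.measQ₁ s).add (h'.measQ₁ s)
  deriv s ξ := (h.deriv s ξ).add (h'.deriv s ξ)
  deriv₁ s ξ := ((h.deriv₁ s ξ).add (h'.deriv₁ s ξ)).congr_deriv (by rw [smul_add]; abel)
  bound s ξ := by
    have hb := bracket_pos ξ
    refine (mul_le_mul_of_nonneg_left (norm_add_le _ _) (by positivity)).trans ?_
    rw [mul_add, add_mul]
    exact add_le_add (h.bound s ξ) (h'.bound s ξ)
  bound₁ s ξ := by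
    have hb := bracket_pos ξ
    refine (mul_le_mul_of_nonneg_left (norm_add_le _ _) (by positivity)).trans ?_
    rw [mul_add, add_mul]
    exact add_le_add (h.bound₁ s ξ) (h'.bound₁ s ξ)
  source := by
    obtain ⟨B, hB⟩ := h.source
    obtain ⟨B', hB'⟩ := h'.source
    refine ⟨B + B', fun s ξ => (norm_add_le _ _).trans ?_⟩
    rw [add_mul]
    exact add_le_add (hB s ξ) (hB' s ξ)
  source_lip := by
    obtain ⟨B, hB⟩ := h.source_lip
    obtain ⟨B', hB'⟩ := h'.source_lip
    refine ⟨B + B', fun s r ξ => ?_⟩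
    rw [add_sub_add_comm, add_mul, mul_add]
    exact (norm_add_le _ _).trans (add_le_add (hB s r ξ) (hB' s r ξ))

/-- An operator acting at each frequency and independent of time commutes with the oscillator
equation. Only a bound and measurability in `ξ` matter, so symbols that are discontinuous at the
origin are allowed. -/
theorem map {F' : Type*} [NormedAddCommGroup F'] [InnerProductSpace ℂ F'] [CompleteSpace F']
    (h : IsDecayingSolution m D g Q Q₁) (M : Plane → F →L[ℂ] F') (hM : StronglyMeasurable M)
    (hM1 : ∀ ξ, ‖M ξ‖ ≤ 1) :
    IsDecayingSolution m D (fun s ξ => M ξ (g s ξ)) (fun s ξ => M ξ (Q s ξ))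
      (fun s ξ => M ξ (Q₁ s ξ)) := by
  have hle : ∀ ξ v, ‖M ξ v‖ ≤ ‖v‖ := fun ξ v =>
    ((M ξ).le_opNorm v).trans (mul_le_of_le_one_left (norm_nonneg _) (hM1 ξ))
  have hmeas : ∀ {a : Plane → F}, StronglyMeasurable a → StronglyMeasurable fun ξ => M ξ (a ξ) :=
    fun {a} ha => (isBoundedBilinearMap_apply (𝕜 := ℂ)).continuous.comp_stronglyMeasurable
      (hM.prodMk ha)
  have hder : ∀ ξ {f : ℝ → F} {f' : F} {s : ℝ}, HasDerivAt f f' s →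
      HasDerivAt (fun s => M ξ (f s)) (M ξ f') s := fun ξ {f f' s} hf =>
    ((M ξ).restrictScalars ℝ).hasFDerivAt.comp_hasDerivAt s hf
  constructor
  · exact h.nonneg
  · exact fun s => hmeas (h.meas s)
  · exact fun s => hmeas (h.measQ s)
  · exact fun s => hmeas (h.measQ₁ s)
  · exact fun s ξ => hder ξ (h.deriv s ξ)
  · exact fun s ξ => (hder ξ (h.deriv₁ s ξ)).congr_deriv (by rw [map_sub, map_smul])
  · exact fun s ξ => (mul_le_mul_of_nonneg_left (hle _ _)
      (pow_nonneg (bracket_pos ξ).le _)).trans (h.bound s ξ)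
  · exact fun s ξ => (mul_le_mul_of_nonneg_left (hle _ _)
      (pow_nonneg (bracket_pos ξ).le _)).trans (h.bound₁ s ξ)
  · obtain ⟨B, hB⟩ := h.source
    exact ⟨B, fun s ξ => (hle _ _).trans (hB s ξ)⟩
  · obtain ⟨B, hB⟩ := h.source_lip
    refine ⟨B, fun s r ξ => ?_⟩
    rw [← map_sub]
    exact (hle _ _).trans (hB s r ξ)

theorem neg (h : IsDecayingSolution m D g Q Q₁) :
    IsDecayingSolution m D (fun s ξ => -g s ξ) (fun s ξ => -Q s ξ) (fun s ξ => -Q₁ s ξ) := by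
  have := h.map (fun _ => -ContinuousLinearMap.id ℂ F) stronglyMeasurable_const fun ξ => by
    rw [norm_neg]
    exact ContinuousLinearMap.norm_id_le
  simpa using this

theorem mono (h : IsDecayingSolution m D g Q Q₁) (hD : D ≤ D') :
    IsDecayingSolution m D' g Q Q₁ :=
  { h with
    nonneg := h.nonneg.trans hD
    bound := fun s ξ => (h.bound s ξ).trans
      (mul_le_mul_of_nonneg_right hD (decayWeight_nonneg s ξ))
    bound₁ := fun s ξ => (h.bound₁ s ξ).trans
      (mul_le_mul_of_nonneg_right hD (decayWeight_nonneg s ξ)) }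

end IsDecayingSolution

/-- The `L²`-valued source `G` has a decaying solution on the Fourier side. -/
def HasSol (m : ℕ) (D : ℝ) (G : ℝ → Lp F 2 (volume : Measure Plane)) : Prop :=
  ∃ g Q Q₁ : ℝ → Plane → F, IsDecayingSolution m D g Q Q₁ ∧
    ∀ s, G s = 𝓕⁻ (toL2 (dil (g s)))

variable {G G' : ℝ → Lp F 2 (volume : Measure Plane)}

namespace HasSol

theorem add (h : HasSol m D G) (h' : HasSol m D' G') : HasSol m (D + D') fun s => G s + G' s := by
  obtain ⟨g, Q, Q₁, hs, hG⟩ := h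
  obtain ⟨g', Q', Q₁', hs', hG'⟩ := h'
  refine ⟨_, _, _, hs.add hs', fun s => ?_⟩
  have e := toL2_add (hs.memLp_source s) (hs'.memLp_source s)
  change G s + G' s = _
  rw [hG, hG', ← FourierTransform.fourierInv_add, ← e]
  rfl

theorem neg (h : HasSol m D G) : HasSol m D fun s => -G s := by
  obtain ⟨g, Q, Q₁, hs, hG⟩ := h
  refine ⟨_, _, _, hs.neg, fun s => ?_⟩
  change -G s = fourierInvCLM F (toL2 (fun x => -dil (g s) x))
  rw [toL2_neg (hs.memLp_source s), map_neg, hG]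
  rfl

theorem sub (h : HasSol m D G) (h' : HasSol m D' G') : HasSol m (D + D') fun s => G s - G' s := by
  simpa only [sub_eq_add_neg] using h.add h'.neg

theorem mono (h : HasSol m D G) (hD : D ≤ D') : HasSol m D' G := by
  obtain ⟨g, Q, Q₁, hs, hG⟩ := h
  exact ⟨g, Q, Q₁, hs.mono hD, hG⟩

theorem multiplier (h : HasSol m D G) (M : Plane → F →L[ℂ] F) (hM : StronglyMeasurable M)
    (hM1 : ∀ ξ, ‖M ξ‖ ≤ 1) : HasSol m D fun s => l2Multiplier (fun ξ v => M ξ v) (G s) := by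
  obtain ⟨g, Q, Q₁, hs, hG⟩ := h
  refine ⟨_, _, _, hs.map M hM hM1, fun s => ?_⟩
  change l2Multiplier (fun ξ v => M ξ v) (G s) = _
  rw [hG, l2Multiplier_fourierInv _ (hs.memLp_source s)]

end HasSol

/-- The functions `p s` are square integrable and form a source with a decaying solution. -/
structure IsSrc (m : ℕ) (D : ℝ) (p : ℝ → Plane → F) : Prop where
  mem : ∀ s, MemLp (p s) 2 (volume : Measure Plane)
  sol : HasSol m D fun s => toL2 (p s)

variable {p p' : ℝ → Plane → F}

namespace IsSrc

theorem add (h : IsSrc m D p) (h' : IsSrc m D' p') : IsSrc m (D + D') fun s x => p s x + p' s x :=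
  ⟨fun s => (h.mem s).add (h'.mem s), by
    simpa only [fun s => toL2_add (h.mem s) (h'.mem s)] using h.sol.add h'.sol⟩

theorem sub (h : IsSrc m D p) (h' : IsSrc m D' p') : IsSrc m (D + D') fun s x => p s x - p' s x :=
  ⟨fun s => (h.mem s).sub (h'.mem s), by
    simpa only [fun s => toL2_sub (h.mem s) (h'.mem s)] using h.sol.sub h'.sol⟩

theorem congr (h : IsSrc m D p) (he : ∀ s x, p s x = p' s x) : IsSrc m D p' := by
  rwa [← show p = p' from funext fun s => funext fun x => he s x]

theorem mono (h : IsSrc m D p) (hD : D ≤ D') : IsSrc m D' p := ⟨h.mem, h.sol.mono hD⟩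

end IsSrc

end Closure

/-! ### Derivatives and products under the inverse Fourier transform -/

section InverseTransform

theorem differentiable_fourierInv {f : Plane → ℂ} (h0 : Integrable f)
    (h1 : Integrable fun v => ‖v‖ * ‖f v‖) : Differentiable ℝ (𝓕⁻ f) := by
  rw [Real.fourierInv_eq_fourier_comp_neg]
  refine Real.differentiable_fourier h0.comp_neg ?_
  simpa using h1.comp_neg

theorem fderiv_fourierInv {f : Plane → ℂ} (h0 : Integrable f)
    (h1 : Integrable fun v => ‖v‖ * ‖f v‖) (x v : Plane) :
    fderiv ℝ (𝓕⁻ f) x v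
      = 𝓕⁻ (fun y => (2 * Real.pi * Complex.I * (inner ℝ y v : ℝ)) * f y) x := by
  rw [Real.fourierInv_eq_fourier_comp_neg, Real.fourierInv_eq_fourier_comp_neg]
  have h1' : Integrable fun v => ‖v‖ * ‖f (-v)‖ := by simpa using h1.comp_neg
  rw [Real.fderiv_fourier h0.comp_neg h1', Real.fourier_continuousLinearMap_apply]
  · refine congrArg (fun f : Plane → ℂ => 𝓕 f x) (funext fun y => ?_)
    simp only [VectorFourier.fourierSMulRight_apply,
      innerSL_apply_apply ℝ, inner_neg_left, Complex.real_smul, smul_eq_mul, Complex.ofReal_neg]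
    ring
  · refine (h1'.const_mul (2 * Real.pi * ‖innerSL ℝ (E := Plane)‖)).mono' ?_
      (Eventually.of_forall fun y => ?_)
    · exact h0.comp_neg.aestronglyMeasurable.fourierSMulRight
    · refine (VectorFourier.norm_fourierSMulRight_le (innerSL ℝ) (fun x => f (-x)) y).trans
        (le_of_eq ?_)
      ring

theorem fourierInv_mul_fourierInv {a b : Plane → ℂ} (ha : Integrable a) (hb : Integrable b)
    (x : Plane) :
    𝓕⁻ a x * 𝓕⁻ b x = 𝓕⁻ (fun ζ => ∫ η, a η * b (ζ - η)) x := by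
  rw [Real.fourierInv_eq_fourier_neg, Real.fourierInv_eq_fourier_neg,
    Real.fourierInv_eq_fourier_neg, ← Real.fourier_mul_convolution_eq ha hb]
  rfl

theorem integrable_convolution_mul {a b : Plane → ℂ} (ha : Integrable a) (hb : Integrable b) :
    Integrable fun ζ => ∫ η, a η * b (ζ - η) :=
  ha.integrable_convolution (ContinuousLinearMap.mul ℝ ℂ) hb

/-- The Fourier normalization `(2π)⁻²`. -/
def fourierConst : ℝ := ((2 * Real.pi) ^ 2)⁻¹

theorem abs_fourierConst_le : |fourierConst| ≤ 1 := by
  have hp := Real.pi_gt_three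
  rw [fourierConst, abs_of_pos (by positivity)]
  exact inv_le_one_of_one_le₀ (by nlinarith)

theorem integral_dil_mul_dil (a b : Plane → ℂ) (ζ : Plane) :
    ∫ η, dil a η * dil b (ζ - η)
      = fourierConst * ∫ η, a η * b ((2 * Real.pi) • ζ - η) := by
  have h := Measure.integral_comp_smul (volume : Measure Plane)
    (fun η => a η * b ((2 * Real.pi) • ζ - η)) (2 * Real.pi)
  simp only [dil, smul_sub]
  rw [h, finrank_euclideanSpace_fin, abs_of_pos (by positivity), Complex.real_smul, fourierConst]

end InverseTransform

/-! ### Half waves: derivatives and products -/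

section HalfWave

variable {ε ε' : ℝ} {A B : Plane → ℂ} {D D' : ℝ} {k : ℕ}

/-- The amplitude `e^{iεt⟨ξ⟩} A(ξ)`. -/
def evolve (ε : ℝ) (A : Plane → ℂ) (t : ℝ) (ξ : Plane) : ℂ := osc (t * (ε * bracket ξ)) * A ξ

/-- The half wave `e^{iεt⟨∇⟩}` applied to the function with Fourier transform `A`. -/
def halfWave (ε : ℝ) (A : Plane → ℂ) (t : ℝ) : Plane → ℂ := 𝓕⁻ (dil (evolve ε A t))

theorem norm_evolve (t : ℝ) (ξ : Plane) : ‖evolve ε A t ξ‖ = ‖A ξ‖ := by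
  rw [evolve, norm_mul, norm_osc, one_mul]

theorem continuous_evolve (hA : Continuous A) (t : ℝ) : Continuous (evolve ε A t) :=
  (continuous_osc.comp (continuous_const.mul (continuous_const.mul continuous_bracket))).mul hA

theorem integrable_evolve (hA : Prof (k + 3) D A) (t : ℝ) : Integrable (evolve ε A t) :=
  ((hA.integrable (by omega)).norm).mono' (continuous_evolve hA.continuous t).aestronglyMeasurable
    (Eventually.of_forall fun ξ => (norm_evolve t ξ).le)

theorem integrable_norm_mul_dil (hA : Prof (k + 4) D A) (t : ℝ) :
    Integrable fun v : Plane => ‖v‖ * ‖dil (evolve ε A t) v‖ := by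
  have h1 : Integrable fun ξ : Plane => ‖(bracket ξ : ℂ) * A ξ‖ :=
    ((hA.bracket_mul (k := k + 3)).integrable (by omega)).norm
  refine (integrable_dil h1).mono' ?_ (Eventually.of_forall fun v => ?_)
  · have hd : Continuous (dil (evolve ε A t)) :=
      (continuous_evolve hA.continuous t).comp (continuous_const_smul _)
    exact (continuous_norm.mul hd.norm).aestronglyMeasurable
  · have hp := Real.pi_gt_three
    have h2 : ‖v‖ ≤ bracket ((2 * Real.pi) • v) := by
      refine le_trans ?_ (norm_le_bracket _)
      rw [norm_smul, Real.norm_of_nonneg (by positivity)]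
      nlinarith [norm_nonneg v]
    rw [norm_mul, norm_norm, norm_norm]
    change ‖v‖ * ‖evolve ε A t _‖ ≤ ‖((bracket ((2 * Real.pi) • v) : ℝ) : ℂ) * A _‖
    rw [norm_evolve, norm_mul, Complex.norm_real, Real.norm_of_nonneg (bracket_pos _).le]
    exact mul_le_mul_of_nonneg_right h2 (norm_nonneg _)

theorem differentiable_halfWave (hA : Prof (k + 4) D A) (t : ℝ) :
    Differentiable ℝ (halfWave ε A t) :=
  differentiable_fourierInv (integrable_dil (integrable_evolve (k := k + 1) hA t))
    (integrable_norm_mul_dil hA t)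

theorem pd_halfWave (hA : Prof (k + 4) D A) (j : Fin 2) (t : ℝ) (x : Plane) :
    pd j (halfWave ε A t) x
      = halfWave ε (fun ξ => Complex.I * (((ξ j : ℝ) : ℂ) * A ξ)) t x := by
  rw [pd, halfWave, fderiv_fourierInv (integrable_dil (integrable_evolve (k := k + 1) hA t))
    (integrable_norm_mul_dil hA t), halfWave]
  refine congrArg (fun f : Plane → ℂ => 𝓕⁻ f x) (funext fun y => ?_)
  have h : inner ℝ y (EuclideanSpace.single j (1 : ℝ)) = y j := by
    rw [EuclideanSpace.inner_single_right]
    simp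
  simp only [dil, evolve, h, PiLp.smul_apply, smul_eq_mul]
  push_cast
  ring

theorem halfWave_eq_integral (t : ℝ) (x : Plane) :
    halfWave ε A t x = ∫ v, osc (t * (ε * bracket ((2 * Real.pi) • v)))
      * (Complex.exp (2 * Real.pi * inner ℝ v x * Complex.I) * dil A v) := by
  rw [halfWave, Real.fourierInv_eq']
  refine integral_congr_ae (Eventually.of_forall fun v => ?_)
  simp only [dil, evolve, smul_eq_mul]
  push_cast
  ring

theorem hasDerivAt_halfWave (hA : Prof (k + 4) D A) (t : ℝ) (x : Plane) :
    HasDerivAt (fun t => halfWave ε A t x)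
      (halfWave ε (fun ξ => (Complex.I * ε) * ((bracket ξ : ℂ) * A ξ)) t x) t := by
  simp only [halfWave_eq_integral]
  have hθ : Continuous fun v : Plane => ε * bracket ((2 * Real.pi) • v) :=
    continuous_const.mul (continuous_bracket.comp (continuous_const_smul _))
  have hchar : Continuous fun v : Plane => Complex.exp (2 * Real.pi * inner ℝ v x * Complex.I) := by
    fun_prop
  have hd : ∀ {A : Plane → ℂ}, Continuous A → Continuous (dil A) := fun hA =>
    hA.comp (continuous_const_smul _)
  have hn : ∀ v : Plane, ‖Complex.exp (2 * Real.pi * inner ℝ v x * Complex.I)‖ ≤ 1 := fun v => by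
    have := Complex.norm_exp_ofReal_mul_I (2 * Real.pi * inner ℝ v x)
    push_cast at this
    exact this.le
  have i0 : Integrable fun v => Complex.exp (2 * Real.pi * inner ℝ v x * Complex.I) * dil A v :=
    (integrable_dil (hA.integrable (by omega))).bdd_mul (c := 1) hchar.aestronglyMeasurable
      (Eventually.of_forall hn)
  have hbA := (hA.bracket_mul (k := k + 3)).integrable (by omega)
  have i1 : Integrable fun v => ((ε * bracket ((2 * Real.pi) • v) : ℝ) : ℂ)
      * (Complex.exp (2 * Real.pi * inner ℝ v x * Complex.I) * dil A v) := by
    have h := ((integrable_dil hbA).const_mul (ε : ℂ)).bdd_mul (c := 1)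
      hchar.aestronglyMeasurable (Eventually.of_forall hn)
    refine h.congr (Eventually.of_forall fun v => ?_)
    simp only [dil]
    push_cast
    ring
  have hΨ : Continuous fun v => Complex.exp (2 * Real.pi * inner ℝ v x * Complex.I) * dil A v :=
    hchar.mul (hd hA.continuous)
  refine (hasDerivAt_integral_osc hθ hΨ i0 i1 t).congr_deriv ?_
  refine integral_congr_ae (Eventually.of_forall fun v => ?_)
  simp only [dil]
  push_cast
  ring

/-- The product becomes a convolution in which the two phases add; `fourierConst` is the Jacobian of
the change to angular frequency. -/
theorem halfWave_mul (hA : Prof (k + 3) D A) (hB : Prof (k + 3) D' B) (t : ℝ) (x : Plane) :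
    halfWave ε A t x * halfWave ε' B t x
      = 𝓕⁻ (dil fun ξ => srcInt ε ε' A B t ξ * (fourierConst : ℂ)) x := by
  rw [halfWave, halfWave, fourierInv_mul_fourierInv (integrable_dil (integrable_evolve hA t))
    (integrable_dil (integrable_evolve hB t))]
  refine congrArg (fun f : Plane → ℂ => 𝓕⁻ f x) (funext fun ζ => ?_)
  rw [integral_dil_mul_dil]
  simp only [dil]
  rw [mul_comm, srcInt]
  congr 1
  refine integral_congr_ae (Eventually.of_forall fun η => ?_)
  simp only [evolve, osc, biphase]
  rw [mul_add, Complex.ofReal_add, mul_add, Complex.exp_add]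
  ring

theorem integrable_dil_srcInt (hA : Prof (k + 3) D A) (hB : Prof (k + 3) D' B) (t : ℝ) :
    Integrable (dil fun ξ => srcInt ε ε' A B t ξ) := by
  refine integrable_dil ?_
  have h := integrable_convolution_mul (integrable_evolve (ε := ε) hA t)
    (integrable_evolve (ε := ε') hB t)
  refine h.congr (Eventually.of_forall fun ξ => ?_)
  refine integral_congr_ae (Eventually.of_forall fun η => ?_)
  simp only [evolve, osc, biphase]
  rw [mul_add, Complex.ofReal_add, mul_add, Complex.exp_add]
  ring

/-- The transform of the product is both integrable and square integrable, so the pointwise product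
and the `L²` inverse transform coincide. The vector `e` lets scalar products serve as components of
a vector field. -/
theorem exists_isSrc_halfWave {F : Type*} [NormedAddCommGroup F] [InnerProductSpace ℂ F]
    [CompleteSpace F] (m : ℕ) : ∃ K, 0 ≤ K ∧ ∀ {ε ε' : ℝ} {A B : Plane → ℂ} {DA DB : ℝ} {e : F},
    ε ^ 2 = 1 → ε' ^ 2 = 1 → Prof (m + 18) DA A → Prof (m + 18) DB B → ‖e‖ ≤ 1 →
    IsSrc m (K * (DA * DB)) fun s x => (halfWave ε A s x * halfWave ε' B s x) • e := by
  obtain ⟨K, hK, h⟩ := exists_isDecayingSolution (F := F) m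
  refine ⟨K, hK, ?_⟩
  intro ε ε' A B DA DB e hε hε' hA hB he
  have hq : ‖(fourierConst : ℂ) • e‖ ≤ 1 := by
    rw [norm_smul, Complex.norm_real]
    exact mul_le_one₀ abs_fourierConst_le (norm_nonneg _) he
  obtain ⟨Q, Q₁, hs⟩ := h (q := fun _ => (fourierConst : ℂ) • e) hε hε' hA hB
    stronglyMeasurable_const fun _ => hq
  have hint : ∀ s, Integrable (dil fun ξ => srcInt ε ε' A B s ξ • (fourierConst : ℂ) • e) :=
    fun s => (integrable_dil_srcInt (k := m + 15) hA hB s).smul_const _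
  have heq : ∀ s, (fun x => (halfWave ε A s x * halfWave ε' B s x) • e)
      = 𝓕⁻ (dil fun ξ => srcInt ε ε' A B s ξ • (fourierConst : ℂ) • e) := fun s => by
    ext1 x
    rw [halfWave_mul (k := m + 15) hA hB, Real.fourierInv_eq', Real.fourierInv_eq',
      ← integral_smul_const]
    refine integral_congr_ae (Eventually.of_forall fun v => ?_)
    simp only [dil, smul_smul, smul_eq_mul, mul_assoc]
  refine ⟨fun s => ?_, ⟨_, Q, Q₁, hs, fun s => ?_⟩⟩
  · rw [heq]
    exact memLp_fourierInv (hint s) (hs.memLp_source s)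
  · change toL2 (fun x => (halfWave ε A s x * halfWave ε' B s x) • e) = _
    rw [heq]
    exact toL2_fourierInv (hint s) (hs.memLp_source s)

end HalfWave

/-! ### Superpositions of half waves of both signs -/

section Waves

variable {u v : ℝ → Plane → ℂ} {D D' : ℝ} {k : ℕ}

/-- `u` is a superposition of two half waves of opposite signs with amplitudes decaying like
`D ⟨ξ⟩⁻ᵏ` together with two derivatives. -/
def IsWave (k : ℕ) (D : ℝ) (u : ℝ → Plane → ℂ) : Prop :=
  ∃ A B : Plane → ℂ, Prof k D A ∧ Prof k D B ∧
    ∀ t x, u t x = halfWave 1 A t x + halfWave (-1) B t x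

namespace IsWave

theorem nonneg (h : IsWave k D u) : 0 ≤ D := by
  obtain ⟨A, B, hA, -⟩ := h
  exact hA.nonneg

theorem mono (h : IsWave k D u) {j : ℕ} (hj : j ≤ k) (hD : D ≤ D') : IsWave j D' u := by
  obtain ⟨A, B, hA, hB, e⟩ := h
  exact ⟨A, B, hA.mono hj hD, hB.mono hj hD, e⟩

theorem differentiable (h : IsWave (k + 4) D u) (t : ℝ) : Differentiable ℝ (u t) := by
  obtain ⟨A, B, hA, hB, e⟩ := h
  rw [show u t = fun x => halfWave 1 A t x + halfWave (-1) B t x from funext (e t)]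
  exact (differentiable_halfWave hA t).add (differentiable_halfWave hB t)

theorem pd (h : IsWave (k + 4) D u) (j : Fin 2) :
    IsWave (k + 3) (16 * D) fun t x => pd j (u t) x := by
  obtain ⟨A, B, hA, hB, e⟩ := h
  have key : ∀ {A : Plane → ℂ}, Prof (k + 4) D A →
      Prof (k + 3) (16 * D) fun ξ => Complex.I * (((ξ j : ℝ) : ℂ) * A ξ) := fun hA =>
    ((hA.coord_mul (k := k + 3) j).const_mul Complex.I).mono le_rfl
      (le_of_eq (by rw [Complex.norm_I]; ring))
  refine ⟨_, _, key hA, key hB, fun t x => ?_⟩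
  rw [← pd_halfWave hA, ← pd_halfWave hB]
  change EulerPoisson.pd j (u t) x = _
  rw [show u t = fun x => halfWave 1 A t x + halfWave (-1) B t x from funext (e t),
    EulerPoisson.pd, fderiv_fun_add (differentiable_halfWave hA t x)
      (differentiable_halfWave hB t x)]
  rfl

theorem hasDerivAt (h : IsWave (k + 4) D u) : ∃ u' : ℝ → Plane → ℂ, IsWave (k + 3) (32 * D) u' ∧
    ∀ t x, HasDerivAt (fun s => u s x) (u' t x) t := by
  obtain ⟨A, B, hA, hB, e⟩ := h
  have key : ∀ {A : Plane → ℂ} {ε : ℝ}, ε ^ 2 = 1 → Prof (k + 4) D A →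
      Prof (k + 3) (32 * D) fun ξ => (Complex.I * ε) * ((bracket ξ : ℂ) * A ξ) := fun hε hA =>
    ((hA.bracket_mul (k := k + 3)).const_mul _).mono le_rfl (le_of_eq (by
      rw [norm_mul, Complex.norm_I, Complex.norm_real, one_mul, Real.norm_eq_abs,
        abs_eq_one_of_sq hε]
      ring))
  refine ⟨_, ⟨_, _, key (ε := 1) (by norm_num) hA, key (ε := -1) (by norm_num) hB,
    fun t x => rfl⟩, fun t x => ?_⟩
  rw [show (fun s => u s x) = fun s => halfWave 1 A s x + halfWave (-1) B s x from
    funext fun s => e s x]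
  exact (hasDerivAt_halfWave hA t x).add (hasDerivAt_halfWave hB t x)

theorem exists_isSrc_mul (F : Type*) [NormedAddCommGroup F] [InnerProductSpace ℂ F]
    [CompleteSpace F] (m : ℕ) : ∃ K, 0 ≤ K ∧ ∀ {u v : ℝ → Plane → ℂ} {D : ℝ} {e : F},
    IsWave (m + 18) D u → IsWave (m + 18) D v → ‖e‖ ≤ 1 →
    IsSrc m (K * D ^ 2) fun s x => (u s x * v s x) • e := by
  obtain ⟨K, hK, h⟩ := exists_isSrc_halfWave (F := F) m
  refine ⟨4 * K, by positivity, ?_⟩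
  rintro u v D e ⟨A, B, hA, hB, hu⟩ ⟨A', B', hA', hB', hv⟩ he
  have h1 : (1 : ℝ) ^ 2 = 1 := by norm_num
  have h2 : (-1 : ℝ) ^ 2 = 1 := by norm_num
  refine (((((h h1 h1 hA hA' he).add (h h1 h2 hA hB' he)).add (h h2 h1 hB hA' he)).add
    (h h2 h2 hB hB' he)).congr fun s x => ?_).mono (le_of_eq (by ring))
  rw [hu, hv, ← add_smul, ← add_smul, ← add_smul]
  congr 1
  ring

end IsWave

end Waves

/-! ### From the data norm to wave amplitudes -/

section Data

variable {F : Type*} [NormedAddCommGroup F] [InnerProductSpace ℂ F] [CompleteSpace F]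
variable {w : Plane → F} {k : ℕ} {D : ℝ}

theorem plane_eq (v : Plane) :
    v = v 0 • EuclideanSpace.single (0 : Fin 2) (1 : ℝ)
      + v 1 • EuclideanSpace.single (1 : Fin 2) (1 : ℝ) := by
  ext i
  fin_cases i <;> simp

theorem fderiv_apply_eq (w : Plane → F) (ξ v : Plane) :
    fderiv ℝ w ξ v = v 0 • pd 0 w ξ + v 1 • pd 1 w ξ := by
  conv_lhs => rw [plane_eq v, map_add, map_smul, map_smul]
  rfl

theorem contDiff_pd (hw : ContDiff ℝ 2 w) (j : Fin 2) : ContDiff ℝ 1 (pd j w) :=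
  (hw.fderiv_right (by norm_num [one_add_one_eq_two])).clm_apply contDiff_const

theorem pd_pd (hw : ContDiff ℝ 2 w) (i j : Fin 2) (ξ : Plane) :
    pd i (pd j w) ξ = fderiv ℝ (fderiv ℝ w) ξ (EuclideanSpace.single i 1)
      (EuclideanSpace.single j 1) := by
  have h : DifferentiableAt ℝ (fderiv ℝ w) ξ :=
    ((hw.fderiv_right (m := 1) (by norm_num [one_add_one_eq_two])).differentiable (by norm_num)) ξ
  have := (h.hasFDerivAt.clm_apply (hasFDerivAt_const (EuclideanSpace.single j (1 : ℝ)) ξ)).fderiv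
  change fderiv ℝ (fun x => fderiv ℝ w x (EuclideanSpace.single j 1)) ξ _ = _
  rw [this]
  simp

theorem pd_comm (hw : ContDiff ℝ 2 w) (ξ : Plane) : pd 1 (pd 0 w) ξ = pd 0 (pd 1 w) ξ := by
  rw [pd_pd hw, pd_pd hw]
  exact (hw.contDiffAt.isSymmSndFDerivAt (by simp)).eq _ _

theorem jetSum_eq (w : Plane → F) (ξ : Plane) :
    jetSum w ξ = ‖w ξ‖ + (‖pd 1 w ξ‖ + ‖pd 0 w ξ‖)
      + (‖pd 1 (pd 1 w) ξ‖ + ‖pd 0 (pd 1 w) ξ‖ + ‖pd 0 (pd 0 w) ξ‖) := by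
  simp [jetSum, Finset.sum_range_succ, Finset.Nat.antidiagonal_succ]
  ring

theorem jetSum_nonneg (w : Plane → F) (ξ : Plane) : 0 ≤ jetSum w ξ :=
  Finset.sum_nonneg fun _ _ => Finset.sum_nonneg fun _ _ => norm_nonneg _

theorem dd_clm_comp (L : F →L[ℂ] ℂ) (hw : Differentiable ℝ w) (v ξ : Plane) :
    dd v (fun ξ => L (w ξ)) ξ = L (fderiv ℝ w ξ v) := by
  have := ((L.restrictScalars ℝ).hasFDerivAt.comp ξ (hw ξ).hasFDerivAt).fderiv
  change fderiv ℝ (⇑(L.restrictScalars ℝ) ∘ w) ξ v = _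
  rw [this]
  rfl

/-- A second derivative in a direction of length at most one contains the mixed partial derivative
twice, while `jetSum` counts it once; hence the factor `2`. -/
theorem prof_of_jetSum (hw : ContDiff ℝ 2 w) (L : F →L[ℂ] ℂ) (hL : ‖L‖ ≤ 1)
    (h : ∀ ξ, bracket ξ ^ k * jetSum w ξ ≤ D) : Prof k (2 * D) fun ξ => L (w ξ) := by
  have hD : 0 ≤ D := le_trans (mul_nonneg (pow_nonneg (bracket_pos _).le _) (jetSum_nonneg w 0)) (h 0)
  have hjet : ∀ ξ, jetSum w ξ ≤ D * (bracket ξ ^ k)⁻¹ := fun ξ => by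
    rw [← div_eq_mul_inv, le_div_iff₀ (pow_pos (bracket_pos ξ) k), mul_comm]
    exact h ξ
  have hLn : ∀ z, ‖L z‖ ≤ ‖z‖ := fun z =>
    (L.le_opNorm z).trans (mul_le_of_le_one_left (norm_nonneg _) hL)
  refine ⟨by positivity, fun v hv => ?_⟩
  have hv' : ∀ i, ‖v i‖ ≤ 1 := fun i => (PiLp.norm_apply_le v i).trans hv
  have hcomb : ∀ y z : F, ‖v 0 • y + v 1 • z‖ ≤ ‖y‖ + ‖z‖ := fun y z => by
    refine (norm_add_le _ _).trans (add_le_add ?_ ?_) <;> rw [norm_smul]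
    · exact mul_le_of_le_one_left (norm_nonneg _) (hv' 0)
    · exact mul_le_of_le_one_left (norm_nonneg _) (hv' 1)
  have hd : Differentiable ℝ w := hw.differentiable (by norm_num)
  have hp : ∀ j, Differentiable ℝ (pd j w) := fun j => (contDiff_pd hw j).differentiable (by norm_num)
  have e1 : dd v (fun ξ => L (w ξ)) = fun ξ => L (v 0 • pd 0 w ξ + v 1 • pd 1 w ξ) := by
    ext ξ
    rw [dd_clm_comp L hd, fderiv_apply_eq]
  have hpd : ∀ i ξ, pd i (fun ξ => v 0 • pd 0 w ξ + v 1 • pd 1 w ξ) ξ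
      = v 0 • pd i (pd 0 w) ξ + v 1 • pd i (pd 1 w) ξ := fun i ξ => by
    have h1 := (((hp 0 ξ).hasFDerivAt.const_smul (v 0)).add
      ((hp 1 ξ).hasFDerivAt.const_smul (v 1))).fderiv
    change fderiv ℝ (v 0 • pd 0 w + v 1 • pd 1 w) ξ _ = _
    rw [h1]
    rfl
  have hdc : Differentiable ℝ fun ξ => v 0 • pd 0 w ξ + v 1 • pd 1 w ξ :=
    ((hp 0).const_smul _).add ((hp 1).const_smul _)
  refine ⟨(L.restrictScalars ℝ).contDiff.comp hw, fun ξ => ?_, fun ξ => ?_, fun ξ => ?_⟩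
  all_goals
    have hj := hjet ξ
    have hj0 := jetSum_nonneg w ξ
    have n1 := norm_nonneg (w ξ)
    have n2 := norm_nonneg (pd 0 w ξ)
    have n3 := norm_nonneg (pd 1 w ξ)
    have n4 := norm_nonneg (pd 0 (pd 0 w) ξ)
    have n5 := norm_nonneg (pd 0 (pd 1 w) ξ)
    have n6 := norm_nonneg (pd 1 (pd 1 w) ξ)
    have hs := jetSum_eq w ξ
  · refine (hLn _).trans ?_
    linarith
  · rw [e1]
    refine (hLn _).trans ((hcomb _ _).trans ?_)
    linarith
  · rw [e1, dd_clm_comp L hdc]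
    refine (hLn _).trans ?_
    rw [fderiv_apply_eq, hpd, hpd, pd_comm hw]
    refine (hcomb _ _).trans ((add_le_add (hcomb _ _) (hcomb _ _)).trans ?_)
    linarith

theorem fourier_eq_hat (f : Plane → F) (ζ : Plane) : 𝓕 f ζ = dil (hat f) ζ := by
  rw [dil, hat, smul_smul, inv_mul_cancel₀ (by positivity), one_smul]

theorem integrable_fourierChar_smul {a : Plane → F} (ha : Integrable a) (x : Plane) :
    Integrable fun v => Real.fourierChar (inner ℝ v x) • a v := by
  simpa using (Real.fourierIntegral_convergent_iff (-x)).2 ha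

theorem fourierInv_add_apply {a b : Plane → ℂ} (ha : Integrable a) (hb : Integrable b)
    (x : Plane) : 𝓕⁻ a x + 𝓕⁻ b x = 𝓕⁻ (fun ζ => a ζ + b ζ) x := by
  simp only [Real.fourierInv_eq, smul_add]
  exact (integral_add (integrable_fourierChar_smul ha x) (integrable_fourierChar_smul hb x)).symm

theorem clm_multiplier (L : F →L[ℂ] ℂ) {σ : Plane → ℝ} {f : Plane → F}
    (h : Integrable fun ξ => (σ ξ : ℂ) • hat f ξ) (x : Plane) :
    L (multiplier σ f x) = 𝓕⁻ (dil fun ξ => (σ ξ : ℂ) * L (hat f ξ)) x := by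
  have e : (fun ζ : Plane => (σ ((2 * Real.pi) • ζ) : ℂ) • 𝓕 f ζ)
      = dil fun ξ => (σ ξ : ℂ) • hat f ξ := by
    ext1 ζ
    rw [fourier_eq_hat]
    rfl
  rw [multiplier, e, Real.fourierInv_eq, Real.fourierInv_eq,
    ← L.integral_comp_comm (integrable_fourierChar_smul (integrable_dil h) x)]
  refine integral_congr_ae (Eventually.of_forall fun ζ => ?_)
  simp only [dil, Circle.smul_def, map_smul, smul_eq_mul]

theorem integrable_sin_div_bracket_smul {w : Plane → F} (hw : Integrable w) (hc : Continuous w)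
    (t : ℝ) : Integrable fun ξ => ((Real.sin (t * bracket ξ) / bracket ξ : ℝ) : ℂ) • w ξ := by
  refine hw.norm.mono' (Continuous.aestronglyMeasurable ?_) (Eventually.of_forall fun ξ => ?_)
  · have h1 : Continuous fun ξ : Plane => Real.sin (t * bracket ξ) / bracket ξ :=
      (Real.continuous_sin.comp (continuous_const.mul continuous_bracket)).div continuous_bracket
        fun ξ => (bracket_pos ξ).ne'
    exact (Complex.continuous_ofReal.comp h1).smul hc
  · rw [norm_smul, Complex.norm_real, norm_div, Real.norm_of_nonneg (bracket_pos ξ).le]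
    refine mul_le_of_le_one_left (norm_nonneg _) ?_
    rw [div_le_one (bracket_pos ξ)]
    exact (Real.abs_sin_le_one _).trans (one_le_bracket ξ)

theorem integrable_cos_smul {w : Plane → F} (hw : Integrable w) (hc : Continuous w)
    (t : ℝ) : Integrable fun ξ => ((Real.cos (t * bracket ξ) : ℝ) : ℂ) • w ξ := by
  refine hw.norm.mono' (Continuous.aestronglyMeasurable ?_) (Eventually.of_forall fun ξ => ?_)
  · have h1 : Continuous fun ξ : Plane => Real.cos (t * bracket ξ) :=
      Real.continuous_cos.comp (continuous_const.mul continuous_bracket)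
    exact (Complex.continuous_ofReal.comp h1).smul hc
  · rw [norm_smul, Complex.norm_real]
    exact mul_le_of_le_one_left (norm_nonneg _) (Real.abs_cos_le_one _)

/-- Euler's formula gives the amplitudes `(f̂ ∓ i⟨ξ⟩⁻¹ĝ)/2`. Their constant is `2D + 2 · 48 D`,
which is below `200 D`; two powers of decay are lost in `Prof.inv_bracket_mul`. -/
theorem isWave_linearSol {f g : Plane → F} (L : F →L[ℂ] ℂ) (hf : Integrable (hat f))
    (hg : Integrable (hat g)) (hcf : Continuous (hat f)) (hcg : Continuous (hat g))
    (pf : Prof (k + 5) D fun ξ => L (hat f ξ)) (pg : Prof (k + 5) D fun ξ => L (hat g ξ)) :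
    IsWave (k + 3) (200 * D) fun t x => L (linearSol f g t x) := by
  have hD := pf.nonneg
  have key : ∀ c : ℂ, ‖c‖ = 1 / 2 →
      Prof (k + 3) (200 * D) fun ξ => (1 / 2 : ℂ) * L (hat f ξ)
        + c * ((((bracket ξ)⁻¹ : ℝ) : ℂ) * L (hat g ξ)) := fun c hc =>
    (((pf.mono (by omega) le_rfl).const_mul (1 / 2)).add
      ((pg.inv_bracket_mul (k := k + 3)).const_mul c)).mono le_rfl (by
        rw [hc]
        norm_num
        linarith)
  have k1 := key (-Complex.I / 2) (by simp)
  have k2 := key (Complex.I / 2) (by simp)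
  refine ⟨_, _, k1, k2, fun t x => ?_⟩
  have i1 := integrable_cos_smul hf hcf t
  have i2 := integrable_sin_div_bracket_smul hg hcg t
  change L (linearSol f g t x) = _
  rw [linearSol, map_add, clm_multiplier L i1, clm_multiplier L i2, halfWave, halfWave,
    fourierInv_add_apply (integrable_dil ?_) (integrable_dil ?_),
    fourierInv_add_apply (integrable_dil (integrable_evolve k1 t))
      (integrable_dil (integrable_evolve k2 t))]
  · refine congrArg (fun f : Plane → ℂ => 𝓕⁻ f x) (funext fun ζ => ?_)
    simp only [dil, evolve, osc]
    set b := bracket ((2 * Real.pi) • ζ)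
    push_cast
    rw [Complex.cos, Complex.sin]
    have hI : Complex.I * Complex.I = -1 := Complex.I_mul_I
    rw [show Complex.I * ((t : ℂ) * (1 * (b : ℂ))) = (t : ℂ) * b * Complex.I by ring,
      show Complex.I * ((t : ℂ) * (-1 * (b : ℂ))) = -((t : ℂ) * b) * Complex.I by ring,
      div_eq_mul_inv _ (b : ℂ)]
    ring
  · simpa only [smul_eq_mul, map_smul] using L.integrable_comp i1
  · simpa only [smul_eq_mul, map_smul] using L.integrable_comp i2

end Data

/-! ### Quadratic expressions in waves -/

section Quadratic

variable {k n n' : ℕ} {D D' : ℝ} {q q' : ℝ → Plane → ℂ}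

/-- `q` is a sum of `n` products of two waves. -/
inductive IsQuad (k : ℕ) (D : ℝ) : ℕ → (ℝ → Plane → ℂ) → Prop
  | mul {a b : ℝ → Plane → ℂ} : IsWave k D a → IsWave k D b →
      IsQuad k D 1 fun t x => a t x * b t x
  | add {n n' : ℕ} {q q' : ℝ → Plane → ℂ} : IsQuad k D n q → IsQuad k D n' q' →
      IsQuad k D (n + n') fun t x => q t x + q' t x

namespace IsQuad

theorem congr (h : IsQuad k D n q) (hn : n = n') (he : ∀ t x, q t x = q' t x) :
    IsQuad k D n' q' := by
  subst hn
  rwa [← show q = q' from funext fun t => funext fun x => he t x]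

theorem differentiable (h : IsQuad (k + 4) D n q) (t : ℝ) : Differentiable ℝ (q t) := by
  induction h with
  | mul ha hb => exact (ha.differentiable t).mul (hb.differentiable t)
  | add _ _ h h' => exact h.add h'

theorem pd (h : IsQuad (k + 4) D n q) (j : Fin 2) :
    IsQuad (k + 3) (16 * D) (2 * n) fun t x => pd j (q t) x := by
  induction h with
  | @mul a b ha hb =>
    have hD := ha.nonneg
    have ha' := ha.mono (D' := 16 * D) (j := k + 3) (by omega) (by linarith)
    have hb' := hb.mono (D' := 16 * D) (j := k + 3) (by omega) (by linarith)
    refine ((IsQuad.mul ha' (hb.pd j)).add (IsQuad.mul hb' (ha.pd j))).congr rfl fun t x => ?_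
    have := ((ha.differentiable t x).hasFDerivAt.mul (hb.differentiable t x).hasFDerivAt).fderiv
    change _ = fderiv ℝ (a t * b t) x _
    rw [this]
    rfl
  | @add n n' q q' hq hq' h h' =>
    refine (h.add h').congr (mul_add 2 n n').symm fun t x => ?_
    have := ((hq.differentiable t x).hasFDerivAt.add (hq'.differentiable t x).hasFDerivAt).fderiv
    change _ = fderiv ℝ (q t + q' t) x _
    rw [this]
    rfl

theorem hasDerivAt (h : IsQuad (k + 4) D n q) : ∃ q', IsQuad (k + 3) (32 * D) (2 * n) q' ∧
    ∀ t x, HasDerivAt (fun s => q s x) (q' t x) t := by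
  induction h with
  | @mul a b ha hb =>
    have hD := ha.nonneg
    have ha' := ha.mono (D' := 32 * D) (j := k + 3) (by omega) (by linarith)
    have hb' := hb.mono (D' := 32 * D) (j := k + 3) (by omega) (by linarith)
    obtain ⟨da, hda, ea⟩ := ha.hasDerivAt
    obtain ⟨db, hdb, eb⟩ := hb.hasDerivAt
    exact ⟨_, (IsQuad.mul hda hb').add (IsQuad.mul ha' hdb), fun t x => (ea t x).mul (eb t x)⟩
  | @add n n' q q' hq hq' h h' =>
    obtain ⟨dq, hdq, e⟩ := h
    obtain ⟨dq', hdq', e'⟩ := h'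
    exact ⟨_, (hdq.add hdq').congr (mul_add 2 n n').symm fun _ _ => rfl,
      fun t x => (e t x).add (e' t x)⟩

theorem exists_isSrc (F : Type*) [NormedAddCommGroup F] [InnerProductSpace ℂ F]
    [CompleteSpace F] (m : ℕ) : ∃ K, 0 ≤ K ∧ ∀ {n : ℕ} {q : ℝ → Plane → ℂ} {D : ℝ} {e : F},
    IsQuad (m + 18) D n q → ‖e‖ ≤ 1 → IsSrc m (n * (K * D ^ 2)) fun s x => q s x • e := by
  obtain ⟨K, hK, h⟩ := IsWave.exists_isSrc_mul F m
  refine ⟨K, hK, ?_⟩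
  intro n q D e hq he
  induction hq with
  | mul ha hb => exact (h ha hb he).mono (by simp)
  | add _ _ h h' =>
    refine ((h.add h').congr fun s x => (add_smul _ _ _).symm).mono (le_of_eq ?_)
    push_cast
    ring

end IsQuad

end Quadratic

/-! ### Components of vector fields -/

section Components

theorem differentiable_vec {v : Plane → Vec} (h : ∀ j, Differentiable ℝ fun x => v x j) :
    Differentiable ℝ v := (differentiable_piLp 2).2 h

theorem pd_apply {v : Plane → Vec} (h : ∀ j, Differentiable ℝ fun x => v x j) (i j : Fin 2)
    (x : Plane) : pd i v x j = pd i (fun y => v y j) x := by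
  have hv := (differentiable_vec h x).hasFDerivAt
  have := ((PiLp.hasFDerivAt_apply (𝕜 := ℝ) 2 (v x) j).comp x hv).fderiv
  change _ = fderiv ℝ ((fun f : Vec => f j) ∘ v) x _
  rw [this]
  rfl

theorem hasDerivAt_vec {w : ℝ → Vec} {w' : Fin 2 → ℂ} {t : ℝ}
    (h : ∀ j, HasDerivAt (fun s => w s j) (w' j) t) : HasDerivAt w (WithLp.toLp 2 w') t := by
  have h1 := (PiLp.hasFDerivAt_toLp (𝕜 := ℝ) 2 (fun j => w t j)).comp_hasDerivAt t
    (hasDerivAt_pi.2 h)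
  exact h1

end Components

/-! ### The fluxes as sums of products of waves -/

section Nonlinearity

variable {m : ℕ} {D : ℝ} {u : ℝ → Plane → ℂ} {v : ℝ → Plane → Vec}

theorem isQuad_massFlux (hu : IsWave (m + 20) D u) (hv : ∀ j, IsWave (m + 20) D fun t x => v t x j) :
    IsQuad (m + 19) (16 * D) 4 fun t x => massFlux (u t) (v t) x := by
  have hD := hu.nonneg
  have hu' := hu.mono (D' := 16 * D) (j := m + 19) (by omega) (by linarith)
  have hv' := fun j => (hv j).mono (D' := 16 * D) (j := m + 19) (by omega) (by linarith)
  have hup := fun j => hu.pd (k := m + 16) j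
  have hvp := fun i j => (hv i).pd (k := m + 16) j
  refine (((IsQuad.mul (hv' 0) (hup 0)).add (.mul (hv' 1) (hup 1))).add
    ((IsQuad.mul hu' (hvp 0 0)).add (.mul hu' (hvp 1 1)))).congr rfl fun t x => ?_
  have hd := fun j => (hv j).differentiable (k := m + 16) t
  simp only [massFlux, advect, divergence, Fin.sum_univ_two, smul_eq_mul, pd_apply hd]
  ring

theorem isQuad_momentumFlux (hu : IsWave (m + 20) D u)
    (hv : ∀ j, IsWave (m + 20) D fun t x => v t x j) (j : Fin 2) :
    IsQuad (m + 19) (16 * D) 3 fun t x => momentumFlux (u t) (v t) x j := by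
  have hD := hu.nonneg
  have hu' := hu.mono (D' := 16 * D) (j := m + 19) (by omega) (by linarith)
  have hv' := fun j => (hv j).mono (D' := 16 * D) (j := m + 19) (by omega) (by linarith)
  refine (((IsQuad.mul (hv' 0) ((hv j).pd (k := m + 16) 0)).add
    (.mul (hv' 1) ((hv j).pd (k := m + 16) 1))).add
    (IsQuad.mul hu' (hu.pd (k := m + 16) j))).congr rfl fun t x => ?_
  have hd := fun j => (hv j).differentiable (k := m + 16) t
  simp [momentumFlux, advect, grad, Fin.sum_univ_two, pd_apply hd]

end Nonlinearity

/-! ### The nonlinearities as admissible sources -/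

section Sources

theorem exists_isSrc_G₁ (m : ℕ) : ∃ K, 0 ≤ K ∧ ∀ {D : ℝ} {u : ℝ → Plane → ℂ} {v : ℝ → Plane → Vec},
    IsWave (m + 20) D u → (∀ j, IsWave (m + 20) D fun t x => v t x j) →
    IsSrc m (K * D ^ 2) (G₁ u v) := by
  obtain ⟨K, hK, h⟩ := IsQuad.exists_isSrc ℂ m
  -- The divergence gives two derivatives of three products, `2 · (3 + 3) = 12` terms with constant
  -- `16 · 16 D`; the time derivative of four products gives `8` terms with constant `32 · 16 D`.
  refine ⟨12 * (K * 256 ^ 2) + 8 * (K * 512 ^ 2), by positivity, ?_⟩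
  intro D u v hu hv
  have hmom := isQuad_momentumFlux hu hv
  obtain ⟨q, hq, eq⟩ := (isQuad_massFlux hu hv).hasDerivAt (k := m + 15)
  have h1 := h (e := 1) (((hmom 0).pd (k := m + 15) 0).add ((hmom 1).pd (k := m + 15) 1)) (by simp)
  have h2 := h (e := 1) hq (by simp)
  refine ((h1.sub h2).congr fun s x => ?_).mono (le_of_eq ?_)
  · have hd := fun j => (hmom j).differentiable (k := m + 15) s
    rw [G₁, (eq s x).deriv, divergence, Fin.sum_univ_two, pd_apply hd, pd_apply hd]
    simp only [smul_eq_mul, mul_one]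
  · push_cast
    ring

theorem vec_eq (z : Vec) : z 0 • EuclideanSpace.single (0 : Fin 2) (1 : ℂ)
    + z 1 • EuclideanSpace.single (1 : Fin 2) (1 : ℂ) = z := by
  ext i
  fin_cases i <;> simp

theorem norm_single_one_le (j : Fin 2) : ‖(EuclideanSpace.single j (1 : ℂ) : Vec)‖ ≤ 1 := by
  simp

theorem exists_isSrc_G₂local (m : ℕ) : ∃ K, 0 ≤ K ∧
    ∀ {D : ℝ} {u : ℝ → Plane → ℂ} {v : ℝ → Plane → Vec},
    IsWave (m + 20) D u → (∀ j, IsWave (m + 20) D fun t x => v t x j) →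
    IsSrc m (K * D ^ 2) (G₂local u v) := by
  obtain ⟨K, hK, h⟩ := IsQuad.exists_isSrc Vec m
  refine ⟨16 * (K * 256 ^ 2) + 12 * (K * 512 ^ 2), by positivity, ?_⟩
  intro D u v hu hv
  have hmass := isQuad_massFlux hu hv
  choose q hq eq using fun j => (isQuad_momentumFlux hu hv j).hasDerivAt (k := m + 15)
  have h1 := fun j => h (hmass.pd (k := m + 15) j) (norm_single_one_le j)
  have h2 := fun j => h (hq j) (norm_single_one_le j)
  refine ((((h1 0).add (h1 1)).sub ((h2 0).add (h2 1))).congr fun s x => ?_).mono (le_of_eq ?_)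
  · rw [G₂local, (hasDerivAt_vec fun j => eq j s x).deriv, ← vec_eq (grad _ x),
      ← vec_eq (WithLp.toLp 2 fun j => q j s x)]
    rfl
  · push_cast
    ring

theorem exists_isSrc_smul (m : ℕ) : ∃ K, 0 ≤ K ∧
    ∀ {D : ℝ} {u : ℝ → Plane → ℂ} {v : ℝ → Plane → Vec},
    IsWave (m + 20) D u → (∀ j, IsWave (m + 20) D fun t x => v t x j) →
    IsSrc m (K * D ^ 2) fun s x => u s x • v s x := by
  obtain ⟨K, hK, h⟩ := IsWave.exists_isSrc_mul Vec m
  refine ⟨2 * K, by positivity, ?_⟩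
  intro D u v hu hv
  have h1 := fun j => h (hu.mono (by omega) le_rfl) ((hv j).mono (by omega) le_rfl)
    (norm_single_one_le j)
  refine (((h1 0).add (h1 1)).congr fun s x => ?_).mono (le_of_eq (by ring))
  rw [mul_smul, mul_smul, ← smul_add, vec_eq]

end Sources

/-! ### The nonlocal term `∇Δ⁻¹∇·(uv)` -/

section Projection

/-- The inclusion of the real frequency plane in `ℂ²`. -/
def complexify (ξ : Plane) : Vec := WithLp.toLp 2 fun j => ((ξ j : ℝ) : ℂ)

theorem norm_complexify (ξ : Plane) : ‖complexify ξ‖ = ‖ξ‖ := by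
  simp [complexify, EuclideanSpace.norm_eq]

theorem continuous_complexify : Continuous complexify := by
  unfold complexify
  fun_prop

/-- The orthogonal projection on the line spanned by `ξ`, the symbol of `∇Δ⁻¹∇·`. -/
def projSymbol (ξ : Plane) : Vec →L[ℂ] Vec :=
  (((‖ξ‖ ^ 2)⁻¹ : ℝ) : ℂ) • InnerProductSpace.rankOne ℂ (complexify ξ) (complexify ξ)

theorem norm_projSymbol_le (ξ : Plane) : ‖projSymbol ξ‖ ≤ 1 := by
  rw [projSymbol, norm_smul, InnerProductSpace.norm_rankOne, norm_complexify, Complex.norm_real,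
    Real.norm_of_nonneg (by positivity), ← sq]
  exact inv_mul_le_one

theorem stronglyMeasurable_projSymbol : StronglyMeasurable projSymbol := by
  have h1 : Measurable fun ξ : Plane => (((‖ξ‖ ^ 2)⁻¹ : ℝ) : ℂ) := by fun_prop
  have h2 : Continuous fun ξ : Plane =>
      InnerProductSpace.rankOne ℂ (complexify ξ) (complexify ξ) := by
    refine continuous_clm_apply.2 fun z => ?_
    simp only [InnerProductSpace.rankOne_apply]
    exact (continuous_complexify.inner (𝕜 := ℂ) continuous_const).smul continuous_complexify
  exact h1.stronglyMeasurable.smul h2.stronglyMeasurable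

/-- The two factors `i` cancel the sign of the Laplacian. At `ξ = 0` both sides vanish because the
inverse of zero is zero. -/
theorem gradInvLapDiv_eq : gradInvLapDiv = l2Multiplier fun ξ v => projSymbol ξ v := by
  unfold gradInvLapDiv
  congr 1
  ext ξ v j
  simp only [projSymbol, complexify, smul_apply, InnerProductSpace.rankOne_apply, PiLp.smul_apply,
    smul_eq_mul, PiLp.inner_apply, RCLike.inner_apply, Complex.conj_ofReal, Fin.sum_univ_two]
  push_cast
  linear_combination (-(ξ j : ℂ) * (ξ 0 * v 0 + ξ 1 * v 1) * ((‖ξ‖ : ℂ) ^ 2)⁻¹) * Complex.I_mul_I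

theorem exists_hasSol_G₂ (m : ℕ) : ∃ K, 0 ≤ K ∧
    ∀ {D : ℝ} {u : ℝ → Plane → ℂ} {v : ℝ → Plane → Vec},
    IsWave (m + 20) D u → (∀ j, IsWave (m + 20) D fun t x => v t x j) →
    (∀ s, MemLp (G₂local u v s) 2 volume) ∧ (∀ s, MemLp (fun x => u s x • v s x) 2 volume) ∧
    HasSol m (K * D ^ 2) (G₂L2 u v) := by
  obtain ⟨K, hK, h⟩ := exists_isSrc_G₂local m
  obtain ⟨K', hK', h'⟩ := exists_isSrc_smul m
  refine ⟨K + K', by positivity, ?_⟩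
  intro D u v hu hv
  refine ⟨(h hu hv).mem, (h' hu hv).mem, ?_⟩
  have := ((h hu hv).sol.sub ((h' hu hv).sol.multiplier projSymbol stronglyMeasurable_projSymbol
    norm_projSymbol_le)).mono (le_of_eq (add_mul K K' (D ^ 2)).symm)
  rw [← gradInvLapDiv_eq] at this
  exact this

end Projection

/-! ### Assembly of the estimate -/

section Conclusion

variable {F : Type*} [NormedAddCommGroup F] [InnerProductSpace ℂ F] [CompleteSpace F]

theorem integrable_of_jetSum {w : Plane → F} {k : ℕ} {D : ℝ} (hw : Continuous w) (hk : 3 ≤ k)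
    (h : ∀ ξ, bracket ξ ^ k * jetSum w ξ ≤ D) : Integrable w := by
  refine ((integrable_inv_bracket_pow hk).const_mul D).mono' hw.aestronglyMeasurable
    (Eventually.of_forall fun ξ => ?_)
  rw [← div_eq_mul_inv, le_div_iff₀ (pow_pos (bracket_pos ξ) k), mul_comm]
  refine le_trans (mul_le_mul_of_nonneg_left ?_ (pow_nonneg (bracket_pos ξ).le _)) (h ξ)
  rw [jetSum_eq]
  have n2 := norm_nonneg (pd 0 w ξ)
  have n3 := norm_nonneg (pd 1 w ξ)
  have n4 := norm_nonneg (pd 0 (pd 0 w) ξ)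
  have n5 := norm_nonneg (pd 0 (pd 1 w) ξ)
  have n6 := norm_nonneg (pd 1 (pd 1 w) ξ)
  linarith

theorem isWave_linearSol_of_jetSum {f g : Plane → F} {m : ℕ} {D : ℝ} (hf : ContDiff ℝ 2 (hat f))
    (hg : ContDiff ℝ 2 (hat g)) (bf : ∀ ξ, bracket ξ ^ (m + 24) * jetSum (hat f) ξ ≤ D)
    (bg : ∀ ξ, bracket ξ ^ (m + 24) * jetSum (hat g) ξ ≤ D) (L : F →L[ℂ] ℂ) (hL : ‖L‖ ≤ 1) :
    IsWave (m + 20) (400 * D) fun t x => L (linearSol f g t x) := by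
  have pf := prof_of_jetSum hf L hL bf
  have pg := prof_of_jetSum hg L hL bg
  -- From the exponent `m + 24 = (m + 19) + 5` this yields waves of decay `m + 22`. Decay `m + 20`
  -- suffices: `m + 18` for a product of waves and one more for each of the two derivatives in the
  -- nonlinearities.
  have h := isWave_linearSol (k := m + 19) L
    (integrable_of_jetSum hf.continuous (by omega) bf)
    (integrable_of_jetSum hg.continuous (by omega) bg) hf.continuous hg.continuous pf pg
  exact h.mono (by omega) (le_of_eq (by ring))

theorem HasSol.duhamel {m : ℕ} {D : ℝ} {G : ℝ → Lp F 2 (volume : Measure Plane)}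
    (h : HasSol m D G) :
    (∀ T t : ℝ, IntervalIntegrable (fun s => propagator (t - s) (G s)) volume T t) ∧
    (∀ t : ℝ, Tendsto (fun T : ℝ => duhamel G T t) atTop (𝓝 (duhamelInfty G t))) ∧
    Differentiable ℝ (duhamelInfty G) ∧
    ∀ t : ℝ, ENNReal.ofReal (bracket t) * (sobolevNorm (m + 2) (duhamelInfty G t)
      + sobolevNorm (m + 2) (deriv (duhamelInfty G) t)) ≤ ENNReal.ofReal D * (4 * bracketMass) := by
  obtain ⟨g, Q, Q₁, hs, hG⟩ := h
  refine ⟨fun T t => hs.intervalIntegrable hG t T t, fun t => ?_,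
    fun t => (hs.hasDerivAt_duhamelInfty hG t).differentiableAt, hs.estimate hG⟩
  rw [hs.duhamelInfty_eq hG]
  exact hs.tendsto_duhamel hG t

theorem bound_of_dataNorm {m : ℕ} {f₁ g₁ : Plane → ℂ} {f₂ g₂ : Plane → Vec}
    (h : dataNorm m f₁ g₁ f₂ g₂ < ∞) (ξ : Plane) :
    bracket ξ ^ (m + 24) * (jetSum (hat f₁) ξ + jetSum (hat f₂) ξ + jetSum (hat g₁) ξ
      + jetSum (hat g₂) ξ) ≤ (dataNorm m f₁ g₁ f₂ g₂).toReal := by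
  rw [← ENNReal.ofReal_le_iff_le_toReal h.ne]
  exact le_iSup (fun ξ : Plane => ENNReal.ofReal (bracket ξ ^ (m + 24) *
    (jetSum (hat f₁) ξ + jetSum (hat f₂) ξ + jetSum (hat g₁) ξ + jetSum (hat g₂) ξ))) ξ

theorem ofReal_mul_sq_mul_le {K : ℝ} (hK : 0 ≤ K) {N M : ℝ≥0∞} (hN : N < ∞) (hM : M < ∞) :
    ENNReal.ofReal (K * N.toReal ^ 2) * M ≤ (K.toNNReal * M.toNNReal : ℝ≥0) * N ^ 2 := by
  rw [ENNReal.ofReal_mul hK, ENNReal.ofReal_pow ENNReal.toReal_nonneg, ENNReal.ofReal_toReal hN.ne,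
    ENNReal.coe_mul, ENNReal.coe_toNNReal hM.ne, mul_right_comm]
  rfl

end Conclusion

end EulerPoisson

end

theorem mainTheorem2 (m : ℕ) :
    ∃ C : ℝ≥0, ∀ (f₁ g₁ : Plane → ℂ) (f₂ g₂ : Plane → Vec),
      Integrable f₁ → Integrable g₁ → Integrable f₂ → Integrable g₂ →
      ContDiff ℝ 2 (hat f₁) → ContDiff ℝ 2 (hat g₁) →
      ContDiff ℝ 2 (hat f₂) → ContDiff ℝ 2 (hat g₂) →
      dataNorm m f₁ g₁ f₂ g₂ < ∞ →
      -- the sources are square integrable and the Duhamel integrals are genuine integrals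
      (∀ s, MemLp (G₁ (linearSol f₁ g₁) (linearSol f₂ g₂) s) 2 volume ∧
        MemLp (G₂local (linearSol f₁ g₁) (linearSol f₂ g₂) s) 2 volume ∧
        MemLp (fun x => linearSol f₁ g₁ s x • linearSol f₂ g₂ s x) 2 volume) ∧
      (∀ T t : ℝ,
        IntervalIntegrable
          (fun s => propagator (t - s) (G₁L2 (linearSol f₁ g₁) (linearSol f₂ g₂) s)) volume T t ∧
        IntervalIntegrable
          (fun s => propagator (t - s) (G₂L2 (linearSol f₁ g₁) (linearSol f₂ g₂) s)) volume T t) ∧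
      -- they converge in `L²` as the starting time goes to infinity
      (∀ t : ℝ,
        Tendsto (fun T : ℝ => duhamel (G₁L2 (linearSol f₁ g₁) (linearSol f₂ g₂)) T t) atTop
          (𝓝 (Φ₁ f₁ g₁ f₂ g₂ t)) ∧
        Tendsto (fun T : ℝ => duhamel (G₂L2 (linearSol f₁ g₁) (linearSol f₂ g₂)) T t) atTop
          (𝓝 (Φ₂ f₁ g₁ f₂ g₂ t))) ∧
      -- the limits are differentiable in time and satisfy the estimate
      Differentiable ℝ (Φ₁ f₁ g₁ f₂ g₂) ∧ Differentiable ℝ (Φ₂ f₁ g₁ f₂ g₂) ∧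
      (∀ t : ℝ,
        ENNReal.ofReal (bracket t) * (sobolevNorm (m + 2) (Φ₁ f₁ g₁ f₂ g₂ t)
            + sobolevNorm (m + 2) (deriv (Φ₁ f₁ g₁ f₂ g₂) t))
          ≤ C * dataNorm m f₁ g₁ f₂ g₂ ^ 2) ∧
      (∀ t : ℝ,
        ENNReal.ofReal (bracket t) * (sobolevNorm (m + 2) (Φ₂ f₁ g₁ f₂ g₂ t)
            + sobolevNorm (m + 2) (deriv (Φ₂ f₁ g₁ f₂ g₂) t))
          ≤ C * dataNorm m f₁ g₁ f₂ g₂ ^ 2) := by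
  obtain ⟨K₁, hK₁, h₁⟩ := exists_isSrc_G₁ m
  obtain ⟨K₂, hK₂, h₂⟩ := exists_hasSol_G₂ m
  -- Both components of the solution are waves with constant `400 N`, and the sources are quadratic
  -- in it; the sum of `K₁` and `K₂` serves both estimates.
  set K : ℝ := (K₁ + K₂) * 400 ^ 2 with hK
  have hK0 : 0 ≤ K := by positivity
  have hM : 4 * bracketMass < ∞ := ENNReal.mul_lt_top (by simp) bracketMass_lt_top
  refine ⟨K.toNNReal * (4 * bracketMass).toNNReal, ?_⟩
  intro f₁ g₁ f₂ g₂ _ _ _ _ cf₁ cg₁ cf₂ cg₂ hN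
  set N := (dataNorm m f₁ g₁ f₂ g₂).toReal with hNdef
  have hN0 : 0 ≤ N := ENNReal.toReal_nonneg
  have hb := bound_of_dataNorm hN
  have hj1 := jetSum_nonneg (hat f₁)
  have hj2 := jetSum_nonneg (hat f₂)
  have hj3 := jetSum_nonneg (hat g₁)
  have hj4 := jetSum_nonneg (hat g₂)
  have hp := fun ξ : Plane => pow_nonneg (bracket_pos ξ).le (m + 24)
  have w₁ : IsWave (m + 20) (400 * N) (linearSol f₁ g₁) :=
    isWave_linearSol_of_jetSum cf₁ cg₁
      (fun ξ => (mul_le_mul_of_nonneg_left (by linarith [hj2 ξ, hj3 ξ, hj4 ξ]) (hp ξ)).trans (hb ξ))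
      (fun ξ => (mul_le_mul_of_nonneg_left (by linarith [hj1 ξ, hj2 ξ, hj4 ξ]) (hp ξ)).trans (hb ξ))
      (ContinuousLinearMap.id ℂ ℂ) ContinuousLinearMap.norm_id_le
  have w₂ : ∀ j, IsWave (m + 20) (400 * N) fun t x => linearSol f₂ g₂ t x j := fun j =>
    isWave_linearSol_of_jetSum cf₂ cg₂
      (fun ξ => (mul_le_mul_of_nonneg_left (by linarith [hj1 ξ, hj3 ξ, hj4 ξ]) (hp ξ)).trans (hb ξ))
      (fun ξ => (mul_le_mul_of_nonneg_left (by linarith [hj1 ξ, hj2 ξ, hj3 ξ]) (hp ξ)).trans (hb ξ))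
      (PiLp.proj 2 (fun _ : Fin 2 => ℂ) j)
      (ContinuousLinearMap.opNorm_le_bound _ zero_le_one fun z => by
        rw [one_mul]
        exact PiLp.norm_apply_le z j)
  have s₁ := h₁ w₁ w₂
  obtain ⟨m₂, m₃, s₂⟩ := h₂ w₁ w₂
  have hle₁ : K₁ * (400 * N) ^ 2 ≤ K * N ^ 2 := by
    rw [hK]
    nlinarith [mul_nonneg hK₂ (sq_nonneg N)]
  have hle₂ : K₂ * (400 * N) ^ 2 ≤ K * N ^ 2 := by
    rw [hK]
    nlinarith [mul_nonneg hK₁ (sq_nonneg N)]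
  obtain ⟨a₁, b₁, c₁, d₁⟩ := (s₁.sol.mono hle₁).duhamel
  obtain ⟨a₂, b₂, c₂, d₂⟩ := (s₂.mono hle₂).duhamel
  have hfin := ofReal_mul_sq_mul_le hK0 hN hM
  exact ⟨fun s => ⟨s₁.mem s, m₂ s, m₃ s⟩, fun T t => ⟨a₁ T t, a₂ T t⟩, fun t => ⟨b₁ t, b₂ t⟩,
    c₁, c₂, fun t => (d₁ t).trans hfin, fun t => (d₂ t).trans hfin⟩
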